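/- **Setting.** For each $n$ let $P_n$ be a probability measure on $\mathbb{R}^{d_n}$ with finite 12th moment, let $X^n=(X^n_1,\dots,X^n_n)$ be i.i.d. with law $P_n$, let $Y^n$ be an independent copy of $X^n$, and let $Z^n$ be a bootstrap sample: conditionally on $(X^n,Y^n)$, the $Z^n_i$ are i.i.d. uniform on the observations $X^n_1,\dots,X^n_n$ (counted with multiplicity). Write $\bar X^n=\frac1n\sum_i X^n_i$, $\tilde Y^n_i=Y^n_i+\bar X^n-\mathbb{E}[X^n_1]$ and $\tilde Z^n_i=Z^n_i-\bar X^n+\mathbb{E}[X^n_1]$. Let $$\mathcal F=\{h\in C^3(\mathbb{R}) : \sup_x|h^{(j)}(x)|\le 1,\ j=1,2,3\},$$ $$d_{\mathcal F}(U,V\mid X^n)=\sup_{h\in\mathcal F}\mathbb{E}[h(U)-h(V)\mid X^n],$$ computed with regular conditional distributions given $X^n$, with value $+\infty$ if some $h(U)$ or $h(V)$ is not conditionally integrable. For a random $C^3$ function $F$ of $x_{1:n}\in(\mathbb{R}^{d_n})^n$, let $\partial_{i,k}$ be the partial derivative in the $k$-th coordinate of $x_i$, and put $Z^{n,i,v}=(\tilde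 Y^n_1,\dots,\tilde Y^n_{i-1},v,Z^n_{i+1},\dots,Z^n_n)$, $M_k=2\|X^n_{1,k}\|_{L_{12}}$, $$D_{k_1}(F)=M_{k_1}\max_{i\le n}\|\partial_{i,k_1}F(Z^{n,i,\bar X^n})\|_{L_{12}},$$ $$D_{k_1k_2}(F)=M_{k_1}M_{k_2}\max_{i\le n}\|\partial_{i,k_1}\partial_{i,k_2}F(Z^{n,i,\bar X^n})\|_{L_{12}},$$ $$D_{k_1k_2k_3}(F)=M_{k_1}M_{k_2}M_{k_3}\max_{i\le n}\Big\|\max_{v\in[\bar X^n,\tilde Y^n_i]\cup[\bar X^n,Z^n_i]}|\partial_{i,k_1}\partial_{i,k_2}\partial_{i,k_3}F(Z^{n,i,v})|\Big\|_{L_{12}}.$$ Let $g_n:(\mathbb{R}^{d_n})^n\to\mathbb{R}$ be measurable and $f_n:(\mathbb{R}^{d_n})^n\to\mathbb{R}$ be $C^3$. Let $F_n=f_n(\cdot+\mathbb{E}[X^n_1]-\bar X^n)$, which is differentiated with the shift $\mathbb{E}[X^n_1]-\bar X^n$ held fixed, and set $$R^c_{n,1}=n^{1/3}\sum_{k_1}D_{k_1}(F_n),\quad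 R^c_{n,2}=n^{1/2}\sum_{k_1,k_2}D_{k_1k_2}(F_n),\quad R^c_{n,3}=n\sum_{k_1,k_2,k_3}D_{k_1k_2k_3}(F_n).$$ **Theorem (consistency of the centered bootstrap).** Suppose that, as $n\to\infty$, * $(H^c_0)$: $\|f_n(\tilde Z^n)-g_n(\tilde Z^n)\|_{L_1}+\|f_n(Y^n)-g_n(Y^n)\|_{L_1}\to0$; * $(H^c_1)$: $R^c_{n,1}\to0$, $R^c_{n,2}\to0$ and $R^c_{n,3}\to0$. For a constant $K$ consider the bound $$\big\|d_{\mathcal F}(g_n(\tilde Z^n),g_n(Y^n)\mid X^n)\big\|_{L_1}\le \|g_n(Y^n)-f_n(Y^n)\|_{L_1}+\|g_n(\tilde Z^n)-f_n(\tilde Z^n)\|_{L_1}+K\Big((R^c_{n,1})^2\max\{n^{-1/6},R^c_{n,1}\}+R^c_{n,3}+R^c_{n,2}\Big).\qquad(*)$$ Then: 1. $(*)$ holds with an absolute constant $K>0$, the same for all sequences $(d_n,P_n,g_n,f_n)$, at every $n\ge1$ with $R^c_{n,2}\le n^{1/4}$, hence for all sufficiently large $n$; 2. there is a constant $K'>0$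 independent of $n$ such that $(*)$ holds with $K'$ in place of $K$ for every $n\ge1$, and its right-hand side tends to $0$; 3. consequently the centered bootstrap is consistent: $d_{\mathcal F}(g_n(\tilde Z^n),g_n(Y^n)\mid X^n)\to0$ in $L_1$ and in probability. -/

import Mathlib

open MeasureTheory ProbabilityTheory Filter Topology
open scoped ENNReal

noncomputable section

namespace CenteredBootstrap

/-- Samples of size `n` with observations in `ℝ^d`. -/
abbrev Sample (n d : ℕ) : Type := Fin n → Fin d → ℝ

/-! ### The integral probability metric -/

/-- The class of `C³` functions on the line whose first three derivatives are bounded by `1`. -/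
def testClass : Set (ℝ → ℝ) :=
  {h | ContDiff ℝ 3 h ∧ ∀ j : ℕ, 1 ≤ j → j ≤ 3 → ∀ x : ℝ, |iteratedDeriv j h x| ≤ 1}

open Classical in
/-- `d_F(μ, ν) = sup_{h ∈ F} (E_μ h - E_ν h)`. The class is closed under negation, so taking the
positive part loses nothing. A test function that is not integrable makes the distance infinite. -/
def dF (μ ν : Measure ℝ) : ℝ≥0∞ :=
  ⨆ h ∈ testClass,
    if Integrable h μ ∧ Integrable h ν then ENNReal.ofReal ((∫ t, h t ∂μ) - ∫ t, h t ∂ν) else ⊤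

/-- `d_F(U, V ∣ W)`: the distance between the regular conditional distributions of `U` and `V`
given `W`, as a random variable. -/
def condDF {Ω β : Type*} [MeasurableSpace Ω] [MeasurableSpace β] (Q : Measure Ω)
    [IsFiniteMeasure Q] (U V : Ω → ℝ) (W : Ω → β) (ω : Ω) : ℝ≥0∞ :=
  dF (condDistrib U W Q (W ω)) (condDistrib V W Q (W ω))

/-! ### Bootstrap samples -/

/-- The uniform distribution on the observations (with multiplicity). -/
def empirical {n d : ℕ} (x : Sample n d) : Measure (Fin d → ℝ) :=
  (n : ℝ≥0∞)⁻¹ • ∑ i, Measure.dirac (x i)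

/-- One row of the array: the sample `X` is i.i.d. with law `P`, `Y` is an independent copy of `X`,
and `Z` is a bootstrap sample: given `X` (and `Y`), it is i.i.d. uniform on the observations
of `X`. -/
structure IsBootstrapRow {n d : ℕ} {Ω : Type*} [MeasurableSpace Ω] (Q : Measure Ω)
    [IsFiniteMeasure Q] (P : Measure (Fin d → ℝ)) (X Y Z : Ω → Sample n d) : Prop where
  measurable_X : Measurable X
  measurable_Y : Measurable Y
  measurable_Z : Measurable Z
  law_X : Q.map X = Measure.pi fun _ => P
  law_Y : Q.map Y = Measure.pi fun _ => P
  indep : IndepFun X Y Q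
  bootstrap : ∀ᵐ p ∂(Q.map fun ω => (X ω, Y ω)),
    condDistrib Z (fun ω => (X ω, Y ω)) Q p = Measure.pi fun _ => empirical p.1

/-- The expectation of an observation with law `P`. -/
def mean {d : ℕ} (P : Measure (Fin d → ℝ)) : Fin d → ℝ := fun k => ∫ x, x k ∂P

/-- The empirical mean. -/
def sampleMean {n d : ℕ} (x : Sample n d) : Fin d → ℝ := (n : ℝ)⁻¹ • ∑ i, x i

/-- Add the same vector to every observation. -/
def translate {n d : ℕ} (x : Sample n d) (c : Fin d → ℝ) : Sample n d := fun i => x i + c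

/-- The recentered copy `Ỹ_i = Y_i + X̄ - E X_1`. -/
def Ytilde {n d : ℕ} (P : Measure (Fin d → ℝ)) (x y : Sample n d) : Sample n d :=
  translate y (sampleMean x - mean P)

/-- The centered bootstrap sample `Z̃_i = Z_i - X̄ + E X_1`. -/
def Ztilde {n d : ℕ} (P : Measure (Fin d → ℝ)) (x z : Sample n d) : Sample n d :=
  translate z (mean P - sampleMean x)

/-- The interpolating sample `(Ỹ_1, …, Ỹ_{i-1}, v, Z_{i+1}, …, Z_n)`. -/
def path {n d : ℕ} (P : Measure (Fin d → ℝ)) (x y z : Sample n d) (i : Fin n) (v : Fin d → ℝ) :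
    Sample n d :=
  fun j => if j < i then Ytilde P x y j else if j = i then v else z j

/-- The random function `f(· + E X_1 - X̄)`. -/
def recenter {n d : ℕ} {Ω : Type*} (P : Measure (Fin d → ℝ)) (X : Ω → Sample n d)
    (f : Sample n d → ℝ) : Ω → Sample n d → ℝ :=
  fun ω x => f (translate x (mean P - sampleMean (X ω)))

/-! ### Sizes of the derivatives -/

/-- The partial derivative with respect to the `k`-th coordinate of the `i`-th observation. -/
def pderiv {n d : ℕ} (i : Fin n) (k : Fin d) (f : Sample n d → ℝ) : Sample n d → ℝ :=
  fun x => lineDeriv ℝ f x (Pi.single i (Pi.single k 1))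

/-- `M_k = 2 ‖X_{1,k}‖_{L_12}`. -/
def M {d : ℕ} (P : Measure (Fin d → ℝ)) (k : Fin d) : ℝ≥0∞ :=
  2 * eLpNorm (fun x : Fin d → ℝ => x k) 12 P

section Sizes

variable {n d : ℕ} {Ω : Type*} [MeasurableSpace Ω] (Q : Measure Ω) (P : Measure (Fin d → ℝ))
  (X Y Z : Ω → Sample n d) (F : Ω → Sample n d → ℝ)

/-- First order: `D_{k₁}` of the random function `F`. -/
def D1 (k₁ : Fin d) : ℝ≥0∞ :=
  M P k₁ * ⨆ i : Fin n, eLpNorm (fun ω =>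
    pderiv i k₁ (F ω) (path P (X ω) (Y ω) (Z ω) i (sampleMean (X ω)))) 12 Q

/-- Second order: `D_{k₁k₂}` of the random function `F`. -/
def D2 (k₁ k₂ : Fin d) : ℝ≥0∞ :=
  M P k₁ * M P k₂ * ⨆ i : Fin n, eLpNorm (fun ω =>
    pderiv i k₁ (pderiv i k₂ (F ω)) (path P (X ω) (Y ω) (Z ω) i (sampleMean (X ω)))) 12 Q

/-- Third order: `D_{k₁k₂k₃}` of the random function `F`; the derivative is maximized over the
segments `[X̄, Ỹ_i]` and `[X̄, Z_i]` in the `i`-th slot. -/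
def D3 (k₁ k₂ k₃ : Fin d) : ℝ≥0∞ :=
  M P k₁ * M P k₂ * M P k₃ * ⨆ i : Fin n, eLpNorm (fun ω =>
    ⨆ v ∈ segment ℝ (sampleMean (X ω)) (Ytilde P (X ω) (Y ω) i) ∪
        segment ℝ (sampleMean (X ω)) (Z ω i),
      ‖pderiv i k₁ (pderiv i k₂ (pderiv i k₃ (F ω))) (path P (X ω) (Y ω) (Z ω) i v)‖ₑ) 12 Q

variable (f g : Sample n d → ℝ)

/-- `R^c_{n,1} = n^{1/3} ∑ D_{k₁}(f(· + E X_1 - X̄))`. -/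
def R1 : ℝ≥0∞ :=
  (n : ℝ≥0∞) ^ (1 / 3 : ℝ) * ∑ k₁, D1 Q P X Y Z (recenter P X f) k₁

/-- `R^c_{n,2} = n^{1/2} ∑ D_{k₁k₂}(f(· + E X_1 - X̄))`. -/
def R2 : ℝ≥0∞ :=
  (n : ℝ≥0∞) ^ (1 / 2 : ℝ) * ∑ k₁, ∑ k₂, D2 Q P X Y Z (recenter P X f) k₁ k₂

/-- `R^c_{n,3} = n ∑ D_{k₁k₂k₃}(f(· + E X_1 - X̄))`. -/
def R3 : ℝ≥0∞ :=
  (n : ℝ≥0∞) * ∑ k₁, ∑ k₂, ∑ k₃, D3 Q P X Y Z (recenter P X f) k₁ k₂ k₃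

/-- The approximation error `‖g(Y) - f(Y)‖_{L_1} + ‖g(Z̃) - f(Z̃)‖_{L_1}`. -/
def approxError : ℝ≥0∞ :=
  eLpNorm (fun ω => g (Y ω) - f (Y ω)) 1 Q +
    eLpNorm (fun ω => g (Ztilde P (X ω) (Z ω)) - f (Ztilde P (X ω) (Z ω))) 1 Q

/-- The right-hand side of the bound, with constant `K`. -/
def bound (K : ℝ) : ℝ≥0∞ :=
  approxError Q P X Y Z f g + ENNReal.ofReal K *
    (R1 Q P X Y Z f ^ 2 * max ((n : ℝ≥0∞) ^ (-(1 / 6) : ℝ)) (R1 Q P X Y Z f) +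
      R3 Q P X Y Z f + R2 Q P X Y Z f)

/-- The random variable `d_F(g(Z̃), g(Y) ∣ X)`. -/
def bootDist [IsFiniteMeasure Q] : Ω → ℝ≥0∞ :=
  condDF Q (fun ω => g (Ztilde P (X ω) (Z ω))) (fun ω => g (Y ω)) X

end Sizes

end CenteredBootstrap

end

open CenteredBootstrap

noncomputable section

namespace CenteredBootstrap

/-! ### Taylor expansions -/

/-! Condition on the sample X = x. Then Ỹ and Z are independent of each other, each i.i.d., with
marginal laws `shifted P x` and `empirical x`. Both laws have mean x̄, which is what the centering
achieves. For F = f(· + E X_1 - x̄) one has F(Ỹ) = f(Y) and F(Z) = f(Z̃), so E h(F(Ỹ)) is to be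
compared with E h(F(Z)) for a test function h. Lindeberg's method does this by exchanging one
observation at a time.

One exchange: expand F in slot i about x̄ to second order. Since h is 1-Lipschitz, the cubic
remainder of F passes through h. Then expand h to second order at the value a of F with x̄ in slot
i. This leaves h'(a) u + h''(a) u² / 2, where u is a quadratic polynomial in the displacement whose
coefficients do not involve the exchanged pair. Integrating over the pair, first moments cancel, and
only differences of moments of orders 2 to 4 remain, besides the Taylor remainders
(`enorm_integral_sub_le`, `lindeberg_bound`).

Averaging over X: the moment differences are of order n^{-1/2} in L_2 (`eLpNorm_momentGap_le`). Let
D_j be the sum of the sizes of the derivatives of order j. Hölder's inequality bounds one exchange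
by a multiple of n^{-1/2} (D_2 + (D_1 + D_2)²) + D_1³ + D_2³ + D_3
(`IsBootstrapRow.lintegral_rowTerm_le`). After multiplication by n, n^{1/2} D_2 = R_2, n^{1/2} D_1²
= n^{-1/6} R_1², n D_1³ = R_1³ and n D_3 = R_3. The leftovers n^{-1/2} R_2² and n^{-1/2} R_2³ are
absorbed into R_2 when n^{-1/2} R_2² is bounded. The condition R_2 ≤ n^{1/4} bounds it by 1. Since
R_2 → 0, only finitely many n can violate that condition, and a larger constant covers them.

The conditional distance is a supremum over an uncountable class, and its measurability is never
established. A measurable majorant is carried along instead, so that Markov's inequality applies. -/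

theorem exists_taylor_remainder {φ φ₁ φ₂ φ₃ : ℝ → ℝ} (h₀ : ∀ t, HasDerivAt φ (φ₁ t) t)
    (h₁ : ∀ t, HasDerivAt φ₁ (φ₂ t) t) (h₂ : ∀ t, HasDerivAt φ₂ (φ₃ t) t) :
    ∃ ξ ∈ Set.Ioo (0 : ℝ) 1, φ 1 = φ 0 + φ₁ 0 + φ₂ 0 / 2 + φ₃ ξ / 6 := by
  set c : ℝ := φ 1 - φ 0 - φ₁ 0 - φ₂ 0 / 2 with hc
  have hG : ∀ t, HasDerivAt
      (fun t => φ 1 - φ t - φ₁ t * (1 - t) - φ₂ t * (1 - t) ^ 2 / 2 - c * (1 - t) ^ 3)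
      (-(φ₃ t * (1 - t) ^ 2 / 2) + 3 * c * (1 - t) ^ 2) t := by
    intro t
    have hs : HasDerivAt (fun t : ℝ => 1 - t) (-1) t := by
      simpa using (hasDerivAt_id t).const_sub 1
    have hs2 : HasDerivAt (fun t : ℝ => (1 - t) ^ 2) (-(2 * (1 - t))) t := by
      refine (hs.pow 2).congr_deriv ?_
      simp
    have hs3 : HasDerivAt (fun t : ℝ => (1 - t) ^ 3) (-(3 * (1 - t) ^ 2)) t := by
      refine (hs.pow 3).congr_deriv ?_
      simp
    refine (((((h₀ t).const_sub (φ 1)).sub ((h₁ t).mul hs)).sub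
      (((h₂ t).mul hs2).div_const 2)).sub (hs3.const_mul c)).congr_deriv ?_
    ring
  -- Rolle's theorem: `c` is chosen so that the auxiliary function vanishes at 0, and it vanishes at
  -- 1 by construction. Its derivative has the factor (1 - t)², nonzero at `ξ`, which leaves c = φ₃
  -- ξ / 6.
  obtain ⟨ξ, hξ, h⟩ := exists_hasDerivAt_eq_zero (a := 0) (b := 1) zero_lt_one
    (fun t _ => (hG t).continuousAt.continuousWithinAt) (by simp [hc]) (fun t _ => hG t)
  refine ⟨ξ, hξ, ?_⟩
  have h1 : (1 - ξ) ^ 2 ≠ 0 := pow_ne_zero _ (by linarith [hξ.2])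
  have : (3 * c - φ₃ ξ / 2) * (1 - ξ) ^ 2 = 0 := by linarith
  have := (mul_eq_zero.1 this).resolve_right h1
  linarith

theorem hasDerivAt_iteratedDeriv {h : ℝ → ℝ} {N k : ℕ} (hh : ContDiff ℝ N h) (hk : k < N)
    (x : ℝ) : HasDerivAt (iteratedDeriv k h) (iteratedDeriv (k + 1) h x) x := by
  rw [iteratedDeriv_succ]
  exact (hh.differentiable_iteratedDeriv k (by exact_mod_cast hk) x).hasDerivAt

theorem abs_sub_le_of_mem_testClass {h : ℝ → ℝ} (hh : h ∈ testClass) (x y : ℝ) :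
    |h x - h y| ≤ |x - y| := by
  have hd : ∀ t, HasDerivAt h (iteratedDeriv 1 h t) t := fun t => by
    simpa using hasDerivAt_iteratedDeriv (N := 3) (k := 0) hh.1 (by norm_num) t
  have := Convex.norm_image_sub_le_of_norm_hasDerivWithin_le (s := Set.univ) (C := 1)
    (fun t _ => (hd t).hasDerivWithinAt) (fun t _ => hh.2 1 le_rfl (by norm_num) t) convex_univ
    (Set.mem_univ y) (Set.mem_univ x)
  simpa using this

theorem abs_taylor_le_of_mem_testClass {h : ℝ → ℝ} (hh : h ∈ testClass) (a u : ℝ) :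
    |h (a + u) - (h a + iteratedDeriv 1 h a * u + iteratedDeriv 2 h a * u ^ 2 / 2)|
      ≤ |u| ^ 3 / 6 := by
  have hd : ∀ t, HasDerivAt h (iteratedDeriv 1 h t) t := fun t => by
    simpa using hasDerivAt_iteratedDeriv (N := 3) (k := 0) hh.1 (by norm_num) t
  have hd1 := fun t => hasDerivAt_iteratedDeriv (N := 3) (k := 1) hh.1 (by norm_num) t
  have hd2 := fun t => hasDerivAt_iteratedDeriv (N := 3) (k := 2) hh.1 (by norm_num) t
  have hl : ∀ t, HasDerivAt (fun t : ℝ => a + t * u) u t := fun t => by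
    simpa using ((hasDerivAt_id t).mul_const u).const_add a
  obtain ⟨ξ, -, he⟩ := exists_taylor_remainder (φ := fun t => h (a + t * u))
    (φ₁ := fun t => iteratedDeriv 1 h (a + t * u) * u)
    (φ₂ := fun t => iteratedDeriv 2 h (a + t * u) * u * u)
    (φ₃ := fun t => iteratedDeriv 3 h (a + t * u) * u * u * u)
    (fun t => (hd _).comp t (hl t)) (fun t => ((hd1 _).comp t (hl t)).mul_const u)
    (fun t => (((hd2 _).comp t (hl t)).mul_const u).mul_const u)
  simp only [one_mul, zero_mul, add_zero] at he
  rw [he]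
  have h3 := hh.2 3 (by norm_num) le_rfl (a + ξ * u)
  have : h a + iteratedDeriv 1 h a * u + iteratedDeriv 2 h a * u * u / 2 +
      iteratedDeriv 3 h (a + ξ * u) * u * u * u / 6 -
      (h a + iteratedDeriv 1 h a * u + iteratedDeriv 2 h a * u ^ 2 / 2) =
      iteratedDeriv 3 h (a + ξ * u) * u ^ 3 / 6 := by ring
  rw [this, abs_div, abs_mul, abs_pow, abs_of_pos (by norm_num : (0 : ℝ) < 6)]
  gcongr
  exact mul_le_of_le_one_left (by positivity) h3

/-! ### Partial derivatives -/

section Partial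

variable {n d : ℕ}

theorem pderiv_eq_fderiv {f : Sample n d → ℝ} (hf : Differentiable ℝ f) (i : Fin n) (k : Fin d) :
    pderiv i k f = fun x => fderiv ℝ f x (Pi.single i (Pi.single k 1)) :=
  funext fun x => (hf x).lineDeriv_eq_fderiv

theorem ContDiff.pderiv {f : Sample n d → ℝ} {N : ℕ} (hf : ContDiff ℝ (N + 1 : ℕ) f) (i : Fin n)
    (k : Fin d) : ContDiff ℝ N (pderiv i k f) := by
  rw [pderiv_eq_fderiv (hf.differentiable (by simp))]
  exact (hf.fderiv_right (m := N) (by simp)).clm_apply contDiff_const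

/-- The derivatives of the random function are thus those of the fixed `f` at a random point
depending continuously on the data. The measurability of the jets rests on this. -/
theorem pderiv_translate (f : Sample n d → ℝ) (c : Fin d → ℝ) (i : Fin n) (k : Fin d) :
    pderiv i k (fun x => f (translate x c)) = fun x => pderiv i k f (translate x c) := by
  funext x
  simp only [CenteredBootstrap.pderiv, lineDeriv]
  congr 1
  funext t
  congr 1
  funext j
  simp only [translate, Pi.add_apply]
  abel

theorem continuous_translate :
    Continuous fun p : Sample n d × (Fin d → ℝ) => translate p.1 p.2 := by
  unfold translate
  fun_prop

theorem hasDerivAt_line {f : Sample n d → ℝ} (hf : Differentiable ℝ f) (i : Fin n)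
    (η : Fin d → ℝ) (w : Sample n d) (t : ℝ) :
    HasDerivAt (fun t : ℝ => f (w + t • (Pi.single i η : Sample n d)))
      (∑ k, η k * pderiv i k f (w + t • (Pi.single i η : Sample n d))) t := by
  have hl : HasDerivAt (fun t : ℝ => w + t • (Pi.single i η : Sample n d)) (Pi.single i η) t := by
    simpa using ((hasDerivAt_id t).smul_const (Pi.single i η : Sample n d)).const_add w
  refine ((hf _).hasFDerivAt.comp_hasDerivAt t hl).congr_deriv ?_
  have h1 : (Pi.single i η : Sample n d)
      = ∑ k, η k • (Pi.single i (Pi.single k 1) : Sample n d) := by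
    funext j l
    by_cases hj : j = i
    · subst hj
      simp [Finset.sum_apply, Pi.single_apply]
    · simp [Finset.sum_apply, hj]
  have h2 : ∀ T : Sample n d →L[ℝ] ℝ, T (Pi.single i η)
      = ∑ k, η k * T (Pi.single i (Pi.single k 1)) := fun T => by
    conv_lhs => rw [h1]
    simp only [map_sum, map_smul, smul_eq_mul]
  simp only [h2, pderiv_eq_fderiv hf]

/-- The sample `(y_1, …, y_{i-1}, v, z_{i+1}, …, z_n)`. -/
def hybrid (y z : Sample n d) (i : Fin n) (v : Fin d → ℝ) : Sample n d :=
  fun j => if j < i then y j else if j = i then v else z j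

theorem hybrid_add_smul (y z : Sample n d) (i : Fin n) (m η : Fin d → ℝ) (t : ℝ) :
    hybrid y z i (m + t • η) = hybrid y z i m + t • (Pi.single i η : Sample n d) := by
  funext j
  by_cases hj : j = i
  · subst hj; simp [hybrid]
  · simp [hybrid, hj]

/-- The base point of slot `i` does not see the pair being exchanged, so this pair can be integrated
out with the first and second order Taylor coefficients frozen. -/
theorem hybrid_update (y z : Sample n d) (i : Fin n) (s t v : Fin d → ℝ) :
    hybrid (Function.update y i s) (Function.update z i t) i v = hybrid y z i v := by
  funext j
  by_cases hj : j = i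
  · subst hj; simp [hybrid]
  · simp [hybrid, hj]

theorem continuous_hybrid (i : Fin n) :
    Continuous fun p : Sample n d × Sample n d × (Fin d → ℝ) => hybrid p.1 p.2.1 i p.2.2 := by
  refine continuous_pi fun j => ?_
  unfold hybrid
  split_ifs <;> fun_prop

theorem sum_hybrid_sub (G : Sample n d → ℝ) (y z : Sample n d) :
    G y - G z = ∑ i, (G (hybrid y z i (y i)) - G (hybrid y z i (z i))) := by
  -- `S m` has its first `m` observations from `y`; the `i`-th exchange leads from `S i` to `S (i +
  -- 1)`, and the sum telescopes.
  set S : ℕ → Sample n d := fun m j => if (j : ℕ) < m then y j else z j with hS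
  have h1 : ∀ i : Fin n, hybrid y z i (y i) = S (i + 1) := by
    intro i; funext j
    simp only [hybrid, hS, Fin.lt_def, Fin.ext_iff]
    split_ifs with h1 h2 h3 <;> first | rfl | omega | skip
    all_goals rw [Fin.ext ‹(j : ℕ) = i›]
  have h2 : ∀ i : Fin n, hybrid y z i (z i) = S i := by
    intro i; funext j
    simp only [hybrid, hS, Fin.lt_def, Fin.ext_iff]
    split_ifs with h1 h2 <;> first | rfl | omega | skip
    all_goals rw [Fin.ext ‹(j : ℕ) = i›]
  simp only [h1, h2]
  rw [Fin.sum_univ_eq_sum_range (fun i => G (S (i + 1)) - G (S i)),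
    Finset.sum_range_sub (fun i => G (S i))]
  have h3 : S n = y := by funext j; simp [hS, j.2]
  have h4 : S 0 = z := by funext j; simp [hS]
  rw [h3, h4]

/-- Taylor's formula along the segment from `m` to `v` in slot `i`. The Lagrange form evaluates the
third derivatives at a point of the segment, where `D3` takes its supremum. -/
theorem exists_taylor_hybrid {F : Sample n d → ℝ} (hF : ContDiff ℝ 3 F) (y z : Sample n d)
    (i : Fin n) (m v : Fin d → ℝ) :
    ∃ w ∈ segment ℝ m v, F (hybrid y z i v) = F (hybrid y z i m)
      + ∑ k, (v k - m k) * pderiv i k F (hybrid y z i m)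
      + (∑ k, (v k - m k) * ∑ l, (v l - m l) *
          pderiv i l (pderiv i k F) (hybrid y z i m)) / 2
      + (∑ k, (v k - m k) * ∑ l, (v l - m l) * ∑ p, (v p - m p) *
          pderiv i p (pderiv i l (pderiv i k F)) (hybrid y z i w)) / 6 := by
  have h1 : ∀ k, ContDiff ℝ (2 : ℕ) (pderiv i k F) := fun k =>
    ContDiff.pderiv (N := 2) (by exact_mod_cast hF) i k
  have h2 : ∀ k l, ContDiff ℝ (1 : ℕ) (pderiv i l (pderiv i k F)) := fun k l =>
    ContDiff.pderiv (N := 1) (by exact_mod_cast h1 k) i l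
  have hd0 := hasDerivAt_line (hF.differentiable (by norm_num)) i (v - m) (hybrid y z i m)
  have hd1 := fun k =>
    hasDerivAt_line ((h1 k).differentiable (by norm_num)) i (v - m) (hybrid y z i m)
  have hd2 := fun k l =>
    hasDerivAt_line ((h2 k l).differentiable (by norm_num)) i (v - m) (hybrid y z i m)
  obtain ⟨ξ, hξ, he⟩ := exists_taylor_remainder hd0
    (fun t => HasDerivAt.fun_sum fun k _ => (hd1 k t).const_mul ((v - m) k))
    (fun t => HasDerivAt.fun_sum fun k _ => (HasDerivAt.fun_sum fun l _ =>
      (hd2 k l t).const_mul ((v - m) l)).const_mul ((v - m) k))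
  refine ⟨m + ξ • (v - m), ?_, ?_⟩
  · rw [segment_eq_image']
    exact ⟨ξ, ⟨hξ.1.le, hξ.2.le⟩, rfl⟩
  · have h1 := hybrid_add_smul y z i m (v - m) 1
    rw [one_smul, one_smul, add_sub_cancel] at h1
    simp only [← hybrid_add_smul, one_smul, zero_smul, add_zero, Pi.sub_apply] at he
    rwa [← h1] at he

end Partial

/-! ### Hölder's inequality -/

section Hoelder

variable {Ω ι : Type*} [MeasurableSpace Ω] {Q : Measure Ω}

theorem eLpNorm_nat_pow {ε : Type*} [ENorm ε] (f : Ω → ε) {p : ℕ} (hp : p ≠ 0) :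
    eLpNorm f p Q ^ p = ∫⁻ ω, ‖f ω‖ₑ ^ p ∂Q := by
  have hp' : (p : ℝ) ≠ 0 := by exact_mod_cast hp
  rw [eLpNorm_eq_lintegral_rpow_enorm_toReal (by exact_mod_cast hp) (by simp)]
  simp only [ENNReal.toReal_natCast, ENNReal.rpow_natCast, one_div]
  rw [← ENNReal.rpow_natCast, ← ENNReal.rpow_mul, inv_mul_cancel₀ hp', ENNReal.rpow_one]

theorem lintegral_mul_le_eLpNorm_two {f g : Ω → ℝ≥0∞} (hf : AEMeasurable f Q)
    (hg : AEMeasurable g Q) :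
    ∫⁻ ω, f ω * g ω ∂Q ≤ eLpNorm f 2 Q * eLpNorm g 2 Q := by
  have := ENNReal.lintegral_mul_le_Lp_mul_Lq Q Real.HolderConjugate.two_two hf hg
  simpa [eLpNorm_eq_lintegral_rpow_enorm_toReal] using this

variable [IsProbabilityMeasure Q]

/-- Hölder's inequality with equal weights, followed by monotonicity of norms on a probability
space. The condition `hN` is the moment budget, with `N = 12` in most uses. -/
theorem lintegral_prod_pow_le (s : Finset ι) {f : ι → Ω → ℝ≥0∞}
    (hf : ∀ i ∈ s, AEMeasurable (f i) Q) {p N : ℕ} (hp : p ≠ 0) (hN : s.card * p ≤ N) :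
    ∫⁻ ω, (∏ i ∈ s, f i ω) ^ p ∂Q ≤ (∏ i ∈ s, eLpNorm (f i) N Q) ^ p := by
  rcases s.eq_empty_or_nonempty with rfl | hs
  · simp
  have hc : (s.card : ℝ) ≠ 0 := by exact_mod_cast hs.card_ne_zero
  have hcp : s.card * p ≠ 0 := mul_ne_zero hs.card_ne_zero hp
  have key := ENNReal.lintegral_prod_norm_pow_le s (f := fun i ω => f i ω ^ (s.card * p))
    (fun i hi => (hf i hi).pow_const _) (p := fun _ => (s.card : ℝ)⁻¹)
    (by simp [hc]) (fun _ _ => by positivity)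
  have h1 : ∀ x : ℝ≥0∞, (x ^ (s.card * p)) ^ ((s.card : ℝ)⁻¹) = x ^ p := fun x => by
    rw [mul_comm, pow_mul, ← ENNReal.rpow_natCast (x ^ p), ← ENNReal.rpow_mul,
      mul_inv_cancel₀ hc, ENNReal.rpow_one]
  simp only [h1] at key
  simp only [Finset.prod_pow] at key
  refine key.trans ?_
  rw [← Finset.prod_pow]
  refine Finset.prod_le_prod' fun i hi => ?_
  have h2 := eLpNorm_nat_pow (Q := Q) (f i) hcp
  simp only [enorm_eq_self] at h2
  rw [← h2, h1]
  gcongr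
  exact eLpNorm_le_eLpNorm_of_exponent_le (by exact_mod_cast hN) (hf i hi).aestronglyMeasurable

theorem eLpNorm_prod_le (s : Finset ι) {f : ι → Ω → ℝ≥0∞}
    (hf : ∀ i ∈ s, AEMeasurable (f i) Q) {p N : ℕ} (hp : p ≠ 0) (hN : s.card * p ≤ N) :
    eLpNorm (fun ω => ∏ i ∈ s, f i ω) p Q ≤ ∏ i ∈ s, eLpNorm (f i) N Q := by
  rw [← ENNReal.pow_le_pow_left_iff hp, eLpNorm_nat_pow _ hp]
  simpa using lintegral_prod_pow_le s hf hp hN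

end Hoelder

/-! ### Resampling one observation -/

section Resample

variable {n d : ℕ}

/-- Redrawing one coordinate from its own law preserves the product law. An integral over the
product thereby becomes an iterated one whose inner variable is a fresh `i`-th coordinate, without
splitting the product. -/
theorem measurePreserving_update {E : Type*} [MeasurableSpace E] (A : Measure E)
    [IsProbabilityMeasure A] (i : Fin n) :
    MeasurePreserving (fun p : (Fin n → E) × E => Function.update p.1 i p.2)
      ((Measure.pi fun _ => A).prod A) (Measure.pi fun _ => A) := by
  have hm : Measurable fun p : (Fin n → E) × E => Function.update p.1 i p.2 := by
    refine measurable_pi_iff.2 fun j => ?_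
    by_cases hj : j = i
    · subst hj; simpa using measurable_snd
    · simpa [hj, Function.comp_def] using (measurable_pi_apply j).comp measurable_fst
  refine ⟨hm, (Measure.pi_eq fun s hs => ?_).symm⟩
  rw [Measure.map_apply hm (MeasurableSet.univ_pi hs)]
  have : (fun p : (Fin n → E) × E => Function.update p.1 i p.2) ⁻¹' Set.univ.pi s
      = (Set.univ.pi (Function.update s i Set.univ)) ×ˢ s i := by
    ext p
    simp only [Set.mem_preimage, Set.mem_pi, Set.mem_univ, true_imp_iff, Set.mem_prod]
    constructor
    · intro h
      refine ⟨fun j => ?_, by simpa using h i⟩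
      by_cases hj : j = i
      · subst hj; simp
      · simpa [hj] using h j
    · rintro ⟨h, h'⟩ j
      by_cases hj : j = i
      · subst hj; simpa using h'
      · simpa [hj] using h j
  rw [this, Measure.prod_prod, Measure.pi_pi, ← Finset.mul_prod_erase _ _ (Finset.mem_univ i),
    ← Finset.mul_prod_erase (a := i) _ (fun j => A (s j)) (Finset.mem_univ i)]
  simp only [Function.update_self, measure_univ, one_mul]
  rw [mul_comm]
  congr 1
  refine Finset.prod_congr rfl fun j hj => ?_
  rw [Function.update_of_ne (Finset.ne_of_mem_erase hj)]

theorem measurePreserving_update_prod {E : Type*} [MeasurableSpace E] (A B : Measure E)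
    [IsProbabilityMeasure A] [IsProbabilityMeasure B] (i : Fin n) :
    MeasurePreserving (fun p : ((Fin n → E) × (Fin n → E)) × (E × E) =>
        (Function.update p.1.1 i p.2.1, Function.update p.1.2 i p.2.2))
      (((Measure.pi fun _ => A).prod (Measure.pi fun _ => B)).prod (A.prod B))
      ((Measure.pi fun _ => A).prod (Measure.pi fun _ => B)) := by
  have hA := measurePreserving_update A i
  have hB := measurePreserving_update B i
  have hm : Measurable (fun p : ((Fin n → E) × (Fin n → E)) × (E × E) =>
        (Function.update p.1.1 i p.2.1, Function.update p.1.2 i p.2.2)) :=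
    (hA.measurable.comp (measurable_fst.fst.prodMk measurable_snd.fst)).prodMk
      (hB.measurable.comp (measurable_fst.snd.prodMk measurable_snd.snd))
  refine ⟨hm, Measure.ext_of_lintegral _ fun f hf => ?_⟩
  have hfm : Measurable fun p : ((Fin n → E) × (Fin n → E)) × (E × E) =>
      f (Function.update p.1.1 i p.2.1, Function.update p.1.2 i p.2.2) := hf.comp hm
  rw [lintegral_map hf hm, lintegral_prod _ hfm.aemeasurable,
    lintegral_prod _ (Measurable.lintegral_prod_right' hfm).aemeasurable,
    lintegral_prod _ hf.aemeasurable]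
  have h1 : ∀ y z, ∫⁻ q : E × E, f (Function.update y i q.1, Function.update z i q.2) ∂(A.prod B)
      = ∫⁻ s, ∫⁻ t, f (Function.update y i s, Function.update z i t) ∂B ∂A := fun y z =>
    lintegral_prod (fun q : E × E => f (Function.update y i q.1, Function.update z i q.2))
      (hfm.comp (measurable_prodMk_left (x := (y, z)))).aemeasurable
  -- Interchanging `z` and `s` puts each fresh coordinate next to the vector it updates, so that the
  -- statement for one vector applies twice.
  have h2 : ∀ y, ∫⁻ z, ∫⁻ s, ∫⁻ t, f (Function.update y i s, Function.update z i t) ∂B ∂A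
        ∂(Measure.pi fun _ => B)
      = ∫⁻ s, ∫⁻ z, f (Function.update y i s, z) ∂(Measure.pi fun _ => B) ∂A := fun y => by
    rw [lintegral_lintegral_swap]
    · refine lintegral_congr fun s => ?_
      have hfs : Measurable fun z => f (Function.update y i s, z) :=
        hf.comp measurable_prodMk_left
      rw [← hB.lintegral_comp hfs]
      exact (lintegral_prod _ (hfs.comp hB.measurable).aemeasurable).symm
    · refine Measurable.aemeasurable (Measurable.lintegral_prod_right'
        (f := fun q : ((Fin n → E) × E) × E =>
          f (Function.update y i q.1.2, Function.update q.1.1 i q.2)) ?_)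
      exact hfm.comp (((measurable_const (a := y)).prodMk measurable_fst.fst).prodMk
        (measurable_fst.snd.prodMk measurable_snd))
  simp only [h1, h2]
  have hg : Measurable fun y => ∫⁻ z, f (y, z) ∂(Measure.pi fun _ : Fin n => B) :=
    Measurable.lintegral_prod_right' hf
  rw [← hA.lintegral_comp hg]
  exact (lintegral_prod _ (hg.comp hA.measurable).aemeasurable).symm

end Resample

/-! ### One step of the Lindeberg replacement -/

section Step

variable {d : ℕ}

/-- The monomial `∏ a, (v - m)_{κ a}`. -/
def monomial (m : Fin d → ℝ) {r : ℕ} (κ : Fin r → Fin d) (v : Fin d → ℝ) : ℝ :=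
  ∏ a, (v (κ a) - m (κ a))

/-- The difference of the mixed moments about `m` of two measures. -/
def momentGap (A B : Measure (Fin d → ℝ)) (m : Fin d → ℝ) {r : ℕ} (κ : Fin r → Fin d) : ℝ :=
  ∫ v, monomial m κ v ∂A - ∫ v, monomial m κ v ∂B

/-- The part of the replacement error that comes from moments of order at most four. -/
def momentTerm (A B : Measure (Fin d → ℝ)) (m : Fin d → ℝ) (b : Fin d → ℝ)
    (c : Fin d → Fin d → ℝ) : ℝ≥0∞ :=
  ∑ k, ∑ l, ‖c k l‖ₑ * ‖momentGap A B m ![k, l]‖ₑ +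
  (∑ k, ∑ l, ‖b k‖ₑ * ‖b l‖ₑ * ‖momentGap A B m ![k, l]‖ₑ +
   ∑ k, ∑ l, ∑ p, ‖b k‖ₑ * ‖c l p‖ₑ * ‖momentGap A B m ![k, l, p]‖ₑ +
   ∑ k, ∑ l, ∑ p, ∑ q, ‖c k l‖ₑ * ‖c p q‖ₑ * ‖momentGap A B m ![k, l, p, q]‖ₑ)

/-- The bound on the third-order Taylor remainder. -/
def cubicTerm (e : Fin d → Fin d → Fin d → ℝ≥0∞) (η : Fin d → ℝ) : ℝ≥0∞ :=
  ∑ k, ∑ l, ∑ p, e k l p * ‖η k‖ₑ * ‖η l‖ₑ * ‖η p‖ₑ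

/-- The part of the replacement error that comes from Taylor remainders. -/
def remainderTerm (b : Fin d → ℝ) (c : Fin d → Fin d → ℝ)
    (e : Fin d → Fin d → Fin d → ℝ≥0∞) (η : Fin d → ℝ) : ℝ≥0∞ :=
  (∑ k, ‖b k‖ₑ * ‖η k‖ₑ) ^ 3 + (∑ k, ∑ l, ‖c k l‖ₑ * ‖η k‖ₑ * ‖η l‖ₑ) ^ 3 + cubicTerm e η

/-- The second-order Taylor polynomial without its constant term. -/
def quadPoly (b : Fin d → ℝ) (c : Fin d → Fin d → ℝ) (η : Fin d → ℝ) : ℝ :=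
  ∑ k, b k * η k + (∑ k, ∑ l, c k l * (η k * η l)) / 2

/-- `φ` is integrable for both measures, and its integrals differ by at most `R`. -/
def GapBound {E : Type*} [MeasurableSpace E] (A B : Measure E) (φ : E → ℝ) (R : ℝ≥0∞) : Prop :=
  Integrable φ A ∧ Integrable φ B ∧ ‖∫ v, φ v ∂A - ∫ v, φ v ∂B‖ₑ ≤ R

namespace GapBound

variable {E ι : Type*} [MeasurableSpace E] {A B : Measure E} {φ ψ : E → ℝ} {R S : ℝ≥0∞}

theorem mono (h : GapBound A B φ R) (hRS : R ≤ S) : GapBound A B φ S :=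
  ⟨h.1, h.2.1, h.2.2.trans hRS⟩

theorem add (h : GapBound A B φ R) (h' : GapBound A B ψ S) :
    GapBound A B (fun v => φ v + ψ v) (R + S) := by
  refine ⟨h.1.add h'.1, h.2.1.add h'.2.1, ?_⟩
  rw [integral_add h.1 h'.1, integral_add h.2.1 h'.2.1, add_sub_add_comm]
  exact (enorm_add_le _ _).trans (add_le_add h.2.2 h'.2.2)

theorem const_mul (h : GapBound A B φ R) (c : ℝ) :
    GapBound A B (fun v => c * φ v) (‖c‖ₑ * R) := by
  refine ⟨h.1.const_mul c, h.2.1.const_mul c, ?_⟩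
  rw [integral_const_mul, integral_const_mul, ← mul_sub, enorm_mul]
  exact mul_le_mul_right h.2.2 _

theorem sum (s : Finset ι) {φ : ι → E → ℝ} {R : ι → ℝ≥0∞} (h : ∀ i, GapBound A B (φ i) (R i)) :
    GapBound A B (fun v => ∑ i ∈ s, φ i v) (∑ i ∈ s, R i) := by
  refine ⟨integrable_finsetSum _ fun i _ => (h i).1,
    integrable_finsetSum _ fun i _ => (h i).2.1, ?_⟩
  rw [integral_finsetSum _ fun i _ => (h i).1, integral_finsetSum _ fun i _ => (h i).2.1,
    ← Finset.sum_sub_distrib]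
  exact (enorm_sum_le _ _).trans (Finset.sum_le_sum fun i _ => (h i).2.2)

end GapBound

theorem enorm_abs_quadPoly_le (b : Fin d → ℝ) (c : Fin d → Fin d → ℝ) (η : Fin d → ℝ) :
    ENNReal.ofReal (|quadPoly b c η| ^ 3 / 6) ≤
      (∑ k, ‖b k‖ₑ * ‖η k‖ₑ) ^ 3 + (∑ k, ∑ l, ‖c k l‖ₑ * ‖η k‖ₑ * ‖η l‖ₑ) ^ 3 := by
  set L := ∑ k, b k * η k with hL
  set T := ∑ k, ∑ l, c k l * (η k * η l) with hT
  have h1 : ‖L‖ₑ ≤ ∑ k, ‖b k‖ₑ * ‖η k‖ₑ :=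
    (enorm_sum_le _ _).trans_eq (by simp only [enorm_mul])
  have h2 : ‖T‖ₑ ≤ ∑ k, ∑ l, ‖c k l‖ₑ * ‖η k‖ₑ * ‖η l‖ₑ := by
    refine (enorm_sum_le _ _).trans (Finset.sum_le_sum fun k _ => ?_)
    exact (enorm_sum_le _ _).trans_eq (by simp only [enorm_mul, mul_assoc])
  have h3 : |quadPoly b c η| ^ 3 / 6 ≤ |L| ^ 3 + |T| ^ 3 := by
    have h4 : |quadPoly b c η| ≤ |L| + |T| / 2 := by
      refine (abs_add_le _ _).trans_eq ?_
      rw [abs_div, abs_two]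
    have h5 : |quadPoly b c η| ^ 3 ≤ (|L| + |T| / 2) ^ 3 := by gcongr
    have hl := abs_nonneg L
    have ht := abs_nonneg T
    -- With p = |L| and q = |T| / 2 the difference of the two sides is 3 (p + q) (p - q)².
    have : (|L| + |T| / 2) ^ 3 ≤ 4 * (|L| ^ 3 + (|T| / 2) ^ 3) := by
      nlinarith [mul_nonneg (add_nonneg hl (div_nonneg ht zero_le_two)) (sq_nonneg (|L| - |T| / 2))]
    nlinarith [pow_nonneg hl 3, pow_nonneg ht 3]
  refine (ENNReal.ofReal_le_ofReal h3).trans ?_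
  rw [ENNReal.ofReal_add (by positivity) (by positivity), ENNReal.ofReal_pow (abs_nonneg _),
    ENNReal.ofReal_pow (abs_nonneg _), ← Real.enorm_eq_ofReal_abs, ← Real.enorm_eq_ofReal_abs]
  gcongr

variable {A B : Measure (Fin d → ℝ)} {m : Fin d → ℝ}

/-- Write the polynomial as L + T / 2, with L linear and T quadratic. Its square L² + LT + T² / 4
involves moments of orders 2 to 4. The gap of L vanishes because the two laws have the same mean.
The numerical factors are at most 1 in absolute value and are dropped. -/
theorem gapBound_quadPoly
    (hA : ∀ (r : ℕ) (κ : Fin r → Fin d), r ≤ 4 → Integrable (monomial m κ) A)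
    (hB : ∀ (r : ℕ) (κ : Fin r → Fin d), r ≤ 4 → Integrable (monomial m κ) B)
    (hm : ∀ k, momentGap A B m ![k] = 0) (b : Fin d → ℝ) (c : Fin d → Fin d → ℝ) {α β : ℝ}
    (hα : |α| ≤ 1) (hβ : |β| ≤ 1) :
    GapBound A B (fun v => α * quadPoly b c (v - m) + β * quadPoly b c (v - m) ^ 2 / 2)
      (momentTerm A B m b c) := by
  have h0 : ∀ (r : ℕ) (κ : Fin r → Fin d), r ≤ 4 →
      GapBound A B (monomial m κ) ‖momentGap A B m κ‖ₑ := fun r κ hr =>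
    ⟨hA r κ hr, hB r κ hr, le_rfl⟩
  have hle : ∀ {t : ℝ} {R : ℝ≥0∞}, |t| ≤ 1 → ‖t‖ₑ * R ≤ R := fun {t R} ht => by
    refine mul_le_of_le_one_left' ?_
    rw [Real.enorm_eq_ofReal_abs]
    exact ENNReal.ofReal_le_one.2 ht
  have hhalf : |(1 / 2 : ℝ)| ≤ 1 := by rw [abs_of_pos] <;> norm_num
  have hquarter : |(1 / 4 : ℝ)| ≤ 1 := by rw [abs_of_pos] <;> norm_num
  have hmono1 : ∀ k v, monomial m ![k] v = (v - m) k := fun k v => by simp [monomial]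
  have hmono2 : ∀ k l v, monomial m ![k, l] v = (v - m) k * (v - m) l := fun k l v => by
    simp [monomial, Fin.prod_univ_succ]
  have hmono3 : ∀ k l p v, monomial m ![k, l, p] v = (v - m) k * ((v - m) l * (v - m) p) :=
    fun k l p v => by simp [monomial, Fin.prod_univ_succ]
  have hmono4 : ∀ k l p q v, monomial m ![k, l, p, q] v =
      (v - m) k * ((v - m) l * ((v - m) p * (v - m) q)) :=
    fun k l p q v => by simp [monomial, Fin.prod_univ_succ]
  have hlin : GapBound A B (fun v => ∑ k, b k * (v - m) k) 0 := by
    have := GapBound.sum Finset.univ fun k => (h0 1 ![k] (by norm_num)).const_mul (b k)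
    simpa only [hmono1, hm, enorm_zero, mul_zero, Finset.sum_const_zero] using this
  have hquad : GapBound A B (fun v => ∑ k, ∑ l, c k l * ((v - m) k * (v - m) l))
      (∑ k, ∑ l, ‖c k l‖ₑ * ‖momentGap A B m ![k, l]‖ₑ) := by
    have := GapBound.sum Finset.univ fun k => GapBound.sum Finset.univ fun l =>
      (h0 2 ![k, l] (by norm_num)).const_mul (c k l)
    simpa only [hmono2] using this
  have hLL : GapBound A B (fun v => ∑ k, ∑ l, (b k * b l) * ((v - m) k * (v - m) l))
      (∑ k, ∑ l, ‖b k‖ₑ * ‖b l‖ₑ * ‖momentGap A B m ![k, l]‖ₑ) := by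
    have := GapBound.sum Finset.univ fun k => GapBound.sum Finset.univ fun l =>
      (h0 2 ![k, l] (by norm_num)).const_mul (b k * b l)
    simpa only [hmono2, enorm_mul] using this
  have hLQ : GapBound A B (fun v => ∑ k, ∑ l, ∑ p,
        (b k * c l p) * ((v - m) k * ((v - m) l * (v - m) p)))
      (∑ k, ∑ l, ∑ p, ‖b k‖ₑ * ‖c l p‖ₑ * ‖momentGap A B m ![k, l, p]‖ₑ) := by
    have := GapBound.sum Finset.univ fun k => GapBound.sum Finset.univ fun l =>
      GapBound.sum Finset.univ fun p => (h0 3 ![k, l, p] (by norm_num)).const_mul (b k * c l p)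
    simpa only [hmono3, enorm_mul] using this
  have hQQ : GapBound A B (fun v => ∑ k, ∑ l, ∑ p, ∑ q,
        (c k l * c p q) * ((v - m) k * ((v - m) l * ((v - m) p * (v - m) q))))
      (∑ k, ∑ l, ∑ p, ∑ q, ‖c k l‖ₑ * ‖c p q‖ₑ * ‖momentGap A B m ![k, l, p, q]‖ₑ) := by
    have := GapBound.sum Finset.univ fun k => GapBound.sum Finset.univ fun l =>
      GapBound.sum Finset.univ fun p => GapBound.sum Finset.univ fun q =>
        (h0 4 ![k, l, p, q] (by norm_num)).const_mul (c k l * c p q)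
    simpa only [hmono4, enorm_mul] using this
  have hu : GapBound A B (fun v => quadPoly b c (v - m))
      (∑ k, ∑ l, ‖c k l‖ₑ * ‖momentGap A B m ![k, l]‖ₑ) := by
    have := (hlin.add ((hquad.const_mul (1 / 2)).mono (hle hhalf)))
    rw [zero_add] at this
    convert this using 2 with v
    simp only [quadPoly]
    ring
  have hu2 : GapBound A B (fun v => quadPoly b c (v - m) ^ 2)
      (∑ k, ∑ l, ‖b k‖ₑ * ‖b l‖ₑ * ‖momentGap A B m ![k, l]‖ₑ +
       ∑ k, ∑ l, ∑ p, ‖b k‖ₑ * ‖c l p‖ₑ * ‖momentGap A B m ![k, l, p]‖ₑ +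
       ∑ k, ∑ l, ∑ p, ∑ q, ‖c k l‖ₑ * ‖c p q‖ₑ * ‖momentGap A B m ![k, l, p, q]‖ₑ) := by
    convert (hLL.add hLQ).add ((hQQ.const_mul (1 / 4)).mono (hle hquarter)) using 2 with v
    have e1 : ∑ k, ∑ l, (b k * b l) * ((v - m) k * (v - m) l)
        = (∑ k, b k * (v - m) k) * ∑ k, b k * (v - m) k := by
      rw [Finset.sum_mul_sum]
      exact Finset.sum_congr rfl fun k _ => Finset.sum_congr rfl fun l _ => by ring
    have e2 : ∑ k, ∑ l, ∑ p, (b k * c l p) * ((v - m) k * ((v - m) l * (v - m) p))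
        = (∑ k, b k * (v - m) k) * ∑ k, ∑ l, c k l * ((v - m) k * (v - m) l) := by
      simp only [Finset.sum_mul]
      simp only [Finset.mul_sum]
      exact Finset.sum_congr rfl fun k _ => Finset.sum_congr rfl fun l _ =>
        Finset.sum_congr rfl fun p _ => by ring
    have e3 : ∑ k, ∑ l, ∑ p, ∑ q,
          (c k l * c p q) * ((v - m) k * ((v - m) l * ((v - m) p * (v - m) q)))
        = (∑ k, ∑ l, c k l * ((v - m) k * (v - m) l)) *
          ∑ k, ∑ l, c k l * ((v - m) k * (v - m) l) := by
      simp only [Finset.sum_mul]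
      simp only [Finset.mul_sum]
      exact Finset.sum_congr rfl fun k _ => Finset.sum_congr rfl fun l _ =>
        Finset.sum_congr rfl fun p _ => Finset.sum_congr rfl fun q _ => by ring
    rw [e1, e2, e3, quadPoly]
    ring
  have hβ2 : |β / 2| ≤ 1 := by
    rw [abs_div, abs_two]; linarith
  have := ((hu.const_mul α).mono (hle hα)).add ((hu2.const_mul (β / 2)).mono (hle hβ2))
  unfold momentTerm
  convert this using 3 with v
  ring

/-- One exchange with all other observations frozen. The second-order expansion of `h` at `a`
contributes only moment gaps; the error comes from its cubic remainder and from replacing `U` and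
`V` by quadratic polynomials inside the 1-Lipschitz `h`. Unlike `b` and `c`, the bound `e` may
depend on the exchanged pair. -/
theorem enorm_integral_sub_le [IsProbabilityMeasure A] [IsProbabilityMeasure B]
    (hA : ∀ (r : ℕ) (κ : Fin r → Fin d), r ≤ 4 → Integrable (monomial m κ) A)
    (hB : ∀ (r : ℕ) (κ : Fin r → Fin d), r ≤ 4 → Integrable (monomial m κ) B)
    (hm : ∀ k, momentGap A B m ![k] = 0) {h : ℝ → ℝ} (hh : h ∈ testClass) (a : ℝ)
    (b : Fin d → ℝ) (c : Fin d → Fin d → ℝ) {U V : (Fin d → ℝ) → ℝ}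
    {e : (Fin d → ℝ) × (Fin d → ℝ) → Fin d → Fin d → Fin d → ℝ≥0∞}
    (hU : ∀ p, ‖U p.1 - (a + quadPoly b c (p.1 - m))‖ₑ ≤ cubicTerm (e p) (p.1 - m))
    (hV : ∀ p, ‖V p.2 - (a + quadPoly b c (p.2 - m))‖ₑ ≤ cubicTerm (e p) (p.2 - m)) :
    ‖∫ p, (h (U p.1) - h (V p.2)) ∂(A.prod B)‖ₑ ≤ ∫⁻ p, (momentTerm A B m b c +
      (remainderTerm b c (e p) (p.1 - m) + remainderTerm b c (e p) (p.2 - m))) ∂(A.prod B) := by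
  rw [lintegral_add_left measurable_const]
  simp only [lintegral_const, measure_univ, mul_one]
  by_cases hint : Integrable (fun p => h (U p.1) - h (V p.2)) (A.prod B)
  swap
  -- A non-integrable integrand has integral zero by convention.
  · rw [integral_undef hint]; simp
  set φ : (Fin d → ℝ) → ℝ := fun v => iteratedDeriv 1 h a * quadPoly b c (v - m) +
    iteratedDeriv 2 h a * quadPoly b c (v - m) ^ 2 / 2 with hφ
  have hφG : GapBound A B φ (momentTerm A B m b c) := gapBound_quadPoly hA hB hm b c
    (hh.2 1 le_rfl (by norm_num) a) (hh.2 2 (by norm_num) (by norm_num) a)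
  clear_value φ
  obtain ⟨hφA, hφB, hgap⟩ := hφG
  have hφi : Integrable (fun p : (Fin d → ℝ) × (Fin d → ℝ) => φ p.1 - φ p.2) (A.prod B) :=
    (hφA.comp_fst B).sub (hφB.comp_snd A)
  have h1 : ∀ w v (e' : Fin d → Fin d → Fin d → ℝ≥0∞),
      ‖w - (a + quadPoly b c (v - m))‖ₑ ≤ cubicTerm e' (v - m) →
      ‖h w - h a - φ v‖ₑ ≤ remainderTerm b c e' (v - m) := by
    intro w v e' hw
    have h2 : h w - h a - φ v = (h (a + quadPoly b c (v - m)) -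
        (h a + iteratedDeriv 1 h a * quadPoly b c (v - m) +
          iteratedDeriv 2 h a * quadPoly b c (v - m) ^ 2 / 2)) +
        (h w - h (a + quadPoly b c (v - m))) := by
      simp only [hφ]; ring
    rw [h2]
    refine (enorm_add_le _ _).trans (add_le_add ?_ ?_)
    · rw [Real.enorm_eq_ofReal_abs]
      exact (ENNReal.ofReal_le_ofReal (abs_taylor_le_of_mem_testClass hh _ _)).trans
        (enorm_abs_quadPoly_le _ _ _)
    · refine le_trans ?_ hw
      rw [Real.enorm_eq_ofReal_abs, Real.enorm_eq_ofReal_abs]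
      exact ENNReal.ofReal_le_ofReal (abs_sub_le_of_mem_testClass hh _ _)
  have h3 : ∫ p, (h (U p.1) - h (V p.2)) ∂(A.prod B) = (∫ v, φ v ∂A - ∫ v, φ v ∂B) +
      ∫ p, ((h (U p.1) - h (V p.2)) - (φ p.1 - φ p.2)) ∂(A.prod B) := by
    rw [integral_sub hint hφi, integral_sub (hφA.comp_fst B) (hφB.comp_snd A),
      integral_fun_fst, integral_fun_snd]
    simp
  rw [h3]
  refine (enorm_add_le _ _).trans (add_le_add hgap ?_)
  refine (enorm_integral_le_lintegral_enorm _).trans (lintegral_mono fun p => ?_)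
  have h4 : (h (U p.1) - h (V p.2)) - (φ p.1 - φ p.2)
      = (h (U p.1) - h a - φ p.1) - (h (V p.2) - h a - φ p.2) := by ring
  rw [h4]
  exact (enorm_sub_le).trans (add_le_add (h1 _ _ _ (hU p)) (h1 _ _ _ (hV p)))

end Step

/-! ### The Lindeberg bound for two product measures -/

section Lindeberg

variable {n d : ℕ}

/-- The gradient in the `i`-th slot. -/
def jet1 (F : Sample n d → ℝ) (i : Fin n) (w : Sample n d) : Fin d → ℝ :=
  fun k => pderiv i k F w

/-- The Hessian in the `i`-th slot. -/
def jet2 (F : Sample n d → ℝ) (i : Fin n) (w : Sample n d) : Fin d → Fin d → ℝ :=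
  fun k l => pderiv i k (pderiv i l F) w

/-- The third derivatives in the `i`-th slot, maximized over `[m, y_i] ∪ [m, z_i]`. -/
def jet3Sup (F : Sample n d → ℝ) (i : Fin n) (m : Fin d → ℝ) (y z : Sample n d) :
    Fin d → Fin d → Fin d → ℝ≥0∞ :=
  fun k l p => ⨆ v ∈ segment ℝ m (y i) ∪ segment ℝ m (z i),
    ‖pderiv i k (pderiv i l (pderiv i p F)) (hybrid y z i v)‖ₑ

/-- The bound on the error of replacing `y_i` by `z_i`. -/
def lindebergTerm (A B : Measure (Fin d → ℝ)) (m : Fin d → ℝ) (F : Sample n d → ℝ) (i : Fin n)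
    (y z : Sample n d) : ℝ≥0∞ :=
  momentTerm A B m (jet1 F i (hybrid y z i m)) (jet2 F i (hybrid y z i m)) +
  (remainderTerm (jet1 F i (hybrid y z i m)) (jet2 F i (hybrid y z i m)) (jet3Sup F i m y z)
      (y i - m) +
    remainderTerm (jet1 F i (hybrid y z i m)) (jet2 F i (hybrid y z i m)) (jet3Sup F i m y z)
      (z i - m))

theorem integrable_comp_of_mem_testClass {E : Type*} [MeasurableSpace E] {ρ : Measure E}
    [IsFiniteMeasure ρ] {h : ℝ → ℝ} (hh : h ∈ testClass) {U : E → ℝ} (hU : Integrable U ρ) :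
    Integrable (fun y => h (U y)) ρ := by
  have h1 : Integrable (fun y => ‖h 0‖ + ‖U y‖) ρ := (integrable_const _).add hU.norm
  refine h1.mono' (hh.1.continuous.comp_aestronglyMeasurable hU.1)
    (Eventually.of_forall fun y => ?_)
  have := abs_sub_le_of_mem_testClass hh (U y) 0
  rw [sub_zero] at this
  calc ‖h (U y)‖ = ‖h 0 + (h (U y) - h 0)‖ := by congr 1; ring
    _ ≤ ‖h 0‖ + ‖h (U y) - h 0‖ := norm_add_le _ _
    _ ≤ _ := by gcongr; exact this

theorem enorm_integral_comp_sub_le {E : Type*} [MeasurableSpace E] {ρ : Measure E}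
    [IsFiniteMeasure ρ] {h : ℝ → ℝ} (hh : h ∈ testClass) {U V : E → ℝ} (hU : Integrable U ρ)
    (hV : Integrable V ρ) :
    ‖∫ y, h (U y) ∂ρ - ∫ y, h (V y) ∂ρ‖ₑ ≤ ∫⁻ y, ‖U y - V y‖ₑ ∂ρ := by
  rw [← integral_sub (integrable_comp_of_mem_testClass hh hU)
    (integrable_comp_of_mem_testClass hh hV)]
  refine (enorm_integral_le_lintegral_enorm _).trans (lintegral_mono fun y => ?_)
  rw [Real.enorm_eq_ofReal_abs, Real.enorm_eq_ofReal_abs]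
  exact ENNReal.ofReal_le_ofReal (abs_sub_le_of_mem_testClass hh _ _)

theorem enorm_hybrid_sub_le {F : Sample n d → ℝ} (hF : ContDiff ℝ 3 F) (i : Fin n)
    (m : Fin d → ℝ) (y z : Sample n d) {v : Fin d → ℝ} (hv : v = y i ∨ v = z i) :
    ‖F (hybrid y z i v) - (F (hybrid y z i m) +
      quadPoly (jet1 F i (hybrid y z i m)) (jet2 F i (hybrid y z i m)) (v - m))‖ₑ ≤
      cubicTerm (jet3Sup F i m y z) (v - m) := by
  obtain ⟨w, hw, he⟩ := exists_taylor_hybrid hF y z i m v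
  have hw' : w ∈ segment ℝ m (y i) ∪ segment ℝ m (z i) := by
    rcases hv with rfl | rfl
    · exact Or.inl hw
    · exact Or.inr hw
  have h1 : F (hybrid y z i v) - (F (hybrid y z i m) +
      quadPoly (jet1 F i (hybrid y z i m)) (jet2 F i (hybrid y z i m)) (v - m)) =
      (∑ p, ∑ l, ∑ k, pderiv i p (pderiv i l (pderiv i k F)) (hybrid y z i w) *
        (v - m) p * (v - m) l * (v - m) k) / 6 := by
    -- Summation indices are relabelled instead of partial derivatives being interchanged, so the
    -- symmetry of higher derivatives is not needed.
    have h2 : (∑ k, (v k - m k) * ∑ l, (v l - m l) * pderiv i l (pderiv i k F) (hybrid y z i m))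
        = ∑ k, ∑ l, pderiv i k (pderiv i l F) (hybrid y z i m) * ((v - m) k * (v - m) l) := by
      rw [Finset.sum_comm]
      simp only [Finset.mul_sum, Pi.sub_apply]
      exact Finset.sum_congr rfl fun k _ => Finset.sum_congr rfl fun l _ => by ring
    have h3 : (∑ k, (v k - m k) * ∑ l, (v l - m l) * ∑ p, (v p - m p) *
          pderiv i p (pderiv i l (pderiv i k F)) (hybrid y z i w)) =
        ∑ p, ∑ l, ∑ k, pderiv i p (pderiv i l (pderiv i k F)) (hybrid y z i w) *
        (v - m) p * (v - m) l * (v - m) k := by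
      simp only [Finset.mul_sum, Pi.sub_apply]
      have : ∀ g : Fin d → Fin d → Fin d → ℝ, ∑ k, ∑ l, ∑ p, g k l p = ∑ p, ∑ l, ∑ k, g k l p := by
        intro g
        rw [Finset.sum_comm]
        simp only [Finset.sum_comm (f := fun k p => g k _ p)]
        rw [Finset.sum_comm]
      rw [this]
      exact Finset.sum_congr rfl fun k _ => Finset.sum_congr rfl fun l _ =>
        Finset.sum_congr rfl fun p _ => by ring
    rw [he, h2, h3]
    simp only [quadPoly, jet1, jet2, Pi.sub_apply]
    have : ∑ k, pderiv i k F (hybrid y z i m) * (v k - m k)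
        = ∑ k, (v k - m k) * pderiv i k F (hybrid y z i m) :=
      Finset.sum_congr rfl fun k _ => mul_comm _ _
    rw [this]
    ring
  rw [h1, div_eq_mul_inv, enorm_mul]
  have h6 : ‖(6 : ℝ)⁻¹‖ₑ ≤ 1 := by
    rw [Real.enorm_eq_ofReal (by norm_num)]
    exact ENNReal.ofReal_le_one.2 (by norm_num)
  refine (mul_le_of_le_one_right' h6).trans ?_
  refine (enorm_sum_le _ _).trans (Finset.sum_le_sum fun k _ => (enorm_sum_le _ _).trans
    (Finset.sum_le_sum fun l _ => (enorm_sum_le _ _).trans (Finset.sum_le_sum fun p _ => ?_)))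
  simp only [enorm_mul]
  gcongr
  exact le_iSup₂ (f := fun v _ => ‖pderiv i k (pderiv i l (pderiv i p F)) (hybrid y z i v)‖ₑ) w hw'

/-- The inequality x ≤ 1 + x³ converts first powers into the cubes already present in
`remainderTerm`. It serves integrability only, not the rate. -/
theorem enorm_quadPoly_le (b : Fin d → ℝ) (c : Fin d → Fin d → ℝ) (η : Fin d → ℝ) :
    ‖quadPoly b c η‖ₑ ≤ 2 +
      ((∑ k, ‖b k‖ₑ * ‖η k‖ₑ) ^ 3 + (∑ k, ∑ l, ‖c k l‖ₑ * ‖η k‖ₑ * ‖η l‖ₑ) ^ 3) := by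
  have hx : ∀ x : ℝ≥0∞, x ≤ 1 + x ^ 3 := fun x => by
    rcases le_total x 1 with h | h
    · exact h.trans le_self_add
    · exact (le_self_pow h (by norm_num)).trans le_add_self
  have h1 : ‖∑ k, b k * η k‖ₑ ≤ ∑ k, ‖b k‖ₑ * ‖η k‖ₑ :=
    (enorm_sum_le _ _).trans_eq (by simp only [enorm_mul])
  have h2 : ‖(∑ k, ∑ l, c k l * (η k * η l)) / 2‖ₑ ≤ ∑ k, ∑ l, ‖c k l‖ₑ * ‖η k‖ₑ * ‖η l‖ₑ := by
    have h6 : ‖(2 : ℝ)⁻¹‖ₑ ≤ 1 := by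
      rw [Real.enorm_eq_ofReal (by norm_num)]
      exact ENNReal.ofReal_le_one.2 (by norm_num)
    rw [div_eq_mul_inv, enorm_mul]
    refine (mul_le_of_le_one_right' h6).trans ?_
    refine (enorm_sum_le _ _).trans (Finset.sum_le_sum fun k _ => ?_)
    exact (enorm_sum_le _ _).trans_eq (by simp only [enorm_mul, mul_assoc])
  refine (enorm_add_le _ _).trans ((add_le_add (h1.trans (hx _)) (h2.trans (hx _))).trans_eq ?_)
  rw [add_add_add_comm, one_add_one_eq_two]

variable {A B : Measure (Fin d → ℝ)} {m : Fin d → ℝ} {F : Sample n d → ℝ}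

theorem enorm_hybrid_sub_hybrid_le (hF : ContDiff ℝ 3 F) (i : Fin n) (y z : Sample n d) :
    ‖F (hybrid y z i (y i)) - F (hybrid y z i (z i))‖ₑ ≤ 4 + lindebergTerm A B m F i y z := by
  set b := jet1 F i (hybrid y z i m) with hb
  set c := jet2 F i (hybrid y z i m) with hc
  have key : ∀ v, v = y i ∨ v = z i → ‖F (hybrid y z i v) - F (hybrid y z i m)‖ₑ ≤
      2 + remainderTerm b c (jet3Sup F i m y z) (v - m) := by
    intro v hv
    have : F (hybrid y z i v) - F (hybrid y z i m) = quadPoly b c (v - m) +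
        (F (hybrid y z i v) - (F (hybrid y z i m) + quadPoly b c (v - m))) := by ring
    rw [this, remainderTerm, ← add_assoc]
    exact (enorm_add_le _ _).trans
      (add_le_add (enorm_quadPoly_le b c _) (enorm_hybrid_sub_le hF i m y z hv))
  have h1 : F (hybrid y z i (y i)) - F (hybrid y z i (z i)) =
      (F (hybrid y z i (y i)) - F (hybrid y z i m)) -
      (F (hybrid y z i (z i)) - F (hybrid y z i m)) := by ring
  rw [h1]
  refine enorm_sub_le.trans ((add_le_add (key _ (Or.inl rfl)) (key _ (Or.inr rfl))).trans ?_)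
  rw [add_add_add_comm, lindebergTerm]
  have : (2 : ℝ≥0∞) + 2 = 4 := by norm_num
  rw [this]
  exact add_le_add le_rfl le_add_self

/-- Telescope, redraw the pair in slot `i`, and apply the bound for one exchange. Integrability
under the powers of `A` is a conclusion: each exchange changes `F` by at most 4 plus its Lindeberg
term, so integrability carries over from `B`. -/
theorem lindeberg_bound [IsProbabilityMeasure A] [IsProbabilityMeasure B] (hF : ContDiff ℝ 3 F)
    (hA : ∀ (r : ℕ) (κ : Fin r → Fin d), r ≤ 4 → Integrable (monomial m κ) A)
    (hB : ∀ (r : ℕ) (κ : Fin r → Fin d), r ≤ 4 → Integrable (monomial m κ) B)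
    (hm : ∀ k, momentGap A B m ![k] = 0)
    (hΦ : ∀ i, Measurable fun p : Sample n d × Sample n d => lindebergTerm A B m F i p.1 p.2)
    (hFB : Integrable F (Measure.pi fun _ => B))
    (hfin : ∑ i, ∫⁻ p : Sample n d × Sample n d, lindebergTerm A B m F i p.1 p.2
      ∂((Measure.pi fun _ => A).prod (Measure.pi fun _ => B)) ≠ ⊤) :
    Integrable F (Measure.pi fun _ => A) ∧ ∀ h ∈ testClass,
      ‖∫ y, h (F y) ∂(Measure.pi fun _ => A) - ∫ z, h (F z) ∂(Measure.pi fun _ => B)‖ₑ ≤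
      ∑ i, ∫⁻ p : Sample n d × Sample n d, lindebergTerm A B m F i p.1 p.2
        ∂((Measure.pi fun _ => A).prod (Measure.pi fun _ => B)) := by
  set μ : Measure (Sample n d) := Measure.pi fun _ => A with hμ
  set ν : Measure (Sample n d) := Measure.pi fun _ => B with hν
  have hcont : ∀ i : Fin n, Continuous fun p : Sample n d × Sample n d =>
      F (hybrid p.1 p.2 i (p.1 i)) - F (hybrid p.1 p.2 i (p.2 i)) := by
    intro i
    have h1 : Continuous fun p : Sample n d × Sample n d => hybrid p.1 p.2 i (p.1 i) :=
      (continuous_hybrid i).comp (by fun_prop : Continuous fun p : Sample n d × Sample n d =>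
        (p.1, p.2, p.1 i))
    have h2 : Continuous fun p : Sample n d × Sample n d => hybrid p.1 p.2 i (p.2 i) :=
      (continuous_hybrid i).comp (by fun_prop : Continuous fun p : Sample n d × Sample n d =>
        (p.1, p.2, p.2 i))
    exact (hF.continuous.comp h1).sub (hF.continuous.comp h2)
  have hdiff : ∀ i : Fin n, Integrable (fun p : Sample n d × Sample n d =>
      F (hybrid p.1 p.2 i (p.1 i)) - F (hybrid p.1 p.2 i (p.2 i))) (μ.prod ν) := by
    intro i
    refine ⟨(hcont i).aestronglyMeasurable, ?_⟩
    refine lt_of_le_of_lt (lintegral_mono fun p =>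
      enorm_hybrid_sub_hybrid_le (A := A) (B := B) (m := m) hF i p.1 p.2) ?_
    rw [lintegral_add_left measurable_const]
    have := (ENNReal.sum_ne_top.1 hfin) i (Finset.mem_univ i)
    simp only [lintegral_const, measure_univ, mul_one]
    exact ENNReal.add_lt_top.2 ⟨by norm_num, this.lt_top⟩
  have hFA : Integrable F μ := by
    have h1 : Integrable (fun p : Sample n d × Sample n d => F p.1) (μ.prod ν) := by
      have h2 := (integrable_finsetSum Finset.univ fun i _ => hdiff i).add (hFB.comp_snd μ)
      refine h2.congr (Eventually.of_forall fun p => ?_)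
      simp only [Pi.add_apply, ← sum_hybrid_sub]
      ring
    rwa [Integrable.comp_fst_iff (IsProbabilityMeasure.ne_zero ν)] at h1
  refine ⟨hFA, fun h hh => ?_⟩
  have hhc : Continuous h := hh.1.continuous
  have hlip : ∀ {ρ : Measure (Sample n d)} [IsProbabilityMeasure ρ], Integrable F ρ →
      Integrable (fun y => h (F y)) ρ := fun hρ => integrable_comp_of_mem_testClass hh hρ
  set T : Fin n → Sample n d × Sample n d → ℝ := fun i p =>
    h (F (hybrid p.1 p.2 i (p.1 i))) - h (F (hybrid p.1 p.2 i (p.2 i))) with hT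
  have hTi : ∀ i, Integrable (T i) (μ.prod ν) := fun i => by
    refine (hdiff i).mono ?_ (Eventually.of_forall fun p => abs_sub_le_of_mem_testClass hh _ _)
    have h1 : Continuous fun p : Sample n d × Sample n d => hybrid p.1 p.2 i (p.1 i) :=
      (continuous_hybrid i).comp (by fun_prop : Continuous fun p : Sample n d × Sample n d =>
        (p.1, p.2, p.1 i))
    have h2 : Continuous fun p : Sample n d × Sample n d => hybrid p.1 p.2 i (p.2 i) :=
      (continuous_hybrid i).comp (by fun_prop : Continuous fun p : Sample n d × Sample n d =>
        (p.1, p.2, p.2 i))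
    exact ((hhc.comp (hF.continuous.comp h1)).sub
      (hhc.comp (hF.continuous.comp h2))).aestronglyMeasurable
  have htel : ∫ y, h (F y) ∂μ - ∫ z, h (F z) ∂ν = ∑ i, ∫ p, T i p ∂(μ.prod ν) := by
    rw [← integral_finsetSum _ fun i _ => hTi i]
    have h1 := integral_sub ((hlip hFA).comp_fst ν) ((hlip hFB).comp_snd μ)
    rw [integral_fun_fst (fun y => h (F y)), integral_fun_snd (fun y => h (F y))] at h1
    simp only [probReal_univ, one_smul] at h1
    rw [← h1]
    exact integral_congr_ae (Eventually.of_forall fun p => sum_hybrid_sub (fun y => h (F y)) p.1 p.2)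
  rw [htel]
  refine (enorm_sum_le _ _).trans (Finset.sum_le_sum fun i _ => ?_)
  have hmp := measurePreserving_update_prod (n := n) A B i
  have hTu : Integrable (fun q : (Sample n d × Sample n d) × ((Fin d → ℝ) × (Fin d → ℝ)) =>
      T i (Function.update q.1.1 i q.2.1, Function.update q.1.2 i q.2.2))
      ((μ.prod ν).prod (A.prod B)) := hmp.integrable_comp_of_integrable (hTi i)
  -- The inner integral runs over a fresh pair in slot `i`, while the rest of the two samples, and
  -- hence the base point, stays fixed.
  have h1 : ∫ p, T i p ∂(μ.prod ν) = ∫ p, ∫ q : (Fin d → ℝ) × (Fin d → ℝ),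
      T i (Function.update p.1 i q.1, Function.update p.2 i q.2) ∂(A.prod B) ∂(μ.prod ν) := by
    rw [← integral_prod _ hTu]
    have h2 := hmp.map_eq
    rw [← hμ, ← hν] at h2
    have h3 : AEStronglyMeasurable (T i) (Measure.map
      (fun q : (Sample n d × Sample n d) × ((Fin d → ℝ) × (Fin d → ℝ)) =>
        (Function.update q.1.1 i q.2.1, Function.update q.1.2 i q.2.2))
        ((μ.prod ν).prod (A.prod B))) := by
      rw [h2]; exact (hTi i).aestronglyMeasurable
    rw [← integral_map hmp.measurable.aemeasurable h3, h2]
  have hΦu := (hΦ i).comp hmp.measurable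
  have h5 := hmp.lintegral_comp (hΦ i)
  have h6 := lintegral_prod (μ := μ.prod ν) (ν := A.prod B) _ hΦu.aemeasurable
  rw [h1, ← h5]
  refine le_of_le_of_eq ?_ h6.symm
  refine (enorm_integral_le_lintegral_enorm _).trans (lintegral_mono fun p => ?_)
  have h4 := enorm_integral_sub_le (A := A) (B := B) (m := m) hA hB hm hh (F (hybrid p.1 p.2 i m))
    (jet1 F i (hybrid p.1 p.2 i m)) (jet2 F i (hybrid p.1 p.2 i m))
    (U := fun v => F (hybrid p.1 p.2 i v)) (V := fun v => F (hybrid p.1 p.2 i v))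
    (e := fun q => jet3Sup F i m (Function.update p.1 i q.1) (Function.update p.2 i q.2))
    (fun q => by
      have := enorm_hybrid_sub_le hF i m (Function.update p.1 i q.1) (Function.update p.2 i q.2)
        (v := q.1) (Or.inl (by simp))
      simpa only [hybrid_update] using this)
    (fun q => by
      have := enorm_hybrid_sub_le hF i m (Function.update p.1 i q.1) (Function.update p.2 i q.2)
        (v := q.2) (Or.inr (by simp))
      simpa only [hybrid_update] using this)
  simpa only [hT, hybrid_update, Function.update_self, lindebergTerm, Function.comp_def] using h4

end Lindeberg

/-! ### Moments of sums of independent centered random variables -/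

section IndependentSums

theorem integrable_pow_of_memLp_four {Ω : Type*} [MeasurableSpace Ω] {Q : Measure Ω}
    [IsFiniteMeasure Q] {V : Ω → ℝ} (hV : MemLp V 4 Q) {k : ℕ} (hk : k ≤ 4) :
    Integrable (fun ω => V ω ^ k) Q := by
  have h1 : MemLp V k Q := hV.mono_exponent (by exact_mod_cast hk)
  refine (integrable_norm_iff (hV.aestronglyMeasurable.pow k)).1 ?_
  simpa only [Pi.pow_apply, norm_pow] using h1.integrable_norm_pow'

variable {Ω ι : Type*} [MeasurableSpace Ω] {Q : Measure Ω} [IsProbabilityMeasure Q]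
  {V : ι → Ω → ℝ}

theorem integral_sum_sq_le (hV : iIndepFun V Q) (hm : ∀ i, Measurable (V i))
    (h2 : ∀ i, MemLp (V i) 2 Q) (h0 : ∀ i, ∫ ω, V i ω ∂Q = 0) {σ : ℝ}
    (hσ : ∀ i, ∫ ω, V i ω ^ 2 ∂Q ≤ σ) (s : Finset ι) :
    ∫ ω, (∑ i ∈ s, V i ω) ^ 2 ∂Q ≤ s.card * σ := by
  classical
  induction s using Finset.induction with
  | empty => simp
  | insert i s hi ih =>
    have hS : MemLp (fun ω => ∑ j ∈ s, V j ω) 2 Q := memLp_finsetSum _ fun j _ => h2 j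
    have hind : IndepFun (fun ω => ∑ j ∈ s, V j ω) (V i) Q := by
      have := hV.indepFun_finsetSum_of_notMem hm hi
      convert this using 1
      ext ω; simp
    have hI := fun j => (h2 j).integrable one_le_two
    have hSI := hS.integrable one_le_two
    have hprod : ∫ ω, (∑ j ∈ s, V j ω) * V i ω ∂Q = 0 := by
      rw [hind.integral_fun_mul_eq_mul_integral hSI.1 (hI i).1, h0, mul_zero]
    have hprodI : Integrable (fun ω => (∑ j ∈ s, V j ω) * V i ω) Q :=
      hind.integrable_mul hSI (hI i)
    have e : ∀ ω, (∑ j ∈ insert i s, V j ω) ^ 2 =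
        V i ω ^ 2 + (2 * ((∑ j ∈ s, V j ω) * V i ω) + (∑ j ∈ s, V j ω) ^ 2) := fun ω => by
      rw [Finset.sum_insert hi]; ring
    simp only [e]
    rw [integral_add (h2 i).integrable_sq ((hprodI.const_mul 2).fun_add hS.integrable_sq),
      integral_add (hprodI.const_mul 2) hS.integrable_sq, integral_const_mul,
      Finset.card_insert_of_notMem hi, hprod]
    push_cast
    linarith [hσ i]

/-- Adding one summand V to S, the terms S³V and SV³ have mean zero, which leaves E S⁴ + 6 E S² E V²
+ E V⁴. The induction closes because 3c² + 6c + 1 ≤ 3(c + 1)². -/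
theorem integral_sum_pow_four_le (hV : iIndepFun V Q) (hm : ∀ i, Measurable (V i))
    (h4 : ∀ i, MemLp (V i) 4 Q) (h0 : ∀ i, ∫ ω, V i ω ∂Q = 0) {σ β : ℝ}
    (hσ : ∀ i, ∫ ω, V i ω ^ 2 ∂Q ≤ σ) (hσβ : σ ^ 2 ≤ β) (hβ : ∀ i, ∫ ω, V i ω ^ 4 ∂Q ≤ β)
    (s : Finset ι) :
    ∫ ω, (∑ i ∈ s, V i ω) ^ 4 ∂Q ≤ 3 * s.card ^ 2 * β := by
  classical
  induction s using Finset.induction with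
  | empty => simp
  | insert i s hi ih =>
    have hsq := integral_sum_sq_le hV hm (fun j => (h4 j).mono_exponent (by norm_num)) h0 hσ s
    set S : Ω → ℝ := fun ω => ∑ j ∈ s, V j ω with hSdef
    have hS : MemLp S 4 Q := memLp_finsetSum _ fun j _ => h4 j
    have hind : IndepFun S (V i) Q := by
      have := hV.indepFun_finsetSum_of_notMem hm hi
      convert this using 1
      ext ω; simp [hSdef]
    have hind' : ∀ a b : ℕ, IndepFun (fun ω => S ω ^ a) (fun ω => V i ω ^ b) Q := fun a b =>
      hind.comp (φ := fun t : ℝ => t ^ a) (ψ := fun t : ℝ => t ^ b) (by fun_prop) (by fun_prop)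
    have hI := fun (k : ℕ) (hk : k ≤ 4) => integrable_pow_of_memLp_four (h4 i) hk
    have hSI := fun (k : ℕ) (hk : k ≤ 4) => integrable_pow_of_memLp_four hS hk
    have hprod : ∀ a b : ℕ, a ≤ 4 → b ≤ 4 →
        ∫ ω, S ω ^ a * V i ω ^ b ∂Q = (∫ ω, S ω ^ a ∂Q) * ∫ ω, V i ω ^ b ∂Q :=
      fun a b ha hb => (hind' a b).integral_fun_mul_eq_mul_integral (hSI a ha).1 (hI b hb).1
    have hprodI : ∀ a b : ℕ, a ≤ 4 → b ≤ 4 → Integrable (fun ω => S ω ^ a * V i ω ^ b) Q :=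
      fun a b ha hb => (hind' a b).integrable_mul (hSI a ha) (hI b hb)
    have hS0 : ∫ ω, S ω ^ 1 ∂Q = 0 := by
      simp only [pow_one, hSdef]
      rw [integral_finsetSum _ fun j _ => (h4 j).integrable (by norm_num)]
      simp [h0]
    have hV0 : ∫ ω, V i ω ^ 1 ∂Q = 0 := by simpa using h0 i
    have e : ∀ ω, (∑ j ∈ insert i s, V j ω) ^ 4 =
        S ω ^ 4 + (4 * (S ω ^ 3 * V i ω ^ 1) + (6 * (S ω ^ 2 * V i ω ^ 2) +
          (4 * (S ω ^ 1 * V i ω ^ 3) + V i ω ^ 4))) := fun ω => by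
      rw [Finset.sum_insert hi]; simp only [hSdef]; ring
    simp only [e]
    have i1 := (hprodI 3 1 (by norm_num) (by norm_num)).const_mul 4
    have i2 := (hprodI 2 2 (by norm_num) (by norm_num)).const_mul 6
    have i3 := (hprodI 1 3 (by norm_num) (by norm_num)).const_mul 4
    rw [integral_add (hSI 4 le_rfl) (i1.fun_add (i2.fun_add (i3.fun_add (hI 4 le_rfl)))),
      integral_add i1 (i2.fun_add (i3.fun_add (hI 4 le_rfl))), integral_add i2 (i3.fun_add (hI 4 le_rfl)),
      integral_add i3 (hI 4 le_rfl), integral_const_mul, integral_const_mul, integral_const_mul,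
      hprod 3 1 (by norm_num) (by norm_num), hprod 2 2 (by norm_num) (by norm_num),
      hprod 1 3 (by norm_num) (by norm_num), hS0, hV0, Finset.card_insert_of_notMem hi]
    have hV2 : 0 ≤ ∫ ω, V i ω ^ 2 ∂Q := integral_nonneg fun ω => by positivity
    have hσ0 : 0 ≤ σ := hV2.trans (hσ i)
    have hmul : (∫ ω, S ω ^ 2 ∂Q) * ∫ ω, V i ω ^ 2 ∂Q ≤ s.card * σ * σ :=
      mul_le_mul hsq (hσ i) hV2 (by positivity)
    have hc : (0 : ℝ) ≤ s.card := Nat.cast_nonneg _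
    have hβ0 : 0 ≤ β := (sq_nonneg σ).trans hσβ
    push_cast
    nlinarith [hβ i, mul_le_mul_of_nonneg_left hσβ hc]

end IndependentSums

/-! ### Averages of centered functions over an i.i.d. sample -/

section SampleMoments

variable {n d : ℕ} [NeZero n] {P : Measure (Fin d → ℝ)} [IsProbabilityMeasure P]

/-- The average of `W` over the sample. -/
def average {n d : ℕ} (W : (Fin d → ℝ) → ℝ) (x : Sample n d) : ℝ := (n : ℝ)⁻¹ * ∑ j, W (x j)

/-- The common final step for k = 2 and k = 4: take the k-th root of a moment inequality for the
sum, with `C ≤ 2 ^ k` absorbed into the factor 2. -/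
theorem average_pow_eLpNorm_le {W : (Fin d → ℝ) → ℝ} {k : ℕ} (hk : Even k)
    (hk0 : k ≠ 0) {C : ℝ} (hWk : MemLp W k P)
    (h : ∫ x : Sample n d, (∑ j, W (x j)) ^ k ∂(Measure.pi fun _ => P)
      ≤ C * (n : ℝ) ^ (k / 2 : ℕ) * ∫ v, W v ^ k ∂P) (hCk : C ≤ 2 ^ k) :
    eLpNorm (fun x : Sample n d => average W x) k (Measure.pi fun _ => P) ≤
      2 * (n : ℝ≥0∞) ^ (-(1 / 2) : ℝ) * eLpNorm W k P := by
  have hn : (0 : ℝ) < n := by exact_mod_cast Nat.pos_of_ne_zero (NeZero.ne n)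
  rw [← ENNReal.pow_le_pow_left_iff hk0, eLpNorm_nat_pow _ hk0, mul_pow, mul_pow,
    eLpNorm_nat_pow _ hk0]
  have hWj : ∀ j : Fin n, MemLp (fun x : Sample n d => W (x j)) k (Measure.pi fun _ => P) :=
    fun j => hWk.comp_measurePreserving (measurePreserving_eval (fun _ : Fin n => P) j)
  have hsum : MemLp (fun x : Sample n d => average W x) k (Measure.pi fun _ => P) :=
    (memLp_finsetSum _ fun j _ => hWj j).const_mul _
  have key : ∀ {E : Type} [MeasurableSpace E] {ρ : Measure E} [IsProbabilityMeasure ρ] {f : E → ℝ},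
      MemLp f k ρ → ∫⁻ v, ‖f v‖ₑ ^ k ∂ρ = ENNReal.ofReal (∫ v, f v ^ k ∂ρ) := by
    intro E _ ρ _ f hf
    have hpow : ∀ v, f v ^ k = ‖f v‖ ^ k := fun v => by
      rw [Real.norm_eq_abs, hk.pow_abs]
    rw [ofReal_integral_eq_lintegral_ofReal]
    · refine lintegral_congr fun v => ?_
      rw [hpow, ENNReal.ofReal_pow (norm_nonneg _), ofReal_norm]
    · simp only [hpow]
      exact hf.integrable_norm_pow'
    · exact Eventually.of_forall fun v => hk.pow_nonneg _
  rw [key hsum, key hWk]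
  have hnk : ((n : ℝ≥0∞) ^ (-(1 / 2) : ℝ)) ^ k = ENNReal.ofReal (((n : ℝ) ^ (k / 2))⁻¹) := by
    obtain ⟨r, rfl⟩ := hk
    have : (r + r) / 2 = r := by omega
    rw [this, ← ENNReal.rpow_natCast, ← ENNReal.rpow_mul, ← ENNReal.ofReal_natCast n,
      ENNReal.ofReal_rpow_of_pos hn]
    congr 1
    rw [← Real.rpow_natCast, ← Real.rpow_neg hn.le]
    congr 1
    push_cast; ring
  rw [hnk, (by norm_num : (2 : ℝ≥0∞) = ENNReal.ofReal 2), ← ENNReal.ofReal_pow (by norm_num),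
    ← ENNReal.ofReal_mul (by positivity), ← ENNReal.ofReal_mul (by positivity)]
  refine ENNReal.ofReal_le_ofReal ?_
  simp only [average, mul_pow]
  rw [integral_const_mul]
  have hI : 0 ≤ ∫ v, W v ^ k ∂P := integral_nonneg fun v => hk.pow_nonneg _
  calc ((n : ℝ)⁻¹) ^ k * ∫ x : Sample n d, (∑ j, W (x j)) ^ k ∂(Measure.pi fun _ => P)
      ≤ ((n : ℝ)⁻¹) ^ k * (2 ^ k * (n : ℝ) ^ (k / 2 : ℕ) * ∫ v, W v ^ k ∂P) := by
        gcongr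
        exact h.trans (by gcongr)
    _ = 2 ^ k * ((n : ℝ) ^ (k / 2))⁻¹ * ∫ v, W v ^ k ∂P := by
        obtain ⟨r, rfl⟩ := hk
        have : (r + r) / 2 = r := by omega
        rw [this, pow_add ((n : ℝ)⁻¹), inv_pow]
        have : (n : ℝ) ^ r ≠ 0 := by positivity
        field_simp

theorem eLpNorm_two_average_le {W : (Fin d → ℝ) → ℝ} (hW : Measurable W) (hW2 : MemLp W 2 P)
    (h0 : ∫ v, W v ∂P = 0) :
    eLpNorm (fun x : Sample n d => average W x) 2 (Measure.pi fun _ => P) ≤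
      2 * (n : ℝ≥0∞) ^ (-(1 / 2) : ℝ) * eLpNorm W 2 P := by
  have hmp := fun j : Fin n => measurePreserving_eval (fun _ : Fin n => P) j
  have hint : ∀ (j : Fin n) (φ : (Fin d → ℝ) → ℝ), Measurable φ →
      ∫ x : Sample n d, φ (x j) ∂(Measure.pi fun _ => P) = ∫ v, φ v ∂P := fun j φ hφ => by
    rw [← (hmp j).map_eq, integral_map (hmp j).measurable.aemeasurable hφ.aestronglyMeasurable]
    rw [(hmp j).map_eq]
  refine average_pow_eLpNorm_le (k := 2) (C := 1) (by decide) (by norm_num) hW2 ?_ (by norm_num)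
  refine (integral_sum_sq_le (iIndepFun_pi fun _ => hW.aemeasurable)
    (fun j => hW.comp (measurable_pi_apply j))
    (fun j => hW2.comp_measurePreserving (hmp j)) (fun j => (hint j W hW).trans h0)
    (fun j => (hint j (fun v => W v ^ 2) (hW.pow_const 2)).le) Finset.univ).trans_eq ?_
  simp

theorem eLpNorm_four_average_le {W : (Fin d → ℝ) → ℝ} (hW : Measurable W) (hW4 : MemLp W 4 P)
    (h0 : ∫ v, W v ∂P = 0) :
    eLpNorm (fun x : Sample n d => average W x) 4 (Measure.pi fun _ => P) ≤
      2 * (n : ℝ≥0∞) ^ (-(1 / 2) : ℝ) * eLpNorm W 4 P := by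
  have hmp := fun j : Fin n => measurePreserving_eval (fun _ : Fin n => P) j
  have hint : ∀ (j : Fin n) (φ : (Fin d → ℝ) → ℝ), Measurable φ →
      ∫ x : Sample n d, φ (x j) ∂(Measure.pi fun _ => P) = ∫ v, φ v ∂P := fun j φ hφ => by
    rw [← (hmp j).map_eq, integral_map (hmp j).measurable.aemeasurable hφ.aestronglyMeasurable]
    rw [(hmp j).map_eq]
  -- The variance of W² is nonnegative.
  have hJ : (∫ v, W v ^ 2 ∂P) ^ 2 ≤ ∫ v, W v ^ 4 ∂P := by
    have h2 : MemLp (fun v => W v ^ 2) 2 P := by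
      refine (memLp_two_iff_integrable_sq (hW.pow_const 2).aestronglyMeasurable).2 ?_
      simpa only [← pow_mul] using integrable_pow_of_memLp_four hW4 (k := 4) le_rfl
    have h3 := variance_nonneg (fun v => W v ^ 2) P
    rw [variance_eq_sub h2] at h3
    have h4 : ∫ v, ((fun v => W v ^ 2) ^ 2) v ∂P = ∫ v, W v ^ 4 ∂P :=
      integral_congr_ae (Eventually.of_forall fun v => by simp only [Pi.pow_apply]; ring)
    rw [h4] at h3
    linarith
  refine average_pow_eLpNorm_le (k := 4) (C := 3) (by decide) (by norm_num) hW4 ?_ (by norm_num)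
  refine (integral_sum_pow_four_le (iIndepFun_pi fun _ => hW.aemeasurable)
    (fun j => hW.comp (measurable_pi_apply j))
    (fun j => hW4.comp_measurePreserving (hmp j)) (fun j => (hint j W hW).trans h0)
    (fun j => (hint j (fun v => W v ^ 2) (hW.pow_const 2)).le) hJ
    (fun j => (hint j (fun v => W v ^ 4) (hW.pow_const 4)).le) Finset.univ).trans_eq ?_
  simp

end SampleMoments

/-! ### The gap between population and bootstrap moments -/

/-- Subtracting the mean costs at most one more copy of the norm. This is one reason for the factor
2 in `M`. -/
theorem eLpNorm_sub_integral_le {E : Type*} [MeasurableSpace E] {ρ : Measure E}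
    [IsProbabilityMeasure ρ] {φ : E → ℝ} (hφ : AEStronglyMeasurable φ ρ) {p : ℝ≥0∞} (hp : 1 ≤ p) :
    eLpNorm (fun v => φ v - ∫ w, φ w ∂ρ) p ρ ≤ 2 * eLpNorm φ p ρ := by
  refine (eLpNorm_sub_le hφ aestronglyMeasurable_const hp).trans ?_
  rw [two_mul]
  refine add_le_add le_rfl ?_
  rw [eLpNorm_const _ (zero_lt_one.trans_le hp).ne' (IsProbabilityMeasure.ne_zero ρ)]
  simp only [measure_univ, ENNReal.one_rpow, mul_one]
  refine (enorm_integral_le_lintegral_enorm _).trans ?_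
  rw [← eLpNorm_one_eq_lintegral_enorm]
  exact eLpNorm_le_eLpNorm_of_exponent_le hp hφ

theorem eLpNorm_mul_le_four {Ω : Type*} [MeasurableSpace Ω] {Q : Measure Ω}
    [IsProbabilityMeasure Q] {f g : Ω → ℝ≥0∞} (hf : AEMeasurable f Q) (hg : AEMeasurable g Q) :
    eLpNorm (fun ω => f ω * g ω) 2 Q ≤ eLpNorm f 4 Q * eLpNorm g 4 Q := by
  have := eLpNorm_prod_le (Q := Q) (Finset.univ : Finset (Fin 2)) (f := ![f, g])
    (fun i _ => by fin_cases i <;> simpa) (p := 2) (N := 4) (by norm_num) (by simp)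
  simpa [Fin.prod_univ_two] using this

theorem enorm_finset_prod {ι : Type*} (s : Finset ι) (f : ι → ℝ) :
    ‖∏ i ∈ s, f i‖ₑ = ∏ i ∈ s, ‖f i‖ₑ := by
  classical
  induction s using Finset.induction with
  | empty => simp
  | insert i s hi ih => rw [Finset.prod_insert hi, Finset.prod_insert hi, enorm_mul, ih]

theorem eLpNorm_eval {n d : ℕ} {P : Measure (Fin d → ℝ)} [IsProbabilityMeasure P]
    {φ : (Fin d → ℝ) → ℝ} (hφ : AEStronglyMeasurable φ P) (p : ℝ≥0∞) (j : Fin n) :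
    eLpNorm (fun x : Sample n d => φ (x j)) p (Measure.pi fun _ => P) = eLpNorm φ p P := by
  have h := measurePreserving_eval (fun _ : Fin n => P) j
  exact eLpNorm_comp_measurePreserving (f := Function.eval j) (p := p) hφ h

@[fun_prop]
theorem continuous_sampleMean {n d : ℕ} : Continuous fun x : Sample n d => sampleMean x := by
  unfold sampleMean
  fun_prop

theorem continuous_monomial {d r : ℕ} (m : Fin d → ℝ) (κ : Fin r → Fin d) :
    Continuous (monomial m κ) := by
  unfold monomial
  fun_prop

section Gap

variable {n d : ℕ} {P : Measure (Fin d → ℝ)}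

theorem sampleMean_apply (x : Sample n d) (k : Fin d) :
    sampleMean x k = (n : ℝ)⁻¹ * ∑ i, x i k := by
  simp [sampleMean]

theorem memLp_coord (hP : MemLp id 12 P) (k : Fin d) : MemLp (fun v : Fin d → ℝ => v k) 12 P :=
  (ContinuousLinearMap.proj (R := ℝ) (φ := fun _ : Fin d => ℝ) k).comp_memLp' hP

theorem M_ne_top (hP : MemLp id 12 P) (k : Fin d) : M P k ≠ ⊤ :=
  ENNReal.mul_ne_top (by norm_num) (memLp_coord hP k).2.ne

theorem integral_empirical (x : Sample n d) (φ : (Fin d → ℝ) → ℝ) :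
    ∫ v, φ v ∂(empirical x) = average φ x := by
  rw [empirical, integral_smul_measure, integral_finsetSum_measure fun i _ => integrable_dirac
    enorm_lt_top]
  simp [average]

instance [NeZero n] (x : Sample n d) : IsProbabilityMeasure (empirical x) := by
  refine ⟨?_⟩
  have h : (n : ℝ≥0∞) ≠ 0 := by exact_mod_cast NeZero.ne n
  simp [empirical, ENNReal.inv_mul_cancel h]

theorem integrable_empirical (x : Sample n d) (φ : (Fin d → ℝ) → ℝ) [NeZero n] :
    Integrable φ (empirical x) := by
  refine Integrable.smul_measure ?_ (by simp [NeZero.ne n])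
  exact integrable_finsetSum_measure.2 fun i _ => integrable_dirac enorm_lt_top

/-- The law of `Ỹ_i` given the sample `x`. -/
def shifted (P : Measure (Fin d → ℝ)) (x : Sample n d) : Measure (Fin d → ℝ) :=
  P.map fun v => v + (sampleMean x - mean P)

/-- Translation carries the population mean to x̄, so the central moments of `shifted P x` do not
depend on `x`. -/
theorem integral_shifted_monomial (x : Sample n d) {r : ℕ} (κ : Fin r → Fin d) :
    ∫ v, monomial (sampleMean x) κ v ∂(shifted P x) = ∫ v, monomial (mean P) κ v ∂P := by
  rw [shifted, integral_map (by fun_prop) (continuous_monomial _ _).aestronglyMeasurable]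
  refine integral_congr_ae (Eventually.of_forall fun v => ?_)
  simp [monomial, sub_eq_add_neg, add_assoc]

theorem sampleMean_sub_mean [NeZero n] (x : Sample n d) (k : Fin d) :
    sampleMean x k - mean P k = average (fun v => v k - mean P k) x := by
  have hn : (n : ℝ) ≠ 0 := by exact_mod_cast NeZero.ne n
  rw [sampleMean_apply, average, Finset.sum_sub_distrib]
  simp only [Finset.sum_const, Finset.card_univ, Fintype.card_fin, nsmul_eq_mul]
  field_simp

variable [IsProbabilityMeasure P]

instance (x : Sample n d) : IsProbabilityMeasure (shifted P x) :=
  Measure.isProbabilityMeasure_map (by fun_prop)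

theorem eLpNorm_coord_sub_mean_le (hP : MemLp id 12 P) (k : Fin d) :
    eLpNorm (fun v : Fin d → ℝ => v k - mean P k) 12 P ≤ M P k :=
  eLpNorm_sub_integral_le (memLp_coord hP k).1 (by norm_num)

theorem eLpNorm_two_monomial_le (hP : MemLp id 12 P) {r : ℕ} (hr : r ≤ 4) (κ : Fin r → Fin d) :
    eLpNorm (monomial (mean P) κ) 2 P ≤ ∏ a, M P (κ a) := by
  have h1 := eLpNorm_prod_le (Q := P) Finset.univ
    (f := fun (a : Fin r) (v : Fin d → ℝ) => ‖v (κ a) - mean P (κ a)‖ₑ)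
    (fun a _ => Continuous.aemeasurable (by fun_prop)) (p := 2) (N := 12) (by norm_num) (by simp; omega)
  rw [← eLpNorm_enorm]
  simp only [monomial, enorm_finset_prod]
  refine h1.trans (Finset.prod_le_prod' fun a _ => ?_)
  rw [eLpNorm_enorm]
  exact eLpNorm_coord_sub_mean_le hP (κ a)

theorem memLp_two_monomial (hP : MemLp id 12 P) {r : ℕ} (hr : r ≤ 4) (κ : Fin r → Fin d) :
    MemLp (monomial (mean P) κ) 2 P :=
  ⟨(continuous_monomial _ _).aestronglyMeasurable, (eLpNorm_two_monomial_le hP hr κ).trans_lt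
    (ENNReal.prod_lt_top fun _ _ => (M_ne_top hP _).lt_top)⟩

theorem integrable_shifted_monomial (hP : MemLp id 12 P) (x : Sample n d) {r : ℕ} (hr : r ≤ 4)
    (κ : Fin r → Fin d) : Integrable (monomial (sampleMean x) κ) (shifted P x) := by
  rw [shifted, integrable_map_measure (continuous_monomial _ _).aestronglyMeasurable
    (by fun_prop)]
  refine ((memLp_two_monomial hP hr κ).integrable one_le_two).congr
    (Eventually.of_forall fun v => ?_)
  simp [monomial, sub_eq_add_neg, add_assoc]

variable [NeZero n]

/-- Both laws have mean x̄. This is the purpose of the centering: a gap of order n^{-1/2} here would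
add a term of order n^{1/2} D_1 = n^{1/6} R_1, which the hypotheses do not control. -/
theorem momentGap_one (hP : MemLp id 12 P) (x : Sample n d) (k : Fin d) :
    momentGap (shifted P x) (empirical x) (sampleMean x) ![k] = 0 := by
  have hn : (n : ℝ) ≠ 0 := by exact_mod_cast NeZero.ne n
  rw [momentGap, integral_shifted_monomial, integral_empirical]
  have h1 : ∫ v, monomial (mean P) ![k] v ∂P = 0 := by
    simp only [monomial, Fin.prod_univ_one, Matrix.cons_val_zero]
    rw [integral_sub ((memLp_coord hP k).integrable (by norm_num)) (integrable_const _)]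
    simp [mean]
  rw [h1, average]
  simp only [monomial, Fin.prod_univ_one, Matrix.cons_val_zero, Finset.sum_sub_distrib,
    Finset.sum_const, Finset.card_univ, Fintype.card_fin, nsmul_eq_mul, sampleMean_apply]
  field_simp
  simp

theorem eLpNorm_sampleMean_sub_mean_le (hP : MemLp id 12 P) (k : Fin d) :
    eLpNorm (fun x : Sample n d => sampleMean x k - mean P k) 4 (Measure.pi fun _ => P) ≤
      2 * (n : ℝ≥0∞) ^ (-(1 / 2) : ℝ) * M P k := by
  simp only [sampleMean_sub_mean]
  have h12 : MemLp (fun v : Fin d → ℝ => v k - mean P k) 12 P :=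
    (memLp_coord hP k).sub (memLp_const _)
  refine (eLpNorm_four_average_le (by fun_prop) (h12.mono_exponent (by norm_num)) ?_).trans ?_
  · rw [integral_sub ((memLp_coord hP k).integrable (by norm_num)) (integrable_const _)]
    simp [mean]
  · gcongr
    exact (eLpNorm_le_eLpNorm_of_exponent_le (by norm_num) h12.1).trans
      (eLpNorm_coord_sub_mean_le hP k)

theorem eLpNorm_sampleMean_le (hP : MemLp id 12 P) (k : Fin d) :
    eLpNorm (fun x : Sample n d => sampleMean x k) 12 (Measure.pi fun _ => P) ≤
      eLpNorm (fun v : Fin d → ℝ => v k) 12 P := by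
  have hnr : (n : ℝ) ≠ 0 := by exact_mod_cast NeZero.ne n
  have hn : (n : ℝ≥0∞) ≠ 0 := by exact_mod_cast NeZero.ne n
  have h1 : (fun x : Sample n d => sampleMean x k)
      = (n : ℝ)⁻¹ • ∑ i, fun x : Sample n d => x i k := by
    ext x; simp [sampleMean_apply]
  rw [h1, eLpNorm_const_smul]
  have hj : ∀ j : Fin n, eLpNorm (fun x : Sample n d => x j k) 12 (Measure.pi fun _ => P) =
      eLpNorm (fun v : Fin d → ℝ => v k) 12 P := fun j =>
    eLpNorm_eval (memLp_coord hP k).1 12 j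
  refine (mul_le_mul_right (eLpNorm_sum_le (fun j _ => ?_) (by norm_num)) _).trans ?_
  · exact (Continuous.aestronglyMeasurable (by fun_prop))
  · simp only [hj, Finset.sum_const, Finset.card_univ, Fintype.card_fin, nsmul_eq_mul]
    rw [← mul_assoc, enorm_inv hnr, Real.enorm_natCast,
      ENNReal.inv_mul_cancel hn (by simp), one_mul]

theorem eLpNorm_sub_sampleMean_le (hP : MemLp id 12 P) (j : Fin n) (k : Fin d) :
    eLpNorm (fun x : Sample n d => x j k - sampleMean x k) 12 (Measure.pi fun _ => P) ≤ M P k := by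
  have hj : eLpNorm (fun x : Sample n d => x j k) 12 (Measure.pi fun _ => P) =
      eLpNorm (fun v : Fin d → ℝ => v k) 12 P :=
    eLpNorm_eval (memLp_coord hP k).1 12 j
  refine (eLpNorm_sub_le (Continuous.aestronglyMeasurable (by fun_prop))
    (Continuous.aestronglyMeasurable (by fun_prop)) (by norm_num)).trans ?_
  rw [M, two_mul, hj]
  exact add_le_add le_rfl (eLpNorm_sampleMean_le hP k)

/-- The factor x̄ - E X_1 carries the rate n^{-1/2} in L_4. The other factors, at most three, are in
L_12, so their product is in L_4, and Hölder gives L_2. With three of them, twelve moments are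
exactly what this argument uses. -/
theorem eLpNorm_swap_term_le (hP : MemLp id 12 P) {r : ℕ} (hr : r ≤ 4) (κ : Fin r → Fin d)
    (j : Fin n) (a : Fin r) :
    eLpNorm (fun x : Sample n d => (sampleMean x (κ a) - mean P (κ a)) *
        (∏ b with b < a, ((x j (κ b) - mean P (κ b)) - (sampleMean x (κ b) - mean P (κ b)))) *
        ∏ b with a < b, (x j (κ b) - mean P (κ b))) 2 (Measure.pi fun _ => P) ≤
      2 * (n : ℝ≥0∞) ^ (-(1 / 2) : ℝ) * ∏ b, M P (κ b) := by
  set R : Fin r → Sample n d → ℝ≥0∞ := fun b x =>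
    if b < a then ‖x j (κ b) - sampleMean x (κ b)‖ₑ else ‖x j (κ b) - mean P (κ b)‖ₑ with hR
  have hRm : ∀ b, AEMeasurable (R b) (Measure.pi fun _ : Fin n => P) := by
    intro b
    refine Continuous.aemeasurable ?_
    simp only [hR]
    split_ifs <;> fun_prop
  have hRb : ∀ b, eLpNorm (R b) 12 (Measure.pi fun _ => P) ≤ M P (κ b) := by
    intro b
    simp only [hR]
    split_ifs
    · rw [eLpNorm_enorm]; exact eLpNorm_sub_sampleMean_le hP j (κ b)
    · rw [eLpNorm_enorm]
      refine le_of_eq_of_le ?_ (eLpNorm_coord_sub_mean_le hP (κ b))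
      exact eLpNorm_eval (φ := fun v : Fin d → ℝ => v (κ b) - mean P (κ b))
        (Continuous.aestronglyMeasurable (by fun_prop)) 12 j
  have he : ∀ x : Sample n d, ‖(sampleMean x (κ a) - mean P (κ a)) *
        (∏ b with b < a, ((x j (κ b) - mean P (κ b)) - (sampleMean x (κ b) - mean P (κ b)))) *
        ∏ b with a < b, (x j (κ b) - mean P (κ b))‖ₑ =
      ‖sampleMean x (κ a) - mean P (κ a)‖ₑ * ∏ b ∈ Finset.univ.erase a, R b x := by
    intro x
    simp only [enorm_mul, enorm_finset_prod, sub_sub_sub_cancel_right, hR, mul_assoc, Finset.prod_ite]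
    congr 2
    · refine Finset.prod_congr ?_ fun _ _ => rfl
      ext b
      simp only [Finset.mem_filter, Finset.mem_univ, true_and, Finset.mem_erase, and_true]
      exact ⟨fun h => ⟨h.ne, h⟩, fun h => h.2⟩
    · refine Finset.prod_congr ?_ fun _ _ => rfl
      ext b
      simp only [Finset.mem_filter, Finset.mem_univ, true_and, Finset.mem_erase, and_true, not_lt]
      exact ⟨fun h => ⟨h.ne', h.le⟩, fun h => lt_of_le_of_ne h.2 (Ne.symm h.1)⟩
  rw [← eLpNorm_enorm]
  simp only [he]
  refine (eLpNorm_mul_le_four (Continuous.aemeasurable (by fun_prop))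
    (Finset.aemeasurable_fun_prod _ fun b _ => hRm b)).trans ?_
  rw [eLpNorm_enorm, ← Finset.mul_prod_erase _ _ (Finset.mem_univ a), ← mul_assoc]
  refine mul_le_mul' (eLpNorm_sampleMean_sub_mean_le hP (κ a)) ?_
  refine (eLpNorm_prod_le (Finset.univ.erase a) (fun b _ => hRm b) (p := 4) (N := 12)
    (by norm_num) ?_).trans (Finset.prod_le_prod' fun b _ => hRb b)
  rw [Finset.card_erase_of_mem (Finset.mem_univ a), Finset.card_univ, Fintype.card_fin]
  omega

/-- The moments of order at most four of the bootstrap distribution are close to those of the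
population, at the rate `n^{-1/2}`. -/
theorem eLpNorm_momentGap_le (hP : MemLp id 12 P) {r : ℕ} (hr : r ≤ 4) (κ : Fin r → Fin d) :
    eLpNorm (fun x : Sample n d => momentGap (shifted P x) (empirical x) (sampleMean x) κ) 2
      (Measure.pi fun _ => P) ≤ 12 * (n : ℝ≥0∞) ^ (-(1 / 2) : ℝ) * ∏ a, M P (κ a) := by
  have hn : (n : ℝ) ≠ 0 := by exact_mod_cast NeZero.ne n
  have hn' : (n : ℝ≥0∞) ≠ 0 := by exact_mod_cast NeZero.ne n
  set ρ := (n : ℝ≥0∞) ^ (-(1 / 2) : ℝ) with hρ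
  set W : (Fin d → ℝ) → ℝ := fun v => monomial (mean P) κ v - ∫ w, monomial (mean P) κ w ∂P with hW
  set T : Fin n → Fin r → Sample n d → ℝ := fun j a x =>
    (sampleMean x (κ a) - mean P (κ a)) *
        (∏ b with b < a, ((x j (κ b) - mean P (κ b)) - (sampleMean x (κ b) - mean P (κ b)))) *
        ∏ b with a < b, (x j (κ b) - mean P (κ b)) with hT
  have hmono : MemLp (monomial (mean P) κ) 2 P := memLp_two_monomial hP hr κ
  have hWm : Measurable W := ((continuous_monomial _ _).measurable).sub_const _
  have hW2 : MemLp W 2 P := hmono.sub (memLp_const _)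
  have hW0 : ∫ v, W v ∂P = 0 := by
    rw [hW, integral_sub (hmono.integrable one_le_two) (integrable_const _)]
    simp
  -- Two sources of error: the fluctuation of the empirical moment about E X_1, and the change of
  -- center from E X_1 to x̄. The latter is a telescoping product that changes one factor at a time
  -- (`Finset.prod_sub_ordered`).
  have hdec : (fun x : Sample n d => momentGap (shifted P x) (empirical x) (sampleMean x) κ) =
      (fun x : Sample n d => -average W x) + (n : ℝ)⁻¹ • ∑ j, ∑ a, T j a := by
    ext x
    rw [momentGap, integral_shifted_monomial, integral_empirical]
    have h1 : ∀ j, monomial (sampleMean x) κ (x j) =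
        monomial (mean P) κ (x j) - ∑ a, T j a x := by
      intro j
      have := Finset.prod_sub_ordered (Finset.univ : Finset (Fin r))
        (fun a => x j (κ a) - mean P (κ a)) (fun a => sampleMean x (κ a) - mean P (κ a))
      simp only [hT]
      rw [monomial, monomial, ← this]
      simp
    simp only [average, h1, Finset.sum_sub_distrib, hW, Pi.add_apply, Pi.smul_apply,
      Finset.sum_apply, smul_eq_mul, Finset.sum_const, Finset.card_univ, Fintype.card_fin,
      nsmul_eq_mul]
    field_simp
    ring
  have hTm : ∀ j a, AEStronglyMeasurable (T j a) (Measure.pi fun _ : Fin n => P) := by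
    intro j a
    refine Continuous.aestronglyMeasurable ?_
    simp only [hT]
    fun_prop
  have hWa : AEStronglyMeasurable (fun x : Sample n d => -average W x)
      (Measure.pi fun _ => P) := by
    refine Measurable.aestronglyMeasurable ?_
    unfold average
    fun_prop
  rw [hdec]
  refine (eLpNorm_add_le hWa ((Finset.aestronglyMeasurable_sum _ fun j _ =>
    Finset.aestronglyMeasurable_sum _ fun a _ => hTm j a).const_smul _) (by norm_num)).trans ?_
  -- Here 4 = 2 · 2, from the second-moment bound and from centering the monomial. Below, 8 = 4 · 2,
  -- from at most four changes of factor.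
  have hb1 : eLpNorm (fun x : Sample n d => -average W x) 2 (Measure.pi fun _ => P) ≤
      4 * ρ * ∏ a, M P (κ a) := by
    have : (fun x : Sample n d => -average W x) = -(fun x : Sample n d => average W x) := rfl
    rw [this, eLpNorm_neg]
    refine (eLpNorm_two_average_le hWm hW2 hW0).trans ?_
    calc 2 * ρ * eLpNorm W 2 P ≤ 2 * ρ * (2 * ∏ a, M P (κ a)) := by
          gcongr
          refine (eLpNorm_sub_integral_le hmono.1 (by norm_num)).trans ?_
          gcongr
          exact eLpNorm_two_monomial_le hP hr κ
      _ = 4 * ρ * ∏ a, M P (κ a) := by ring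
  have hb2 : eLpNorm ((n : ℝ)⁻¹ • ∑ j, ∑ a, T j a) 2 (Measure.pi fun _ => P) ≤
      8 * ρ * ∏ a, M P (κ a) := by
    rw [eLpNorm_const_smul, enorm_inv hn, Real.enorm_natCast]
    have h1 : eLpNorm (∑ j, ∑ a, T j a) 2 (Measure.pi fun _ => P) ≤
        n * (8 * ρ * ∏ a, M P (κ a)) := by
      refine (eLpNorm_sum_le (fun j _ => Finset.aestronglyMeasurable_sum _ fun a _ => hTm j a)
        (by norm_num)).trans ?_
      refine (Finset.sum_le_card_nsmul _ _ (8 * ρ * ∏ a, M P (κ a)) fun j _ => ?_).trans_eq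
        (by simp)
      refine (eLpNorm_sum_le (fun a _ => hTm j a) (by norm_num)).trans ?_
      refine (Finset.sum_le_card_nsmul _ _ (2 * ρ * ∏ a, M P (κ a)) fun a _ =>
        eLpNorm_swap_term_le hP hr κ j a).trans ?_
      rw [Finset.card_univ, Fintype.card_fin, nsmul_eq_mul]
      calc (r : ℝ≥0∞) * (2 * ρ * ∏ a, M P (κ a)) ≤ (4 : ℕ) * (2 * ρ * ∏ a, M P (κ a)) := by
            gcongr
        _ = 8 * ρ * ∏ a, M P (κ a) := by push_cast; ring
    refine (mul_le_mul_right h1 _).trans_eq ?_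
    rw [← mul_assoc, ENNReal.inv_mul_cancel hn' (by simp), one_mul]
  refine (add_le_add hb1 hb2).trans_eq ?_
  ring

end Gap

/-! ### The joint law of a bootstrap row -/

section Law

variable {n d : ℕ}

/-- The uniform distribution on the indices. -/
def uniformIndex (n : ℕ) : Measure (Fin n) := (n : ℝ≥0∞)⁻¹ • ∑ i, Measure.dirac i

theorem map_uniformIndex (x : Sample n d) : (uniformIndex n).map x = empirical x := by
  rw [uniformIndex, empirical, Measure.map_smul,
    Measure.map_finset_sum (measurable_of_countable x).aemeasurable]
  simp [Measure.map_dirac' (measurable_of_countable x)]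

instance [NeZero n] : IsProbabilityMeasure (uniformIndex n) := by
  refine ⟨?_⟩
  have h : (n : ℝ≥0∞) ≠ 0 := by exact_mod_cast NeZero.ne n
  simp [uniformIndex, ENNReal.inv_mul_cancel h]

/-- A bootstrap sample is `x` read at i.i.d. uniform indices. The index space is finite and
independent of `x`, which gives measurability of the kernel in `x` and integrability of every
measurable function of the sample. -/
theorem pi_empirical_eq_map [NeZero n] (x : Sample n d) :
    (Measure.pi fun _ : Fin n => empirical x) =
      (Measure.pi fun _ : Fin n => uniformIndex n).map fun σ j => x (σ j) := by
  have := Measure.pi_map_pi (μ := fun _ : Fin n => uniformIndex n) (f := fun _ => x)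
    (fun _ => (measurable_of_countable x).aemeasurable)
  rw [this]
  simp [map_uniformIndex]

theorem measurable_resample :
    Measurable fun p : Sample n d × (Fin n → Fin n) => (fun j => p.1 (p.2 j) : Sample n d) := by
  refine measurable_from_prod_countable_left fun σ => ?_
  refine measurable_pi_iff.2 fun j => measurable_pi_apply (σ j)

/-- The conditional law of the bootstrap sample given the observations. -/
def bootKernel (n d : ℕ) [NeZero n] : Kernel (Sample n d) (Sample n d) where
  toFun x := Measure.pi fun _ => empirical x
  measurable' := by
    refine Measure.measurable_of_measurable_coe _ fun s hs => ?_
    have h1 : ∀ x : Sample n d, (Measure.pi fun _ : Fin n => empirical x) s =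
        (Measure.pi fun _ : Fin n => uniformIndex n) (Prod.mk x ⁻¹'
          ((fun p : Sample n d × (Fin n → Fin n) => (fun j => p.1 (p.2 j) : Sample n d)) ⁻¹' s)) := by
      intro x
      rw [pi_empirical_eq_map, Measure.map_apply (measurable_of_countable _) hs]
      rfl
    simp only [h1]
    exact measurable_measure_prodMk_left (measurable_resample hs)

theorem bootKernel_apply [NeZero n] (x : Sample n d) :
    bootKernel n d x = Measure.pi fun _ => empirical x := rfl

instance [NeZero n] : IsMarkovKernel (bootKernel n d) :=
  ⟨fun x => by rw [bootKernel_apply]; infer_instance⟩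

variable {Ω : Type*} [MeasurableSpace Ω] {Q : Measure Ω} [IsProbabilityMeasure Q]
  {P : Measure (Fin d → ℝ)} {X Y Z : Ω → Sample n d}

theorem IsBootstrapRow.measurable (h : IsBootstrapRow Q P X Y Z) :
    Measurable fun ω => (X ω, Y ω, Z ω) :=
  h.measurable_X.prodMk (h.measurable_Y.prodMk h.measurable_Z)

variable [NeZero n] [IsProbabilityMeasure P]

/-- The conditional law of the copy and of the bootstrap sample given the observations. -/
def pairLaw (P : Measure (Fin d → ℝ)) (x : Sample n d) : Measure (Sample n d × Sample n d) :=
  (Measure.pi fun _ => P).prod (Measure.pi fun _ => empirical x)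

instance (x : Sample n d) : IsProbabilityMeasure (pairLaw P x) := by
  unfold pairLaw; infer_instance

/-- The kernel with values `pairLaw P x`. -/
def pairKernel (n d : ℕ) [NeZero n] (P : Measure (Fin d → ℝ)) [IsProbabilityMeasure P] :
    Kernel (Sample n d) (Sample n d × Sample n d) :=
  Kernel.const _ (Measure.pi fun _ => P) ×ₖ bootKernel n d

theorem pairKernel_apply (x : Sample n d) : pairKernel n d P x = pairLaw P x := by
  rw [pairKernel, Kernel.prod_apply, Kernel.const_apply, bootKernel_apply, pairLaw]

instance : IsMarkovKernel (pairKernel n d P) := by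
  unfold pairKernel; infer_instance

/-- The conditional law of `Z` given both `X` and `Y` ignores `Y`, so given `X` the copy and the
bootstrap sample are independent. -/
theorem IsBootstrapRow.lintegral_eq (h : IsBootstrapRow Q P X Y Z)
    {φ : Sample n d × Sample n d × Sample n d → ℝ≥0∞} (hφ : Measurable φ) :
    ∫⁻ ω, φ (X ω, Y ω, Z ω) ∂Q = ∫⁻ x, ∫⁻ p, φ (x, p) ∂(pairLaw P x) ∂(Measure.pi fun _ => P) := by
  have hXY : Measurable fun ω => (X ω, Y ω) := h.measurable_X.prodMk h.measurable_Y
  have h1 : Q.map (fun ω => (X ω, Y ω)) = (Measure.pi fun _ => P).prod (Measure.pi fun _ => P) := by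
    rw [(indepFun_iff_map_prod_eq_prod_map_map h.measurable_X.aemeasurable
      h.measurable_Y.aemeasurable).1 h.indep, h.law_X, h.law_Y]
  have h2 : Q.map (fun ω => ((X ω, Y ω), Z ω)) =
      ((Measure.pi fun _ => P).prod (Measure.pi fun _ => P)) ⊗ₘ
        Kernel.prodMkRight (Sample n d) (bootKernel n d) := by
    rw [← compProd_map_condDistrib h.measurable_Z.aemeasurable]
    have h3 := h.bootstrap
    rw [h1] at h3 ⊢
    exact Measure.compProd_congr h3
  have hψ : Measurable fun q : (Sample n d × Sample n d) × Sample n d => φ (q.1.1, q.1.2, q.2) :=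
    hφ.comp (by fun_prop)
  have h3 : ∫⁻ ω, φ (X ω, Y ω, Z ω) ∂Q =
      ∫⁻ q, φ (q.1.1, q.1.2, q.2) ∂(Q.map fun ω => ((X ω, Y ω), Z ω)) :=
    (lintegral_map hψ (hXY.prodMk h.measurable_Z)).symm
  rw [h3, h2, Measure.lintegral_compProd hψ, lintegral_prod]
  · refine lintegral_congr fun x => ?_
    rw [pairLaw, lintegral_prod]
    · rfl
    · exact (hφ.comp measurable_prodMk_left).aemeasurable
  · exact (Measurable.lintegral_kernel_prod_right' hψ).aemeasurable

/-- Conditional distributions are almost surely unique, and the explicit kernel reproduces the joint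
law with `X`. -/
theorem IsBootstrapRow.condDistrib_ae_eq (h : IsBootstrapRow Q P X Y Z)
    {G : Sample n d × Sample n d × Sample n d → ℝ} (hG : Measurable G) :
    ∀ᵐ ω ∂Q, condDistrib (fun ω => G (X ω, Y ω, Z ω)) X Q (X ω) =
      (pairLaw P (X ω)).map fun p => G (X ω, p) := by
  set κ : Kernel (Sample n d) ℝ := (Kernel.id ×ₖ pairKernel n d P).map G with hκ
  have hκx : ∀ x, κ x = (pairLaw P x).map fun p => G (x, p) := by
    intro x
    rw [hκ, Kernel.map_apply _ hG, Kernel.prod_apply, Kernel.id_apply, pairKernel_apply,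
      Measure.dirac_prod, Measure.map_map hG measurable_prodMk_left]
    rfl
  have hGm : Measurable fun ω => G (X ω, Y ω, Z ω) := hG.comp h.measurable
  have : IsMarkovKernel κ := Kernel.IsMarkovKernel.map _ hG
  have key : condDistrib (fun ω => G (X ω, Y ω, Z ω)) X Q =ᵐ[Q.map X] κ := by
    refine condDistrib_ae_eq_of_measure_eq_compProd X hGm.aemeasurable ?_
    refine Measure.ext_of_lintegral _ fun ψ hψ => ?_
    rw [lintegral_map hψ (h.measurable_X.prodMk hGm), Measure.lintegral_compProd hψ, h.law_X,
      h.lintegral_eq (φ := fun q => ψ (q.1, G q)) (hψ.comp (measurable_fst.prodMk hG))]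
    refine lintegral_congr fun x => ?_
    have hGx : Measurable fun p => G (x, p) := hG.comp measurable_prodMk_left
    have hψx : Measurable fun t => ψ (x, t) := hψ.comp measurable_prodMk_left
    rw [hκx, lintegral_map hψx hGx]
  filter_upwards [ae_of_ae_map h.measurable_X.aemeasurable key] with ω hω
  rw [hω, hκx]

end Law

/-! ### Measurability of the error terms -/

section Measurability

variable {α : Type*} [MeasurableSpace α] {d : ℕ}

theorem measurable_momentTerm {A B : α → Measure (Fin d → ℝ)} {m : α → Fin d → ℝ}
    {b : α → Fin d → ℝ} {c : α → Fin d → Fin d → ℝ}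
    (hg : ∀ (r : ℕ) (κ : Fin r → Fin d), Measurable fun q => momentGap (A q) (B q) (m q) κ)
    (hb : ∀ k, Measurable fun q => b q k) (hc : ∀ k l, Measurable fun q => c q k l) :
    Measurable fun q => momentTerm (A q) (B q) (m q) (b q) (c q) := by
  have h2 := fun k l => hg 2 ![k, l]
  have h3 := fun k l p => hg 3 ![k, l, p]
  have h4 := fun k l p q => hg 4 ![k, l, p, q]
  unfold momentTerm
  refine Measurable.add ?_ (Measurable.add (Measurable.add ?_ ?_) ?_)
  · exact Finset.measurable_fun_sum _ fun k _ => Finset.measurable_fun_sum _ fun l _ =>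
      (hc k l).enorm.mul (h2 k l).enorm
  · exact Finset.measurable_fun_sum _ fun k _ => Finset.measurable_fun_sum _ fun l _ =>
      ((hb k).enorm.mul (hb l).enorm).mul (h2 k l).enorm
  · exact Finset.measurable_fun_sum _ fun k _ => Finset.measurable_fun_sum _ fun l _ =>
      Finset.measurable_fun_sum _ fun p _ =>
        ((hb k).enorm.mul (hc l p).enorm).mul (h3 k l p).enorm
  · exact Finset.measurable_fun_sum _ fun k _ => Finset.measurable_fun_sum _ fun l _ =>
      Finset.measurable_fun_sum _ fun p _ => Finset.measurable_fun_sum _ fun q _ =>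
        ((hc k l).enorm.mul (hc p q).enorm).mul (h4 k l p q).enorm

theorem measurable_remainderTerm {b η : α → Fin d → ℝ} {c : α → Fin d → Fin d → ℝ}
    {e : α → Fin d → Fin d → Fin d → ℝ≥0∞} (hb : ∀ k, Measurable fun q => b q k)
    (hc : ∀ k l, Measurable fun q => c q k l) (he : ∀ k l p, Measurable fun q => e q k l p)
    (hη : ∀ k, Measurable fun q => η q k) :
    Measurable fun q => remainderTerm (b q) (c q) (e q) (η q) := by
  unfold remainderTerm cubicTerm
  refine Measurable.add (Measurable.add (Measurable.pow_const ?_ 3) (Measurable.pow_const ?_ 3)) ?_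
  · exact Finset.measurable_fun_sum _ fun k _ => (hb k).enorm.mul (hη k).enorm
  · exact Finset.measurable_fun_sum _ fun k _ => Finset.measurable_fun_sum _ fun l _ =>
      ((hc k l).enorm.mul (hη k).enorm).mul (hη l).enorm
  · exact Finset.measurable_fun_sum _ fun k _ => Finset.measurable_fun_sum _ fun l _ =>
      Finset.measurable_fun_sum _ fun p _ =>
        (((he k l p).mul (hη k).enorm).mul (hη l).enorm).mul (hη p).enorm

variable {n : ℕ} {P : Measure (Fin d → ℝ)} {f : Sample n d → ℝ}

@[fun_prop]
theorem continuous_Ytilde :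
    Continuous fun q : Sample n d × Sample n d × Sample n d => Ytilde P q.1 q.2.1 := by
  unfold Ytilde translate
  fun_prop

theorem continuous_recentered_hybrid (i : Fin n)
    {v : Sample n d × Sample n d × Sample n d → Fin d → ℝ} (hv : Continuous v) :
    Continuous fun q : Sample n d × Sample n d × Sample n d =>
      translate (hybrid (Ytilde P q.1 q.2.1) q.2.2 i (v q)) (mean P - sampleMean q.1) := by
  have h1 : Continuous fun q : Sample n d × Sample n d × Sample n d =>
      hybrid (Ytilde P q.1 q.2.1) q.2.2 i (v q) :=
    (continuous_hybrid i).comp (by fun_prop : Continuous fun q : Sample n d × Sample n d × Sample n d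
      => (Ytilde P q.1 q.2.1, q.2.2, v q))
  exact continuous_translate.comp (h1.prodMk (by fun_prop))

theorem measurable_momentGap [NeZero n] {r : ℕ} (κ : Fin r → Fin d) :
    Measurable fun x : Sample n d =>
      momentGap (shifted P x) (empirical x) (sampleMean x) κ := by
  simp only [momentGap, integral_shifted_monomial, integral_empirical]
  simp only [average, monomial]
  exact Continuous.measurable (by fun_prop)

/-- The function `f(· + E X_1 - x̄)`. -/
def recentered (P : Measure (Fin d → ℝ)) (f : Sample n d → ℝ) (x v : Sample n d) : ℝ :=
  f (translate v (mean P - sampleMean x))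

theorem contDiff_recentered (hf : ContDiff ℝ 3 f) (x : Sample n d) :
    ContDiff ℝ 3 (recentered P f x) := by
  refine hf.comp ?_
  unfold translate
  fun_prop

theorem continuous_jet1 (hf : ContDiff ℝ 3 f) (i : Fin n) (k : Fin d) :
    Continuous fun q : Sample n d × Sample n d × Sample n d => jet1 (recentered P f q.1) i
      (hybrid (Ytilde P q.1 q.2.1) q.2.2 i (sampleMean q.1)) k := by
  unfold jet1 recentered
  simp only [pderiv_translate]
  have h1 : Continuous (pderiv i k f) :=
    (ContDiff.pderiv (N := 2) (by exact_mod_cast hf) i k).continuous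
  exact h1.comp (continuous_recentered_hybrid i (by fun_prop))

theorem continuous_jet2 (hf : ContDiff ℝ 3 f) (i : Fin n) (k l : Fin d) :
    Continuous fun q : Sample n d × Sample n d × Sample n d => jet2 (recentered P f q.1) i
      (hybrid (Ytilde P q.1 q.2.1) q.2.2 i (sampleMean q.1)) k l := by
  unfold jet2 recentered
  simp only [pderiv_translate]
  have h1 := ContDiff.pderiv (N := 2) (by exact_mod_cast hf) i l
  have h2 := ContDiff.pderiv (N := 1) (by exact_mod_cast h1) i k
  exact h2.continuous.comp (continuous_recentered_hybrid i (by fun_prop))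

/-- The supremum is uncountable, but once the moving segments are parametrized by [0, 1] it is a
supremum of continuous functions, hence lower semicontinuous. -/
theorem measurable_jet3Sup (hf : ContDiff ℝ 3 f) (i : Fin n) (k l p : Fin d) :
    Measurable fun q : Sample n d × Sample n d × Sample n d => jet3Sup (recentered P f q.1) i
      (sampleMean q.1) (Ytilde P q.1 q.2.1) q.2.2 k l p := by
  unfold jet3Sup recentered
  simp only [pderiv_translate, iSup_union, segment_eq_image', iSup_image]
  have h1 := ContDiff.pderiv (N := 2) (by exact_mod_cast hf) i p
  have h2 := ContDiff.pderiv (N := 1) (by exact_mod_cast h1) i l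
  have h3 := ContDiff.pderiv (N := 0) (by exact_mod_cast h2) i k
  refine Measurable.sup ?_ ?_ <;>
  refine (lowerSemicontinuous_biSup fun t _ => Continuous.lowerSemicontinuous ?_).measurable
  · exact (h3.continuous.comp (continuous_recentered_hybrid i (by fun_prop))).enorm
  · exact (h3.continuous.comp (continuous_recentered_hybrid i (by fun_prop))).enorm

/-- The Lindeberg term given the sample `x`. -/
def rowTerm (P : Measure (Fin d → ℝ)) (f : Sample n d → ℝ) (i : Fin n)
    (q : Sample n d × Sample n d × Sample n d) : ℝ≥0∞ :=
  lindebergTerm (shifted P q.1) (empirical q.1) (sampleMean q.1) (recentered P f q.1) i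
    (Ytilde P q.1 q.2.1) q.2.2

theorem measurable_rowTerm [NeZero n] (hf : ContDiff ℝ 3 f) (i : Fin n) :
    Measurable (rowTerm P f i) := by
  unfold rowTerm lindebergTerm
  have hb := fun k => (continuous_jet1 (P := P) hf i k).measurable
  have hc := fun k l => (continuous_jet2 (P := P) hf i k l).measurable
  have he := measurable_jet3Sup (P := P) hf i
  refine Measurable.add (measurable_momentTerm (fun r κ => ?_) hb hc)
    (Measurable.add (measurable_remainderTerm hb hc he fun k => ?_)
      (measurable_remainderTerm hb hc he fun k => ?_))
  · exact (measurable_momentGap κ).comp measurable_fst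
  · exact Continuous.measurable (by simp only [Pi.sub_apply]; fun_prop)
  · exact Continuous.measurable (by simp only [Pi.sub_apply]; fun_prop)

end Measurability

/-! ### Expectations of the error terms -/

section Expectation

variable {Ω : Type*} [MeasurableSpace Ω] {Q : Measure Ω} [IsProbabilityMeasure Q] {d : ℕ}

theorem lintegral_mul_mul_le {f₁ f₂ g : Ω → ℝ≥0∞} (h₁ : AEMeasurable f₁ Q) (h₂ : AEMeasurable f₂ Q)
    (hg : AEMeasurable g Q) :
    ∫⁻ ω, f₁ ω * f₂ ω * g ω ∂Q ≤ eLpNorm f₁ 12 Q * eLpNorm f₂ 12 Q * eLpNorm g 2 Q := by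
  refine (lintegral_mul_le_eLpNorm_two (h₁.mul h₂) hg).trans ?_
  gcongr
  refine (eLpNorm_mul_le_four h₁ h₂).trans ?_
  gcongr
  · exact eLpNorm_le_eLpNorm_of_exponent_le (by norm_num) h₁.aestronglyMeasurable
  · exact eLpNorm_le_eLpNorm_of_exponent_le (by norm_num) h₂.aestronglyMeasurable

/-- The cubes of sums are read as cubes of L_3 norms, so that Minkowski's inequality comes first and
Hölder's is applied to single products. -/
theorem lintegral_remainderTerm_le {b η : Ω → Fin d → ℝ} {c : Ω → Fin d → Fin d → ℝ}
    {e : Ω → Fin d → Fin d → Fin d → ℝ≥0∞} (hb : ∀ k, Measurable fun q => b q k)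
    (hc : ∀ k l, Measurable fun q => c q k l) (he : ∀ k l p, Measurable fun q => e q k l p)
    (hη : ∀ k, Measurable fun q => η q k) {m : Fin d → ℝ≥0∞}
    (hm : ∀ k, eLpNorm (fun ω => η ω k) 12 Q ≤ m k) :
    ∫⁻ ω, remainderTerm (b ω) (c ω) (e ω) (η ω) ∂Q ≤
      (∑ k, m k * eLpNorm (fun ω => b ω k) 12 Q) ^ 3 +
      (∑ k, ∑ l, m k * m l * eLpNorm (fun ω => c ω k l) 12 Q) ^ 3 +
      ∑ k, ∑ l, ∑ p, m k * m l * m p * eLpNorm (fun ω => e ω k l p) 12 Q := by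
  have hb' := fun k => (hb k).enorm
  have hc' := fun k l => (hc k l).enorm
  have hη' := fun k => (hη k).enorm
  unfold remainderTerm cubicTerm
  have cube : ∀ {T : Ω → ℝ≥0∞}, ∫⁻ ω, T ω ^ 3 ∂Q = eLpNorm T 3 Q ^ 3 := fun {T} => by
    have := eLpNorm_nat_pow (Q := Q) T (p := 3) (by norm_num)
    simpa using this.symm
  have mbT := fun k => (hb' k).fun_mul (hη' k)
  have mcT := fun k l => ((hc' k l).fun_mul (hη' k)).fun_mul (hη' l)
  have meT := fun k l p => (((he k l p).fun_mul (hη' k)).fun_mul (hη' l)).fun_mul (hη' p)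
  rw [lintegral_add_left, lintegral_add_left]
  rotate_left
  · exact (Finset.measurable_fun_sum _ fun k _ => mbT k).pow_const 3
  · exact ((Finset.measurable_fun_sum _ fun k _ => mbT k).pow_const 3).add
      ((Finset.measurable_fun_sum _ fun k _ => Finset.measurable_fun_sum _ fun l _ =>
        mcT k l).pow_const 3)
  refine add_le_add (add_le_add ?_ ?_) ?_
  · rw [cube]
    gcongr
    have h1 : (fun ω => ∑ k, ‖b ω k‖ₑ * ‖η ω k‖ₑ) = ∑ k, fun ω => ‖b ω k‖ₑ * ‖η ω k‖ₑ := by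
      ext ω; simp
    rw [h1]
    refine (eLpNorm_sum_le (fun k _ => (mbT k).aestronglyMeasurable) (by norm_num)).trans
      (Finset.sum_le_sum fun k _ => ?_)
    have h2 := eLpNorm_prod_le (Q := Q) (Finset.univ : Finset (Fin 2))
      (f := ![fun ω => ‖b ω k‖ₑ, fun ω => ‖η ω k‖ₑ])
      (fun i _ => by fin_cases i; exacts [(hb' k).aemeasurable, (hη' k).aemeasurable])
      (p := 3) (N := 12) (by norm_num) (by simp)
    simp only [Fin.prod_univ_two, Matrix.cons_val_zero, Matrix.cons_val_one,
      Nat.cast_ofNat, eLpNorm_enorm] at h2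
    refine h2.trans ?_
    rw [mul_comm]
    gcongr
    exact hm k
  · rw [cube]
    gcongr
    have h1 : (fun ω => ∑ k, ∑ l, ‖c ω k l‖ₑ * ‖η ω k‖ₑ * ‖η ω l‖ₑ)
        = ∑ k, ∑ l, fun ω => ‖c ω k l‖ₑ * ‖η ω k‖ₑ * ‖η ω l‖ₑ := by
      ext ω; simp
    rw [h1]
    refine (eLpNorm_sum_le (fun k _ => Finset.aestronglyMeasurable_sum _ fun l _ =>
      (mcT k l).aestronglyMeasurable) (by norm_num)).trans (Finset.sum_le_sum fun k _ => ?_)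
    refine (eLpNorm_sum_le (fun l _ => (mcT k l).aestronglyMeasurable) (by norm_num)).trans
      (Finset.sum_le_sum fun l _ => ?_)
    have h2 := eLpNorm_prod_le (Q := Q) (Finset.univ : Finset (Fin 3))
      (f := ![fun ω => ‖c ω k l‖ₑ, fun ω => ‖η ω k‖ₑ, fun ω => ‖η ω l‖ₑ])
      (fun i _ => by
        fin_cases i
        exacts [(hc' k l).aemeasurable, (hη' k).aemeasurable, (hη' l).aemeasurable])
      (p := 3) (N := 12) (by norm_num) (by simp)
    simp only [Fin.prod_univ_three, Matrix.cons_val_zero, Matrix.cons_val_one, Matrix.cons_val,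
      Nat.cast_ofNat, eLpNorm_enorm] at h2
    refine h2.trans ?_
    rw [mul_assoc, mul_comm]
    gcongr
    · exact hm k
    · exact hm l
  · rw [lintegral_finsetSum _ fun k _ => Finset.measurable_fun_sum _ fun l _ =>
      Finset.measurable_fun_sum _ fun p _ => meT k l p]
    refine Finset.sum_le_sum fun k _ => ?_
    rw [lintegral_finsetSum _ fun l _ => Finset.measurable_fun_sum _ fun p _ => meT k l p]
    refine Finset.sum_le_sum fun l _ => ?_
    rw [lintegral_finsetSum _ fun p _ => meT k l p]
    refine Finset.sum_le_sum fun p _ => ?_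
    have h2 := lintegral_prod_pow_le (Q := Q) (Finset.univ : Finset (Fin 4))
      (f := ![fun ω => e ω k l p, fun ω => ‖η ω k‖ₑ, fun ω => ‖η ω l‖ₑ, fun ω => ‖η ω p‖ₑ])
      (fun i _ => by
        fin_cases i
        exacts [(he k l p).aemeasurable, (hη' k).aemeasurable, (hη' l).aemeasurable,
          (hη' p).aemeasurable])
      (p := 1) (N := 12) (by norm_num) (by simp)
    simp only [Fin.prod_univ_four, Matrix.cons_val_zero, Matrix.cons_val_one, Matrix.cons_val,
      Nat.cast_ofNat, eLpNorm_enorm, pow_one] at h2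
    refine h2.trans ?_
    calc _ ≤ eLpNorm (fun ω => e ω k l p) 12 Q * m k * m l * m p := by
          gcongr
          exacts [hm k, hm l, hm p]
      _ = _ := by ring

/-- Coefficients and moment gaps both depend on the sample, so no independence is available between
them. Hölder's inequality puts the coefficients in L_12 and the gap in L_2, where its rate is known.
-/
theorem lintegral_momentTerm_le {A B : Ω → Measure (Fin d → ℝ)} {μ : Ω → Fin d → ℝ}
    {b : Ω → Fin d → ℝ} {c : Ω → Fin d → Fin d → ℝ}
    (hg : ∀ (r : ℕ) (κ : Fin r → Fin d), Measurable fun q => momentGap (A q) (B q) (μ q) κ)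
    (hb : ∀ k, Measurable fun q => b q k) (hc : ∀ k l, Measurable fun q => c q k l)
    {m : Fin d → ℝ≥0∞} {τ : ℝ≥0∞} (hτ : ∀ (r : ℕ) (κ : Fin r → Fin d), r ≤ 4 →
      eLpNorm (fun ω => momentGap (A ω) (B ω) (μ ω) κ) 2 Q ≤ τ * ∏ a, m (κ a)) :
    ∫⁻ ω, momentTerm (A ω) (B ω) (μ ω) (b ω) (c ω) ∂Q ≤
      τ * ((∑ k, ∑ l, m k * m l * eLpNorm (fun ω => c ω k l) 12 Q) +
        ((∑ k, m k * eLpNorm (fun ω => b ω k) 12 Q) +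
          ∑ k, ∑ l, m k * m l * eLpNorm (fun ω => c ω k l) 12 Q) ^ 2) := by
  have hb' := fun k => (hb k).enorm
  have hc' := fun k l => (hc k l).enorm
  have h2 := fun k l => (hg 2 ![k, l]).enorm
  have h3 := fun k l p => (hg 3 ![k, l, p]).enorm
  have h4 := fun k l p q => (hg 4 ![k, l, p, q]).enorm
  set β := fun k => eLpNorm (fun ω => b ω k) 12 Q with hβ
  set γ := fun k l => eLpNorm (fun ω => c ω k l) 12 Q with hγ
  set Sβ := ∑ k, m k * β k with hSβ
  set Sγ := ∑ k, ∑ l, m k * m l * γ k l with hSγ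
  have t2 : ∀ k l, eLpNorm (fun ω => ‖momentGap (A ω) (B ω) (μ ω) ![k, l]‖ₑ) 2 Q ≤
      τ * (m k * m l) := fun k l => by
    rw [eLpNorm_enorm]
    exact (hτ 2 ![k, l] (by norm_num)).trans_eq (by simp [Fin.prod_univ_succ])
  have t3 : ∀ k l p, eLpNorm (fun ω => ‖momentGap (A ω) (B ω) (μ ω) ![k, l, p]‖ₑ) 2 Q ≤
      τ * (m k * (m l * m p)) := fun k l p => by
    rw [eLpNorm_enorm]
    exact (hτ 3 ![k, l, p] (by norm_num)).trans_eq (by simp [Fin.prod_univ_succ])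
  have t4 : ∀ k l p q, eLpNorm (fun ω => ‖momentGap (A ω) (B ω) (μ ω) ![k, l, p, q]‖ₑ) 2 Q ≤
      τ * (m k * (m l * (m p * m q))) := fun k l p q => by
    rw [eLpNorm_enorm]
    exact (hτ 4 ![k, l, p, q] (by norm_num)).trans_eq (by simp [Fin.prod_univ_succ])
  have hone : ∀ {f : Ω → ℝ≥0∞}, AEMeasurable f Q → eLpNorm f 2 Q ≤ eLpNorm f 12 Q := fun hf =>
    eLpNorm_le_eLpNorm_of_exponent_le (by norm_num) hf.aestronglyMeasurable
  have m1 := fun k l => (hc' k l).fun_mul (h2 k l)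
  have m2 := fun k l => ((hb' k).fun_mul (hb' l)).fun_mul (h2 k l)
  have m3 := fun k l p => ((hb' k).fun_mul (hc' l p)).fun_mul (h3 k l p)
  have m4 := fun k l p q => ((hc' k l).fun_mul (hc' p q)).fun_mul (h4 k l p q)
  have b1 : ∀ k l, ∫⁻ ω, ‖c ω k l‖ₑ * ‖momentGap (A ω) (B ω) (μ ω) ![k, l]‖ₑ ∂Q ≤
      τ * (m k * m l * γ k l) := fun k l => by
    refine (lintegral_mul_le_eLpNorm_two (hc' k l).aemeasurable (h2 k l).aemeasurable).trans ?_
    calc _ ≤ γ k l * (τ * (m k * m l)) :=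
          mul_le_mul' ((hone (hc' k l).aemeasurable).trans_eq (eLpNorm_enorm _)) (t2 k l)
      _ = _ := by ring
  have b2 : ∀ k l, ∫⁻ ω, ‖b ω k‖ₑ * ‖b ω l‖ₑ * ‖momentGap (A ω) (B ω) (μ ω) ![k, l]‖ₑ ∂Q ≤
      τ * ((m k * β k) * (m l * β l)) := fun k l => by
    refine (lintegral_mul_mul_le (hb' k).aemeasurable (hb' l).aemeasurable
      (h2 k l).aemeasurable).trans ?_
    rw [eLpNorm_enorm, eLpNorm_enorm]
    calc _ ≤ β k * β l * (τ * (m k * m l)) := mul_le_mul' le_rfl (t2 k l)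
      _ = _ := by ring
  have b3 : ∀ k l p,
      ∫⁻ ω, ‖b ω k‖ₑ * ‖c ω l p‖ₑ * ‖momentGap (A ω) (B ω) (μ ω) ![k, l, p]‖ₑ ∂Q ≤
      τ * ((m k * β k) * (m l * m p * γ l p)) := fun k l p => by
    refine (lintegral_mul_mul_le (hb' k).aemeasurable (hc' l p).aemeasurable
      (h3 k l p).aemeasurable).trans ?_
    rw [eLpNorm_enorm, eLpNorm_enorm]
    calc _ ≤ β k * γ l p * (τ * (m k * (m l * m p))) := mul_le_mul' le_rfl (t3 k l p)
      _ = _ := by ring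
  have b4 : ∀ k l p q,
      ∫⁻ ω, ‖c ω k l‖ₑ * ‖c ω p q‖ₑ * ‖momentGap (A ω) (B ω) (μ ω) ![k, l, p, q]‖ₑ ∂Q ≤
      τ * ((m k * m l * γ k l) * (m p * m q * γ p q)) := fun k l p q => by
    refine (lintegral_mul_mul_le (hc' k l).aemeasurable (hc' p q).aemeasurable
      (h4 k l p q).aemeasurable).trans ?_
    rw [eLpNorm_enorm, eLpNorm_enorm]
    calc _ ≤ γ k l * γ p q * (τ * (m k * (m l * (m p * m q)))) := mul_le_mul' le_rfl (t4 k l p q)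
      _ = _ := by ring
  have s1 := fun k => Finset.measurable_fun_sum Finset.univ fun l _ => m1 k l
  have s2 := fun k => Finset.measurable_fun_sum Finset.univ fun l _ => m2 k l
  have s3' := fun k l => Finset.measurable_fun_sum Finset.univ fun p _ => m3 k l p
  have s3 := fun k => Finset.measurable_fun_sum Finset.univ fun l _ => s3' k l
  have s4'' := fun k l p => Finset.measurable_fun_sum Finset.univ fun q _ => m4 k l p q
  have s4' := fun k l => Finset.measurable_fun_sum Finset.univ fun p _ => s4'' k l p
  have s4 := fun k => Finset.measurable_fun_sum Finset.univ fun l _ => s4' k l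
  have a1 := Finset.measurable_fun_sum Finset.univ fun k _ => s1 k
  have a2 := Finset.measurable_fun_sum Finset.univ fun k _ => s2 k
  have a3 := Finset.measurable_fun_sum Finset.univ fun k _ => s3 k
  unfold momentTerm
  rw [lintegral_add_left a1, lintegral_add_left (a2.fun_add a3), lintegral_add_left a2]
  have c1 : ∫⁻ ω, ∑ k, ∑ l, ‖c ω k l‖ₑ * ‖momentGap (A ω) (B ω) (μ ω) ![k, l]‖ₑ ∂Q ≤ τ * Sγ := by
    rw [lintegral_finsetSum _ fun k _ => s1 k, hSγ, Finset.mul_sum]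
    refine Finset.sum_le_sum fun k _ => ?_
    rw [lintegral_finsetSum _ fun l _ => m1 k l, Finset.mul_sum]
    exact Finset.sum_le_sum fun l _ => b1 k l
  have c2 : ∫⁻ ω, ∑ k, ∑ l, ‖b ω k‖ₑ * ‖b ω l‖ₑ * ‖momentGap (A ω) (B ω) (μ ω) ![k, l]‖ₑ ∂Q ≤
      τ * (Sβ * Sβ) := by
    rw [lintegral_finsetSum _ fun k _ => s2 k, hSβ, Finset.sum_mul_sum, Finset.mul_sum]
    refine Finset.sum_le_sum fun k _ => ?_
    rw [lintegral_finsetSum _ fun l _ => m2 k l, Finset.mul_sum]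
    exact Finset.sum_le_sum fun l _ => b2 k l
  have c3 : ∫⁻ ω, ∑ k, ∑ l, ∑ p,
      ‖b ω k‖ₑ * ‖c ω l p‖ₑ * ‖momentGap (A ω) (B ω) (μ ω) ![k, l, p]‖ₑ ∂Q ≤ τ * (Sβ * Sγ) := by
    rw [lintegral_finsetSum _ fun k _ => s3 k, hSβ, Finset.sum_mul, Finset.mul_sum]
    refine Finset.sum_le_sum fun k _ => ?_
    rw [lintegral_finsetSum _ fun l _ => s3' k l, hSγ, Finset.mul_sum, Finset.mul_sum]
    refine Finset.sum_le_sum fun l _ => ?_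
    rw [lintegral_finsetSum _ fun p _ => m3 k l p, Finset.mul_sum, Finset.mul_sum]
    exact Finset.sum_le_sum fun p _ => b3 k l p
  have c4 : ∫⁻ ω, ∑ k, ∑ l, ∑ p, ∑ q,
      ‖c ω k l‖ₑ * ‖c ω p q‖ₑ * ‖momentGap (A ω) (B ω) (μ ω) ![k, l, p, q]‖ₑ ∂Q ≤
      τ * (Sγ * Sγ) := by
    rw [lintegral_finsetSum _ fun k _ => s4 k]
    conv_rhs => rw [hSγ, Finset.sum_mul, Finset.mul_sum]
    refine Finset.sum_le_sum fun k _ => ?_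
    rw [lintegral_finsetSum _ fun l _ => s4' k l, Finset.sum_mul, Finset.mul_sum]
    refine Finset.sum_le_sum fun l _ => ?_
    rw [lintegral_finsetSum _ fun p _ => s4'' k l p, Finset.mul_sum, Finset.mul_sum]
    refine Finset.sum_le_sum fun p _ => ?_
    rw [lintegral_finsetSum _ fun q _ => m4 k l p q, Finset.mul_sum, Finset.mul_sum]
    exact Finset.sum_le_sum fun q _ => b4 k l p q
  refine (add_le_add c1 (add_le_add (add_le_add c2 c3) c4)).trans ?_
  -- A second copy of the cross term completes the square.
  calc τ * Sγ + (τ * (Sβ * Sβ) + τ * (Sβ * Sγ) + τ * (Sγ * Sγ))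
      ≤ τ * Sγ + (τ * (Sβ * Sβ) + τ * (Sβ * Sγ) + τ * (Sγ * Sγ)) + τ * (Sβ * Sγ) := le_self_add
    _ = τ * (Sγ + (Sβ + Sγ) ^ 2) := by ring

end Expectation

/-! ### The bound for one row -/

section Row

variable {n d : ℕ} {P : Measure (Fin d → ℝ)} {f g : Sample n d → ℝ}

theorem Ytilde_translate (x y : Sample n d) :
    Ytilde P x (translate y (mean P - sampleMean x)) = y := by
  ext j k
  simp only [Ytilde, translate, Pi.add_apply, Pi.sub_apply]
  ring

theorem recentered_Ytilde (x y : Sample n d) : recentered P f x (Ytilde P x y) = f y := by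
  unfold recentered
  congr 1
  ext j k
  simp only [Ytilde, translate, Pi.add_apply, Pi.sub_apply]
  ring

/-- The integrand of the bound on `d_F(g(Z̃), g(Y) ∣ X = x)`. -/
def rowIntegrand (P : Measure (Fin d → ℝ)) (f g : Sample n d → ℝ)
    (q : Sample n d × Sample n d × Sample n d) : ℝ≥0∞ :=
  ‖g q.2.1 - f q.2.1‖ₑ + ‖g (Ztilde P q.1 q.2.2) - f (Ztilde P q.1 q.2.2)‖ₑ + ∑ i, rowTerm P f i q

@[fun_prop]
theorem continuous_Ztilde :
    Continuous fun q : Sample n d × Sample n d × Sample n d => Ztilde P q.1 q.2.2 := by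
  unfold Ztilde translate
  fun_prop

theorem measurable_approx_fst (hg : Measurable g) (hf : ContDiff ℝ 3 f) :
    Measurable fun q : Sample n d × Sample n d × Sample n d => ‖g q.2.1 - f q.2.1‖ₑ :=
  ((hg.sub hf.continuous.measurable).comp measurable_snd.fst).enorm

theorem measurable_approx_snd (hg : Measurable g) (hf : ContDiff ℝ 3 f) :
    Measurable fun q : Sample n d × Sample n d × Sample n d =>
      ‖g (Ztilde P q.1 q.2.2) - f (Ztilde P q.1 q.2.2)‖ₑ :=
  ((hg.sub hf.continuous.measurable).comp continuous_Ztilde.measurable).enorm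

theorem measurable_Ytilde (x : Sample n d) : Measurable (Ytilde P x) := by
  refine Continuous.measurable ?_
  unfold Ytilde translate
  fun_prop

variable {Ω : Type*} [MeasurableSpace Ω] {Q : Measure Ω} [IsProbabilityMeasure Q]
  {X Y Z : Ω → Sample n d}

theorem IsBootstrapRow.measurePreserving_X (h : IsBootstrapRow Q P X Y Z) :
    MeasurePreserving X Q (Measure.pi fun _ => P) := ⟨h.measurable_X, h.law_X⟩

theorem IsBootstrapRow.measurePreserving_Y (h : IsBootstrapRow Q P X Y Z) :
    MeasurePreserving Y Q (Measure.pi fun _ => P) := ⟨h.measurable_Y, h.law_Y⟩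

theorem pi_shifted_eq_map [IsProbabilityMeasure P] (x : Sample n d) :
    (Measure.pi fun _ : Fin n => shifted P x) = (Measure.pi fun _ : Fin n => P).map (Ytilde P x) :=
  (Measure.pi_map_pi (μ := fun _ : Fin n => P)
    (f := fun _ v => v + (sampleMean x - mean P)) (fun _ => by fun_prop)
    (hμ := fun _ => inferInstanceAs (SigmaFinite (shifted P x)))).symm

variable [NeZero n]

theorem measurable_rowIntegrand (hg : Measurable g) (hf : ContDiff ℝ 3 f) :
    Measurable (rowIntegrand P f g) :=
  ((measurable_approx_fst hg hf).add (measurable_approx_snd hg hf)).add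
    (Finset.measurable_fun_sum _ fun i _ => measurable_rowTerm hf i)

variable [IsProbabilityMeasure P]

theorem lintegral_rowTerm_eq (hf : ContDiff ℝ 3 f) (x : Sample n d) (i : Fin n) :
    (Measurable fun p : Sample n d × Sample n d =>
      lindebergTerm (shifted P x) (empirical x) (sampleMean x) (recentered P f x) i p.1 p.2) ∧
    ∫⁻ p : Sample n d × Sample n d,
      lindebergTerm (shifted P x) (empirical x) (sampleMean x) (recentered P f x) i p.1 p.2
        ∂((Measure.pi fun _ => shifted P x).prod (Measure.pi fun _ => empirical x)) =
      ∫⁻ p, rowTerm P f i (x, p) ∂(pairLaw P x) := by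
  have hm : Measurable fun p : Sample n d × Sample n d =>
      lindebergTerm (shifted P x) (empirical x) (sampleMean x) (recentered P f x) i p.1 p.2 := by
    have h1 : Measurable fun p : Sample n d × Sample n d =>
        (x, translate p.1 (mean P - sampleMean x), p.2) := by
      refine Continuous.measurable ?_
      unfold translate
      fun_prop
    have h2 := (measurable_rowTerm (P := P) hf i).comp h1
    simpa only [rowTerm, Function.comp_def, Ytilde_translate] using h2
  refine ⟨hm, ?_⟩
  have h3 : (Measure.pi fun _ : Fin n => shifted P x).prod (Measure.pi fun _ => empirical x) =
      (pairLaw P x).map (Prod.map (Ytilde P x) id) := by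
    rw [pairLaw, ← Measure.map_prod_map _ _ (measurable_Ytilde x) measurable_id,
      ← pi_shifted_eq_map, Measure.map_id]
  rw [h3, lintegral_map hm ((measurable_Ytilde x).prodMap measurable_id)]
  rfl

theorem integrable_pi_empirical (x : Sample n d) {φ : Sample n d → ℝ} (hφ : Measurable φ) :
    Integrable φ (Measure.pi fun _ => empirical x) := by
  rw [pi_empirical_eq_map, integrable_map_measure hφ.aestronglyMeasurable
    (measurable_of_countable _).aemeasurable]
  exact Integrable.of_finite

/-- Passing from `g` to `f` costs the L_1 errors because test functions are 1-Lipschitz; the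
comparison of f(Y) with f(Z̃) is the Lindeberg bound for `recentered P f x`. A finite right-hand
side also forces integrability of g(Y) and g(Z̃), which excludes the value ⊤ in `dF`; an infinite
one leaves nothing to prove. -/
theorem dF_pairLaw_le (hP : MemLp id 12 P) (hg : Measurable g) (hf : ContDiff ℝ 3 f)
    (x : Sample n d) :
    dF ((pairLaw P x).map fun p => g (Ztilde P x p.2)) ((pairLaw P x).map fun p => g p.1) ≤
      ∫⁻ p, rowIntegrand P f g (x, p) ∂(pairLaw P x) := by
  have hZ : Measurable fun p : Sample n d × Sample n d => Ztilde P x p.2 :=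
    (continuous_Ztilde (P := P)).measurable.comp
      (measurable_prodMk_left (x := x) : Measurable fun p : Sample n d × Sample n d => (x, p))
  have hx : Measurable fun p : Sample n d × Sample n d => (x, p) := measurable_prodMk_left
  have m1 : Measurable fun p : Sample n d × Sample n d => ‖g p.1 - f p.1‖ₑ :=
    (measurable_approx_fst hg hf).comp hx
  have m2 : Measurable fun p : Sample n d × Sample n d =>
      ‖g (Ztilde P x p.2) - f (Ztilde P x p.2)‖ₑ := (measurable_approx_snd hg hf).comp hx
  have m3 : ∀ i, Measurable fun p => rowTerm P f i (x, p) := fun i =>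
    (measurable_rowTerm hf i).comp hx
  have hsplit : ∫⁻ p, rowIntegrand P f g (x, p) ∂(pairLaw P x) =
      ∫⁻ p, ‖g p.1 - f p.1‖ₑ ∂(pairLaw P x) +
      ∫⁻ p, ‖g (Ztilde P x p.2) - f (Ztilde P x p.2)‖ₑ ∂(pairLaw P x) +
      ∑ i, ∫⁻ p, rowTerm P f i (x, p) ∂(pairLaw P x) := by
    unfold rowIntegrand
    rw [lintegral_add_left (m1.fun_add m2), lintegral_add_left m1,
      lintegral_finsetSum _ fun i _ => m3 i]
  by_cases htop : ∫⁻ p, rowIntegrand P f g (x, p) ∂(pairLaw P x) = ⊤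
  · rw [htop]; exact le_top
  rw [hsplit] at htop ⊢
  obtain ⟨h12, h3⟩ := ENNReal.add_ne_top.1 htop
  obtain ⟨h1, h2⟩ := ENNReal.add_ne_top.1 h12
  have hfm := hf.continuous.measurable
  have i1 : Integrable (fun p : Sample n d × Sample n d => g p.1 - f p.1) (pairLaw P x) :=
    ⟨((hg.comp measurable_fst).sub (hfm.comp measurable_fst)).aestronglyMeasurable, h1.lt_top⟩
  have i2 : Integrable (fun p : Sample n d × Sample n d =>
      g (Ztilde P x p.2) - f (Ztilde P x p.2)) (pairLaw P x) :=
    ⟨((hg.comp hZ).sub (hfm.comp hZ)).aestronglyMeasurable, h2.lt_top⟩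
  have hFm : Measurable (recentered P f x) := (contDiff_recentered hf x).continuous.measurable
  have hFB := integrable_pi_empirical x hFm
  have hsum := Finset.sum_congr rfl fun i (_ : i ∈ Finset.univ) =>
    (lintegral_rowTerm_eq (P := P) hf x i).2
  obtain ⟨hFA, hbound⟩ := lindeberg_bound (A := shifted P x) (B := empirical x)
    (m := sampleMean x) (contDiff_recentered (P := P) hf x)
    (fun r κ hr => integrable_shifted_monomial hP x hr κ) (fun r κ _ => integrable_empirical x _)
    (momentGap_one hP x) (fun i => (lintegral_rowTerm_eq hf x i).1) hFB (by rw [hsum]; exact h3)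
  rw [hsum] at hbound
  rw [pi_shifted_eq_map, integrable_map_measure hFm.aestronglyMeasurable
    (measurable_Ytilde x).aemeasurable] at hFA
  have hfY : Integrable f (Measure.pi fun _ => P) :=
    hFA.congr (Eventually.of_forall fun y => recentered_Ytilde x y)
  have j1 : Integrable (fun p : Sample n d × Sample n d => f p.1) (pairLaw P x) := hfY.comp_fst _
  have j2 : Integrable (fun p : Sample n d × Sample n d => f (Ztilde P x p.2)) (pairLaw P x) :=
    Integrable.comp_snd (f := recentered P f x) hFB _
  have k1 : Integrable (fun p : Sample n d × Sample n d => g p.1) (pairLaw P x) :=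
    (i1.add j1).congr (Eventually.of_forall fun p => by simp)
  have k2 : Integrable (fun p : Sample n d × Sample n d => g (Ztilde P x p.2)) (pairLaw P x) :=
    (i2.add j2).congr (Eventually.of_forall fun p => by simp)
  refine iSup₂_le fun h hh => ?_
  have hhm := hh.1.continuous.measurable
  have hgZ : Measurable fun p : Sample n d × Sample n d => g (Ztilde P x p.2) := hg.comp hZ
  have hgY : Measurable fun p : Sample n d × Sample n d => g p.1 := hg.comp measurable_fst
  rw [if_pos ⟨(integrable_map_measure hhm.aestronglyMeasurable hgZ.aemeasurable).2
      (integrable_comp_of_mem_testClass hh k2),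
    (integrable_map_measure hhm.aestronglyMeasurable hgY.aemeasurable).2
      (integrable_comp_of_mem_testClass hh k1)⟩,
    integral_map hgZ.aemeasurable hhm.aestronglyMeasurable,
    integral_map hgY.aemeasurable hhm.aestronglyMeasurable]
  have b1 := enorm_integral_comp_sub_le hh k1 j1
  have b2 := enorm_integral_comp_sub_le hh k2 j2
  have b3 := hbound h hh
  have e1 : ∫ y, h (recentered P f x y) ∂(Measure.pi fun _ => shifted P x) =
      ∫ p, h (f p.1) ∂(pairLaw P x) := by
    have hhF : Measurable fun y => h (recentered P f x y) := hhm.comp hFm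
    rw [pi_shifted_eq_map, integral_map (measurable_Ytilde x).aemeasurable
      hhF.aestronglyMeasurable, pairLaw, integral_fun_fst (fun y => h (f y))]
    simp [recentered_Ytilde]
  have e2 : ∫ z, h (recentered P f x z) ∂(Measure.pi fun _ => empirical x) =
      ∫ p, h (f (Ztilde P x p.2)) ∂(pairLaw P x) := by
    rw [pairLaw, integral_fun_snd (fun z => h (f (Ztilde P x z)))]
    simp [recentered, Ztilde]
  rw [e1, e2] at b3
  set a1 := ∫ p, h (g p.1) ∂(pairLaw P x)
  set a2 := ∫ p, h (g (Ztilde P x p.2)) ∂(pairLaw P x)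
  set c1 := ∫ p, h (f p.1) ∂(pairLaw P x)
  set c2 := ∫ p, h (f (Ztilde P x p.2)) ∂(pairLaw P x)
  have hdec : a2 - a1 = -(a1 - c1) + (a2 - c2) + -(c1 - c2) := by ring
  refine (Real.ofReal_le_enorm _).trans ?_
  rw [hdec]
  refine (enorm_add_le _ _).trans (add_le_add ((enorm_add_le _ _).trans (add_le_add ?_ b2)) ?_)
  · rwa [enorm_neg]
  · rwa [enorm_neg]

/-- The empirical distribution averages to `P` over the sample, so twelfth moments of bootstrap
observations are those of `P`. -/
theorem IsBootstrapRow.eLpNorm_Z (h : IsBootstrapRow Q P X Y Z) (i : Fin n) (k : Fin d) :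
    eLpNorm (fun ω => Z ω i k) 12 Q = eLpNorm (fun v : Fin d → ℝ => v k) 12 P := by
  have hn : (n : ℝ≥0∞) ≠ 0 := by exact_mod_cast NeZero.ne n
  have h1 := eLpNorm_nat_pow (Q := Q) (fun ω => Z ω i k) (p := 12) (by norm_num)
  have h2 := eLpNorm_nat_pow (Q := P) (fun v : Fin d → ℝ => v k) (p := 12) (by norm_num)
  have hc : Measurable fun v : Fin d → ℝ => ‖v k‖ₑ ^ 12 := by fun_prop
  have h3 : ∫⁻ ω, ‖Z ω i k‖ₑ ^ 12 ∂Q = ∫⁻ v, ‖v k‖ₑ ^ 12 ∂P := by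
    rw [h.lintegral_eq (φ := fun q => ‖q.2.2 i k‖ₑ ^ 12) (by fun_prop)]
    have h4 : ∀ x : Sample n d, ∫⁻ p, ‖p.2 i k‖ₑ ^ 12 ∂(pairLaw P x) =
        (n : ℝ≥0∞)⁻¹ * ∑ j, ‖x j k‖ₑ ^ 12 := by
      intro x
      have h5 : Measurable fun z : Sample n d => ‖z i k‖ₑ ^ 12 := by fun_prop
      have h6 : Measurable fun p : Sample n d × Sample n d => ‖p.2 i k‖ₑ ^ 12 :=
        h5.comp measurable_snd
      rw [pairLaw, lintegral_prod _ h6.aemeasurable]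
      simp only [lintegral_const, measure_univ, mul_one]
      have h7 := (measurePreserving_eval (fun _ : Fin n => empirical x) i).lintegral_comp hc
      refine (h7 : ∫⁻ z : Sample n d, ‖z i k‖ₑ ^ 12 ∂_ = _).trans ?_
      rw [empirical, lintegral_smul_measure, lintegral_finsetSum_measure]
      simp [lintegral_dirac' _ hc]
    simp only [h4]
    rw [lintegral_const_mul _ (by fun_prop), lintegral_finsetSum _ fun j _ => by fun_prop]
    have h7 : ∀ j : Fin n, ∫⁻ x : Sample n d, ‖x j k‖ₑ ^ 12 ∂(Measure.pi fun _ => P) =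
        ∫⁻ v, ‖v k‖ₑ ^ 12 ∂P := fun j =>
      (measurePreserving_eval (fun _ : Fin n => P) j).lintegral_comp hc
    simp only [h7, Finset.sum_const, Finset.card_univ, Fintype.card_fin, nsmul_eq_mul]
    rw [← mul_assoc, ENNReal.inv_mul_cancel hn (by simp), one_mul]
  rw [h3, ← h2] at h1
  exact le_antisymm ((ENNReal.pow_le_pow_left_iff (by norm_num)).1 h1.le)
    ((ENNReal.pow_le_pow_left_iff (by norm_num)).1 h1.ge)

end Row

/-! ### Expectation of the bound over a row -/

section Row

variable {n d : ℕ} {P : Measure (Fin d → ℝ)} {f g : Sample n d → ℝ} [IsProbabilityMeasure P]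
  [NeZero n] {Ω : Type*} [MeasurableSpace Ω] {Q : Measure Ω} [IsProbabilityMeasure Q]
  {X Y Z : Ω → Sample n d}

/-- The displacements Ỹ_i - X̄ = Y_i - E X_1 and Z_i - X̄ both have coordinates with L_12 norm at
most `M P k`, and the suprema in `D1`, `D2`, `D3` make the bound uniform in the slot. -/
theorem IsBootstrapRow.lintegral_rowTerm_le (h : IsBootstrapRow Q P X Y Z) (hP : MemLp id 12 P)
    (hf : ContDiff ℝ 3 f) (i : Fin n) :
    ∫⁻ ω, rowTerm P f i (X ω, Y ω, Z ω) ∂Q ≤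
      12 * (n : ℝ≥0∞) ^ (-(1 / 2) : ℝ) *
        ((∑ k, ∑ l, D2 Q P X Y Z (recenter P X f) k l) +
          ((∑ k, D1 Q P X Y Z (recenter P X f) k) +
            ∑ k, ∑ l, D2 Q P X Y Z (recenter P X f) k l) ^ 2) +
      2 * ((∑ k, D1 Q P X Y Z (recenter P X f) k) ^ 3 +
        (∑ k, ∑ l, D2 Q P X Y Z (recenter P X f) k l) ^ 3 +
        ∑ k, ∑ l, ∑ p, D3 Q P X Y Z (recenter P X f) k l p) := by
  obtain ⟨b, hb⟩ : ∃ b : Ω → Fin d → ℝ, ∀ ω, b ω = jet1 (recentered P f (X ω)) i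
    (hybrid (Ytilde P (X ω) (Y ω)) (Z ω) i (sampleMean (X ω))) := ⟨_, fun _ => rfl⟩
  obtain ⟨c, hc⟩ : ∃ c : Ω → Fin d → Fin d → ℝ, ∀ ω, c ω = jet2 (recentered P f (X ω)) i
    (hybrid (Ytilde P (X ω) (Y ω)) (Z ω) i (sampleMean (X ω))) := ⟨_, fun _ => rfl⟩
  obtain ⟨e, he⟩ : ∃ e : Ω → Fin d → Fin d → Fin d → ℝ≥0∞, ∀ ω, e ω =
    jet3Sup (recentered P f (X ω)) i (sampleMean (X ω)) (Ytilde P (X ω) (Y ω)) (Z ω) :=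
    ⟨_, fun _ => rfl⟩
  have mb : ∀ k, Measurable fun ω => b ω k := fun k => by
    simpa only [hb, Function.comp_def] using
      (continuous_jet1 (P := P) hf i k).measurable.comp h.measurable
  have mc : ∀ k l, Measurable fun ω => c ω k l := fun k l => by
    simpa only [hc, Function.comp_def] using
      (continuous_jet2 (P := P) hf i k l).measurable.comp h.measurable
  have me : ∀ k l p, Measurable fun ω => e ω k l p := fun k l p => by
    simpa only [he, Function.comp_def] using
      (measurable_jet3Sup (P := P) hf i k l p).comp h.measurable
  have mY : ∀ k, Measurable fun ω => (Ytilde P (X ω) (Y ω) i - sampleMean (X ω)) k := fun k =>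
    (Continuous.measurable (by simp only [Pi.sub_apply]; fun_prop) :
      Measurable fun q : Sample n d × Sample n d × Sample n d =>
        (Ytilde P q.1 q.2.1 i - sampleMean q.1) k).comp h.measurable
  have mZ : ∀ k, Measurable fun ω => (Z ω i - sampleMean (X ω)) k := fun k =>
    (Continuous.measurable (by simp only [Pi.sub_apply]; fun_prop) :
      Measurable fun q : Sample n d × Sample n d × Sample n d =>
        (q.2.2 i - sampleMean q.1) k).comp h.measurable
  have nY : ∀ k, eLpNorm (fun ω => (Ytilde P (X ω) (Y ω) i - sampleMean (X ω)) k) 12 Q ≤ M P k := by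
    intro k
    have h1 : (fun ω => (Ytilde P (X ω) (Y ω) i - sampleMean (X ω)) k) =
        (fun y : Sample n d => y i k - mean P k) ∘ Y := by
      ext ω
      simp only [Ytilde, translate, Pi.sub_apply, Pi.add_apply, Function.comp_apply]
      ring
    rw [h1, eLpNorm_comp_measurePreserving (Continuous.aestronglyMeasurable (by fun_prop))
      h.measurePreserving_Y]
    refine le_of_eq_of_le ?_ (eLpNorm_coord_sub_mean_le hP k)
    exact eLpNorm_eval (φ := fun v : Fin d → ℝ => v k - mean P k)
      (Continuous.aestronglyMeasurable (by fun_prop)) 12 i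
  have nZ : ∀ k, eLpNorm (fun ω => (Z ω i - sampleMean (X ω)) k) 12 Q ≤ M P k := by
    intro k
    have h2 : eLpNorm (fun ω => sampleMean (X ω) k) 12 Q ≤
        eLpNorm (fun v : Fin d → ℝ => v k) 12 P := by
      refine le_of_eq_of_le ?_ (eLpNorm_sampleMean_le (n := n) hP k)
      exact eLpNorm_comp_measurePreserving (g := fun x : Sample n d => sampleMean x k)
        (Continuous.aestronglyMeasurable (by fun_prop)) h.measurePreserving_X
    have hZk : Measurable fun ω => Z ω i k :=
      (measurable_pi_apply k).comp ((measurable_pi_apply i).comp h.measurable_Z)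
    have hXk : Measurable fun ω => sampleMean (X ω) k :=
      (Continuous.measurable (by fun_prop) : Measurable fun x : Sample n d =>
        sampleMean x k).comp h.measurable_X
    refine (eLpNorm_sub_le hZk.aestronglyMeasurable hXk.aestronglyMeasurable (by norm_num)).trans ?_
    rw [M, two_mul, h.eLpNorm_Z]
    exact add_le_add le_rfl h2
  have hgm : ∀ (r : ℕ) (κ : Fin r → Fin d), Measurable fun ω =>
      momentGap (shifted P (X ω)) (empirical (X ω)) (sampleMean (X ω)) κ := fun r κ =>
    (measurable_momentGap κ).comp h.measurable_X
  have hgap : ∀ (r : ℕ) (κ : Fin r → Fin d), r ≤ 4 → eLpNorm (fun ω =>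
      momentGap (shifted P (X ω)) (empirical (X ω)) (sampleMean (X ω)) κ) 2 Q ≤
        12 * (n : ℝ≥0∞) ^ (-(1 / 2) : ℝ) * ∏ a, M P (κ a) := by
    intro r κ hr
    refine le_of_eq_of_le ?_ (eLpNorm_momentGap_le (n := n) hP hr κ)
    exact eLpNorm_comp_measurePreserving (g := fun x : Sample n d =>
      momentGap (shifted P x) (empirical x) (sampleMean x) κ)
      (measurable_momentGap κ).aestronglyMeasurable h.measurePreserving_X
  have hS1 : ∑ k, M P k * eLpNorm (fun ω => b ω k) 12 Q ≤
      ∑ k, D1 Q P X Y Z (recenter P X f) k := by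
    simp only [hb]
    refine Finset.sum_le_sum fun k _ => mul_le_mul_right ?_ _
    exact le_iSup (fun i : Fin n => eLpNorm (fun ω => pderiv i k (recenter P X f ω)
      (path P (X ω) (Y ω) (Z ω) i (sampleMean (X ω)))) 12 Q) i
  have hS2 : ∑ k, ∑ l, M P k * M P l * eLpNorm (fun ω => c ω k l) 12 Q ≤
      ∑ k, ∑ l, D2 Q P X Y Z (recenter P X f) k l := by
    simp only [hc]
    refine Finset.sum_le_sum fun k _ => Finset.sum_le_sum fun l _ => mul_le_mul_right ?_ _
    exact le_iSup (fun i : Fin n => eLpNorm (fun ω => pderiv i k (pderiv i l (recenter P X f ω))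
      (path P (X ω) (Y ω) (Z ω) i (sampleMean (X ω)))) 12 Q) i
  have hS3 : ∑ k, ∑ l, ∑ p, M P k * M P l * M P p * eLpNorm (fun ω => e ω k l p) 12 Q ≤
      ∑ k, ∑ l, ∑ p, D3 Q P X Y Z (recenter P X f) k l p := by
    simp only [he]
    refine Finset.sum_le_sum fun k _ => Finset.sum_le_sum fun l _ => Finset.sum_le_sum fun p _ =>
      mul_le_mul_right ?_ _
    exact le_iSup (fun i : Fin n => eLpNorm (fun ω =>
      ⨆ v ∈ segment ℝ (sampleMean (X ω)) (Ytilde P (X ω) (Y ω) i) ∪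
        segment ℝ (sampleMean (X ω)) (Z ω i),
      ‖pderiv i k (pderiv i l (pderiv i p (recenter P X f ω)))
        (path P (X ω) (Y ω) (Z ω) i v)‖ₑ) 12 Q) i
  have hmom := lintegral_momentTerm_le hgm mb mc hgap
  have hremY := lintegral_remainderTerm_le mb mc me mY nY
  have hremZ := lintegral_remainderTerm_le mb mc me mZ nZ
  have hsplit : ∫⁻ ω, rowTerm P f i (X ω, Y ω, Z ω) ∂Q =
      ∫⁻ ω, momentTerm (shifted P (X ω)) (empirical (X ω)) (sampleMean (X ω)) (b ω) (c ω) ∂Q +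
      (∫⁻ ω, remainderTerm (b ω) (c ω) (e ω) (Ytilde P (X ω) (Y ω) i - sampleMean (X ω)) ∂Q +
      ∫⁻ ω, remainderTerm (b ω) (c ω) (e ω) (Z ω i - sampleMean (X ω)) ∂Q) := by
    rw [← lintegral_add_left (measurable_remainderTerm mb mc me mY),
      ← lintegral_add_left (measurable_momentTerm hgm mb mc)]
    simp only [hb, hc, he]
    rfl
  rw [hsplit]
  refine (add_le_add hmom (add_le_add hremY hremZ)).trans ?_
  rw [← two_mul]
  gcongr

/-- The conditional distance is dominated by a measurable variable with small expectation. -/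
theorem IsBootstrapRow.exists_bootDist_le (h : IsBootstrapRow Q P X Y Z) (hP : MemLp id 12 P)
    (hg : Measurable g) (hf : ContDiff ℝ 3 f) :
    ∃ B : Ω → ℝ≥0∞, Measurable B ∧ (∀ᵐ ω ∂Q, bootDist Q P X Y Z g ω ≤ B ω) ∧
      ∫⁻ ω, B ω ∂Q ≤ approxError Q P X Y Z f g + n * (
        12 * (n : ℝ≥0∞) ^ (-(1 / 2) : ℝ) *
        ((∑ k, ∑ l, D2 Q P X Y Z (recenter P X f) k l) +
          ((∑ k, D1 Q P X Y Z (recenter P X f) k) +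
            ∑ k, ∑ l, D2 Q P X Y Z (recenter P X f) k l) ^ 2) +
        2 * ((∑ k, D1 Q P X Y Z (recenter P X f) k) ^ 3 +
          (∑ k, ∑ l, D2 Q P X Y Z (recenter P X f) k l) ^ 3 +
          ∑ k, ∑ l, ∑ p, D3 Q P X Y Z (recenter P X f) k l p)) := by
  have hψ := measurable_rowIntegrand (P := P) hg hf
  have hBm : Measurable fun x => ∫⁻ p, rowIntegrand P f g (x, p) ∂(pairLaw P x) := by
    simp only [← pairKernel_apply]
    exact Measurable.lintegral_kernel_prod_right' hψ
  refine ⟨fun ω => ∫⁻ p, rowIntegrand P f g (X ω, p) ∂(pairLaw P (X ω)),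
    hBm.comp h.measurable_X, ?_, ?_⟩
  · have hgZ : Measurable fun q : Sample n d × Sample n d × Sample n d =>
        g (Ztilde P q.1 q.2.2) := hg.comp continuous_Ztilde.measurable
    have hgY : Measurable fun q : Sample n d × Sample n d × Sample n d => g q.2.1 :=
      hg.comp measurable_snd.fst
    filter_upwards [h.condDistrib_ae_eq hgZ, h.condDistrib_ae_eq hgY] with ω h1 h2
    rw [bootDist, condDF, h1, h2]
    exact dF_pairLaw_le hP hg hf (X ω)
  · rw [h.measurePreserving_X.lintegral_comp hBm, ← h.lintegral_eq hψ]
    unfold rowIntegrand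
    have m1 := (measurable_approx_fst (n := n) hg hf).comp h.measurable
    have m2 := (measurable_approx_snd (P := P) hg hf).comp h.measurable
    have m3 := fun i => (measurable_rowTerm (P := P) hf i).comp h.measurable
    simp only [Function.comp_def] at m1 m2 m3
    rw [lintegral_add_left (m1.fun_add m2), lintegral_add_left m1,
      lintegral_finsetSum _ fun i _ => m3 i, approxError, eLpNorm_one_eq_lintegral_enorm,
      eLpNorm_one_eq_lintegral_enorm]
    refine add_le_add le_rfl ?_
    refine (Finset.sum_le_card_nsmul _ _ _ fun i _ => h.lintegral_rowTerm_le hP hf i).trans_eq ?_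
    rw [Finset.card_univ, Fintype.card_fin, nsmul_eq_mul]

end Row

/-! ### The bound in terms of `R1`, `R2`, `R3` -/

theorem add_sq_le_four_mul (a b : ℝ≥0∞) : (a + b) ^ 2 ≤ 4 * (a ^ 2 + b ^ 2) := by
  have h1 : a + b ≤ 2 * max a b := by
    rw [two_mul]; exact add_le_add (le_max_left _ _) (le_max_right _ _)
  have h2 : max a b ^ 2 ≤ a ^ 2 + b ^ 2 := by
    rcases le_total a b with h | h
    · rw [max_eq_right h]; exact le_add_self
    · rw [max_eq_left h]; exact le_self_add
  calc (a + b) ^ 2 ≤ (2 * max a b) ^ 2 := by gcongr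
    _ = 4 * max a b ^ 2 := by ring
    _ ≤ _ := by gcongr

/-- With t = n^{1/12} and u = 1/t every power of n involved is an integral power of t or u. What
remains is algebra, inserting or cancelling powers of t u = 1. -/
theorem lindeberg_rate {t u : ℝ≥0∞} (h : t * u = 1) (a b c : ℝ≥0∞) :
    t ^ 12 * (12 * u ^ 6 * (b + (a + b) ^ 2) + 2 * (a ^ 3 + b ^ 3 + c)) ≤
      48 * (u ^ 2 * (t ^ 4 * a) ^ 2) + 2 * (t ^ 4 * a) ^ 3 + 2 * (t ^ 12 * c) +
        12 * (t ^ 6 * b) + 48 * (u ^ 6 * (t ^ 6 * b) ^ 2) + 2 * (u ^ 6 * (t ^ 6 * b) ^ 3) := by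
  calc t ^ 12 * (12 * u ^ 6 * (b + (a + b) ^ 2) + 2 * (a ^ 3 + b ^ 3 + c))
      ≤ t ^ 12 * (12 * u ^ 6 * (b + 4 * (a ^ 2 + b ^ 2)) + 2 * (a ^ 3 + b ^ 3 + c)) := by
        gcongr; exact add_sq_le_four_mul a b
    _ = 48 * ((t * u) ^ 6 * t ^ 6 * a ^ 2) + 2 * (t ^ 4 * a) ^ 3 + 2 * (t ^ 12 * c) +
        12 * ((t * u) ^ 6 * (t ^ 6 * b)) + 48 * (u ^ 6 * (t ^ 6 * b) ^ 2) +
          2 * (t ^ 12 * b ^ 3) := by ring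
    _ = 48 * ((t * u) ^ 2 * t ^ 6 * a ^ 2) + 2 * (t ^ 4 * a) ^ 3 + 2 * (t ^ 12 * c) +
        12 * (t ^ 6 * b) + 48 * (u ^ 6 * (t ^ 6 * b) ^ 2) +
          2 * ((t * u) ^ 6 * t ^ 12 * b ^ 3) := by simp only [h, one_pow, one_mul]
    _ = _ := by ring

theorem natCast_rpow_twelfth (n : ℕ) (m : ℕ) :
    ((n : ℝ≥0∞) ^ (1 / 12 : ℝ)) ^ m = (n : ℝ≥0∞) ^ (m / 12 : ℝ) := by
  rw [← ENNReal.rpow_natCast, ← ENNReal.rpow_mul]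
  congr 1
  ring

theorem natCast_rpow_neg_twelfth (n : ℕ) (m : ℕ) :
    (((n : ℝ≥0∞) ^ (1 / 12 : ℝ))⁻¹) ^ m = (n : ℝ≥0∞) ^ (-(m / 12) : ℝ) := by
  rw [← ENNReal.inv_pow, natCast_rpow_twelfth, ENNReal.rpow_neg]

theorem one_le_natCast_rpow {n : ℕ} [NeZero n] {r : ℝ} (hr : 0 ≤ r) : 1 ≤ (n : ℝ≥0∞) ^ r := by
  have hn : (1 : ℝ≥0∞) ≤ n := by exact_mod_cast NeZero.one_le
  calc (1 : ℝ≥0∞) = 1 ^ r := (ENNReal.one_rpow r).symm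
    _ ≤ _ := ENNReal.rpow_le_rpow hn hr

theorem bound_mono {n d : ℕ} {P : Measure (Fin d → ℝ)} {f g : Sample n d → ℝ} {Ω : Type*}
    [MeasurableSpace Ω] {Q : Measure Ω} {X Y Z : Ω → Sample n d} {K K' : ℝ} (h : K ≤ K') :
    bound Q P X Y Z f g K ≤ bound Q P X Y Z f g K' := by
  unfold bound
  gcongr

section Bound

variable {n d : ℕ} {P : Measure (Fin d → ℝ)} {f g : Sample n d → ℝ} [IsProbabilityMeasure P]
  [NeZero n] {Ω : Type*} [MeasurableSpace Ω] {Q : Measure Ω} [IsProbabilityMeasure Q]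
  {X Y Z : Ω → Sample n d}

/-- The terms n^{-1/2} R_2² and n^{-1/2} R_2³ do not occur in `bound`; `hR` absorbs them into R_2.
The constant 60 covers 48 + 2 for the R_1 terms and 12 + 48 for R_2. -/
theorem IsBootstrapRow.exists_bootDist_le_bound (h : IsBootstrapRow Q P X Y Z)
    (hP : MemLp id 12 P) (hg : Measurable g) (hf : ContDiff ℝ 3 f) {C : ℝ} (hC : 0 ≤ C)
    (hR : (n : ℝ≥0∞) ^ (-(1 / 2) : ℝ) * R2 Q P X Y Z f ^ 2 ≤ ENNReal.ofReal C) :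
    ∃ B : Ω → ℝ≥0∞, Measurable B ∧ (∀ᵐ ω ∂Q, bootDist Q P X Y Z g ω ≤ B ω) ∧
      ∫⁻ ω, B ω ∂Q ≤ bound Q P X Y Z f g (60 * (1 + C)) := by
  obtain ⟨B, hB, hle, hint⟩ := h.exists_bootDist_le hP hg hf
  refine ⟨B, hB, hle, hint.trans ?_⟩
  rw [bound]
  refine add_le_add le_rfl ?_
  have ht1 : 1 ≤ (n : ℝ≥0∞) ^ (1 / 12 : ℝ) := one_le_natCast_rpow (by norm_num)
  have ht2 : (n : ℝ≥0∞) ^ (1 / 12 : ℝ) ≠ ⊤ :=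
    ENNReal.rpow_ne_top_of_nonneg (by norm_num) (by simp)
  have htu := ENNReal.mul_inv_cancel (zero_lt_one.trans_le ht1).ne' ht2
  have e1 : ((n : ℝ≥0∞) ^ (1 / 12 : ℝ)) ^ 4 = (n : ℝ≥0∞) ^ (1 / 3 : ℝ) := by
    rw [natCast_rpow_twelfth]; norm_num
  have e2 : ((n : ℝ≥0∞) ^ (1 / 12 : ℝ)) ^ 6 = (n : ℝ≥0∞) ^ (1 / 2 : ℝ) := by
    rw [natCast_rpow_twelfth]; norm_num
  have e3 : ((n : ℝ≥0∞) ^ (1 / 12 : ℝ)) ^ 12 = n := by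
    rw [natCast_rpow_twelfth]; norm_num
  have e4 : (((n : ℝ≥0∞) ^ (1 / 12 : ℝ))⁻¹) ^ 2 = (n : ℝ≥0∞) ^ (-(1 / 6) : ℝ) := by
    rw [natCast_rpow_neg_twelfth]; norm_num
  have e5 : (((n : ℝ≥0∞) ^ (1 / 12 : ℝ))⁻¹) ^ 6 = (n : ℝ≥0∞) ^ (-(1 / 2) : ℝ) := by
    rw [natCast_rpow_neg_twelfth]; norm_num
  have hu1 : (n : ℝ≥0∞) ^ (-(1 / 2) : ℝ) ≤ 1 := by
    rw [ENNReal.rpow_neg]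
    exact ENNReal.inv_le_one.2 (one_le_natCast_rpow (by norm_num))
  have key := lindeberg_rate htu (∑ k, D1 Q P X Y Z (recenter P X f) k)
    (∑ k, ∑ l, D2 Q P X Y Z (recenter P X f) k l)
    (∑ k, ∑ l, ∑ p, D3 Q P X Y Z (recenter P X f) k l p)
  rw [e1, e2, e3, e4, e5] at key
  change _ ≤ 48 * (_ * R1 Q P X Y Z f ^ 2) + 2 * R1 Q P X Y Z f ^ 3 + 2 * R3 Q P X Y Z f +
    12 * R2 Q P X Y Z f + 48 * (_ * R2 Q P X Y Z f ^ 2) + 2 * (_ * R2 Q P X Y Z f ^ 3) at key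
  refine key.trans ?_
  generalize R1 Q P X Y Z f = r₁, R2 Q P X Y Z f = r₂, R3 Q P X Y Z f = r₃ at hR ⊢
  generalize (n : ℝ≥0∞) ^ (-(1 / 6) : ℝ) = v, (n : ℝ≥0∞) ^ (-(1 / 2) : ℝ) = w at hR hu1 ⊢
  have hK : ENNReal.ofReal (60 * (1 + C)) = 60 * (1 + ENNReal.ofReal C) := by
    rw [ENNReal.ofReal_mul (by norm_num), ENNReal.ofReal_add zero_le_one hC]
    simp
  have i1 : v * r₁ ^ 2 ≤ r₁ ^ 2 * max v r₁ := by
    rw [mul_comm]; gcongr; exact le_max_left _ _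
  have i2 : r₁ ^ 3 ≤ r₁ ^ 2 * max v r₁ := by
    rw [pow_succ]; gcongr; exact le_max_right _ _
  have i3 : w * r₂ ^ 3 ≤ ENNReal.ofReal C * r₂ := by
    rw [pow_succ, ← mul_assoc]; gcongr
  -- For r₂ ≤ 1 the square is at most r₂ and w ≤ 1; for r₂ ≥ 1 the square is at most the cube.
  have i4 : w * r₂ ^ 2 ≤ r₂ + ENNReal.ofReal C * r₂ := by
    rcases le_total r₂ 1 with h1 | h1
    · refine le_add_right ?_
      calc w * r₂ ^ 2 ≤ 1 * (1 * r₂) := by rw [sq]; gcongr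
        _ = r₂ := by ring
    · refine le_add_left (le_trans ?_ i3)
      exact mul_le_mul_right (pow_le_pow_right₀ h1 (by norm_num)) _
  rw [hK]
  calc 48 * (v * r₁ ^ 2) + 2 * r₁ ^ 3 + 2 * r₃ + 12 * r₂ + 48 * (w * r₂ ^ 2) + 2 * (w * r₂ ^ 3)
      ≤ 48 * (r₁ ^ 2 * max v r₁) + 2 * (r₁ ^ 2 * max v r₁) + 2 * r₃ + 12 * r₂ +
        48 * (r₂ + ENNReal.ofReal C * r₂) + 2 * (ENNReal.ofReal C * r₂) := by gcongr
    _ = 50 * (r₁ ^ 2 * max v r₁) + 2 * r₃ + 60 * r₂ + ENNReal.ofReal C * (50 * r₂) := by ring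
    _ ≤ 60 * (r₁ ^ 2 * max v r₁) + 60 * r₃ + 60 * r₂ +
        ENNReal.ofReal C * (60 * (r₁ ^ 2 * max v r₁) + 60 * r₃ + 60 * r₂) := by
      gcongr
      · norm_num
      · norm_num
      · refine le_add_left ?_
        gcongr
        norm_num
    _ = _ := by ring

theorem rpow_neg_half_mul_sq_le_one {r : ℝ≥0∞} (hr : r ≤ (n : ℝ≥0∞) ^ (1 / 4 : ℝ)) :
    (n : ℝ≥0∞) ^ (-(1 / 2) : ℝ) * r ^ 2 ≤ 1 := by
  have hn : (n : ℝ≥0∞) ≠ 0 := by exact_mod_cast NeZero.ne n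
  calc (n : ℝ≥0∞) ^ (-(1 / 2) : ℝ) * r ^ 2
      ≤ (n : ℝ≥0∞) ^ (-(1 / 2) : ℝ) * ((n : ℝ≥0∞) ^ (1 / 4 : ℝ)) ^ 2 := by gcongr
    _ = 1 := by
      rw [← ENNReal.rpow_natCast, ← ENNReal.rpow_mul, ← ENNReal.rpow_add _ _ hn (by simp)]
      norm_num

/-- Without any restriction on `R2`, the bound holds with a constant depending on `R2`. -/
theorem IsBootstrapRow.exists_bootDist_le_bound_R2 (h : IsBootstrapRow Q P X Y Z)
    (hP : MemLp id 12 P) (hg : Measurable g) (hf : ContDiff ℝ 3 f) {K : ℝ}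
    (hK : 60 * (1 + (R2 Q P X Y Z f).toReal ^ 2) ≤ K) :
    ∃ B : Ω → ℝ≥0∞, Measurable B ∧ (∀ᵐ ω ∂Q, bootDist Q P X Y Z g ω ≤ B ω) ∧
      ∫⁻ ω, B ω ∂Q ≤ bound Q P X Y Z f g K := by
  -- As `toReal` sends ⊤ to 0, `hK` says nothing about an infinite `R2`; the bound is then infinite
  -- itself.
  by_cases htop : R2 Q P X Y Z f = ⊤
  · refine ⟨fun _ => ⊤, measurable_const, Eventually.of_forall fun _ => le_top, ?_⟩
    have hK0 : ENNReal.ofReal K ≠ 0 := by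
      have : 0 < K := lt_of_lt_of_le (by positivity) hK
      simpa using this
    simp [bound, htop, ENNReal.mul_top hK0]
  · obtain ⟨B, h1, h2, h3⟩ := h.exists_bootDist_le_bound hP hg hf
      (C := (R2 Q P X Y Z f).toReal ^ 2) (by positivity) (by
        rw [ENNReal.ofReal_pow ENNReal.toReal_nonneg, ENNReal.ofReal_toReal htop]
        refine mul_le_of_le_one_left' ?_
        rw [ENNReal.rpow_neg]
        exact ENNReal.inv_le_one.2 (one_le_natCast_rpow (by norm_num)))
    exact ⟨B, h1, h2, h3.trans (bound_mono hK)⟩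

end Bound

/-! ### Passage to the limit -/

theorem tendsto_natCast_rpow_neg :
    Tendsto (fun n : ℕ => (n : ℝ≥0∞) ^ (-(1 / 6) : ℝ)) atTop (𝓝 0) := by
  have h : Tendsto (fun n : ℕ => ((n : ℝ≥0∞) ^ (1 / 6 : ℝ))⁻¹) atTop (𝓝 ⊤⁻¹) :=
    tendsto_inv_iff.2
      ((ENNReal.tendsto_rpow_at_top (by norm_num)).comp ENNReal.tendsto_nat_nhds_top)
  simpa only [ENNReal.rpow_neg, ENNReal.inv_top] using h

theorem tendsto_rate {r₁ r₂ r₃ a : ℕ → ℝ≥0∞} (ha : Tendsto a atTop (𝓝 0))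
    (h₁ : Tendsto r₁ atTop (𝓝 0)) (h₂ : Tendsto r₂ atTop (𝓝 0)) (h₃ : Tendsto r₃ atTop (𝓝 0))
    (K : ℝ) : Tendsto (fun n : ℕ => a n + ENNReal.ofReal K *
      (r₁ n ^ 2 * max ((n : ℝ≥0∞) ^ (-(1 / 6) : ℝ)) (r₁ n) + r₃ n + r₂ n)) atTop (𝓝 0) := by
  have hm := tendsto_natCast_rpow_neg.max h₁
  have hp := ENNReal.Tendsto.mul (ENNReal.Tendsto.pow (n := 2) h₁) (Or.inr (by simp)) hm
    (Or.inr (by simp))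
  have := ha.add (ENNReal.Tendsto.const_mul (a := ENNReal.ofReal K) ((hp.add h₃).add h₂)
    (Or.inr ENNReal.ofReal_ne_top))
  simpa using this

/-- Markov's inequality is applied to the measurable majorant: for a non-measurable `D` the lower
integral would not control the outer measure of the event. -/
theorem measure_le_of_le_ae {Ω : Type*} [MeasurableSpace Ω] {Q : Measure Ω} {D B : Ω → ℝ≥0∞}
    (hB : Measurable B) (h : ∀ᵐ ω ∂Q, D ω ≤ B ω) {ε : ℝ≥0∞} (h0 : ε ≠ 0) (ht : ε ≠ ⊤) :
    Q {ω | ε ≤ D ω} ≤ (∫⁻ ω, B ω ∂Q) / ε := by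
  refine le_trans (measure_mono_ae ?_) (meas_ge_le_lintegral_div hB.aemeasurable h0 ht)
  filter_upwards [h] with ω hω hε
  exact le_trans hε hω

end CenteredBootstrap

end

theorem mainTheorem5 :
    ∃ K : ℝ, 0 < K ∧
      ∀ (d : ℕ → ℕ) (P : ∀ n, Measure (Fin (d n) → ℝ)) [∀ n, IsProbabilityMeasure (P n)]
        (Ω : ℕ → Type*) [∀ n, MeasurableSpace (Ω n)]
        (Q : ∀ n, Measure (Ω n)) [∀ n, IsProbabilityMeasure (Q n)]
        (X Y Z : ∀ n, Ω n → Sample n (d n)) (g f : ∀ n, Sample n (d n) → ℝ),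
        (∀ n, IsBootstrapRow (Q n) (P n) (X n) (Y n) (Z n)) →
        (∀ n, MemLp id 12 (P n)) →
        (∀ n, Measurable (g n)) →
        (∀ n, ContDiff ℝ 3 (f n)) →
        Tendsto (fun n => approxError (Q n) (P n) (X n) (Y n) (Z n) (f n) (g n)) atTop (𝓝 0) →
        Tendsto (fun n => R1 (Q n) (P n) (X n) (Y n) (Z n) (f n)) atTop (𝓝 0) →
        Tendsto (fun n => R2 (Q n) (P n) (X n) (Y n) (Z n) (f n)) atTop (𝓝 0) →
        Tendsto (fun n => R3 (Q n) (P n) (X n) (Y n) (Z n) (f n)) atTop (𝓝 0) →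
        -- the bound with the absolute constant, in particular for all large `n`
        (∀ n, 1 ≤ n → R2 (Q n) (P n) (X n) (Y n) (Z n) (f n) ≤ (n : ℝ≥0∞) ^ (1 / 4 : ℝ) →
          ∫⁻ ω, bootDist (Q n) (P n) (X n) (Y n) (Z n) (g n) ω ∂(Q n) ≤
            bound (Q n) (P n) (X n) (Y n) (Z n) (f n) (g n) K) ∧
        -- the bound for all `n`, with a constant that does not depend on `n`
        (∃ K' : ℝ, 0 < K' ∧
          (∀ n, 1 ≤ n →
            ∫⁻ ω, bootDist (Q n) (P n) (X n) (Y n) (Z n) (g n) ω ∂(Q n) ≤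
              bound (Q n) (P n) (X n) (Y n) (Z n) (f n) (g n) K') ∧
          Tendsto (fun n => bound (Q n) (P n) (X n) (Y n) (Z n) (f n) (g n) K') atTop (𝓝 0)) ∧
        -- consistency, in `L_1` and in probability
        Tendsto (fun n => ∫⁻ ω, bootDist (Q n) (P n) (X n) (Y n) (Z n) (g n) ω ∂(Q n))
          atTop (𝓝 0) ∧
        ∀ ε : ℝ≥0∞, 0 < ε →
          Tendsto (fun n => Q n {ω | ε ≤ bootDist (Q n) (P n) (X n) (Y n) (Z n) (g n) ω})
            atTop (𝓝 0) := by
  -- The case C = 1, since R_2 ≤ n^{1/4} means n^{-1/2} R_2² ≤ 1.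
  refine ⟨60 * (1 + 1), by norm_num, ?_⟩
  intro d P _ Ω _ Q _ X Y Z g f hrow hP hg hf h0 h1 h2 h3
  have habs : ∀ n, 1 ≤ n → R2 (Q n) (P n) (X n) (Y n) (Z n) (f n) ≤ (n : ℝ≥0∞) ^ (1 / 4 : ℝ) →
      ∃ B : Ω n → ℝ≥0∞, Measurable B ∧
        (∀ᵐ ω ∂(Q n), bootDist (Q n) (P n) (X n) (Y n) (Z n) (g n) ω ≤ B ω) ∧
        ∫⁻ ω, B ω ∂(Q n) ≤ bound (Q n) (P n) (X n) (Y n) (Z n) (f n) (g n) (60 * (1 + 1)) := by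
    intro n hn hr
    have : NeZero n := ⟨by omega⟩
    exact (hrow n).exists_bootDist_le_bound (hP n) (hg n) (hf n) zero_le_one
      (by simpa using rpow_neg_half_mul_sq_le_one hr)
  -- From `N` on, R_2 ≤ 1 ≤ n^{1/4} and the absolute constant serves. The finitely many earlier rows
  -- are covered by adding the sum of their R_2² to the constant.
  obtain ⟨N, hN⟩ := eventually_atTop.1 (h2.eventually_le_const zero_lt_one)
  set s : ℕ → ℝ := fun n => (R2 (Q n) (P n) (X n) (Y n) (Z n) (f n)).toReal ^ 2
  have hs : ∀ n, 0 ≤ s n := fun n => sq_nonneg _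
  have hsum : 0 ≤ ∑ m ∈ Finset.range N, s m := Finset.sum_nonneg fun m _ => hs m
  set K' : ℝ := 60 * (1 + 1) + 60 * ∑ m ∈ Finset.range N, s m with hK'
  have hall : ∀ n, 1 ≤ n → ∃ B : Ω n → ℝ≥0∞, Measurable B ∧
      (∀ᵐ ω ∂(Q n), bootDist (Q n) (P n) (X n) (Y n) (Z n) (g n) ω ≤ B ω) ∧
      ∫⁻ ω, B ω ∂(Q n) ≤ bound (Q n) (P n) (X n) (Y n) (Z n) (f n) (g n) K' := by
    intro n hn
    have : NeZero n := ⟨by omega⟩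
    rcases lt_or_ge n N with h | h
    · refine (hrow n).exists_bootDist_le_bound_R2 (hP n) (hg n) (hf n) ?_
      have : s n ≤ ∑ m ∈ Finset.range N, s m :=
        Finset.single_le_sum (fun m _ => hs m) (Finset.mem_range.2 h)
      change 60 * (1 + s n) ≤ K'
      linarith
    · obtain ⟨B, b1, b2, b3⟩ := habs n hn
        ((hN n h).trans (one_le_natCast_rpow (by norm_num)))
      exact ⟨B, b1, b2, b3.trans (bound_mono (by linarith))⟩
  have hlim : Tendsto (fun n => bound (Q n) (P n) (X n) (Y n) (Z n) (f n) (g n) K') atTop (𝓝 0) :=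
    tendsto_rate h0 h1 h2 h3 K'
  have hint : ∀ n, 1 ≤ n → ∫⁻ ω, bootDist (Q n) (P n) (X n) (Y n) (Z n) (g n) ω ∂(Q n) ≤
      bound (Q n) (P n) (X n) (Y n) (Z n) (f n) (g n) K' := by
    intro n hn
    obtain ⟨B, _, b2, b3⟩ := hall n hn
    exact (lintegral_mono_ae b2).trans b3
  refine ⟨?_, ⟨K', by linarith, hint, hlim⟩, ?_, ?_⟩
  · intro n hn hr
    obtain ⟨B, _, b2, b3⟩ := habs n hn hr
    exact (lintegral_mono_ae b2).trans b3
  · exact tendsto_of_tendsto_of_tendsto_of_le_of_le' tendsto_const_nhds hlim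
      (Eventually.of_forall fun n => zero_le) ((eventually_ge_atTop 1).mono hint)
  · intro ε hε
    -- The level `ε` may be ⊤, by which Markov's inequality cannot divide; lowering it to `min ε 1`
    -- only enlarges the event.
    have hδ0 : min ε 1 ≠ 0 := (lt_min hε zero_lt_one).ne'
    have hδt : min ε 1 ≠ ⊤ := ne_top_of_le_ne_top ENNReal.one_ne_top (min_le_right _ _)
    have hdiv := ENNReal.Tendsto.div_const hlim (Or.inr hδ0)
    rw [ENNReal.zero_div] at hdiv
    refine tendsto_of_tendsto_of_tendsto_of_le_of_le' tendsto_const_nhds hdiv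
      (Eventually.of_forall fun n => zero_le) ((eventually_ge_atTop 1).mono fun n hn => ?_)
    obtain ⟨B, b1, b2, b3⟩ := hall n hn
    calc Q n {ω | ε ≤ bootDist (Q n) (P n) (X n) (Y n) (Z n) (g n) ω}
        ≤ Q n {ω | min ε 1 ≤ bootDist (Q n) (P n) (X n) (Y n) (Z n) (g n) ω} :=
          measure_mono fun ω (hω : ε ≤ _) => (min_le_left _ _).trans hω
      _ ≤ (∫⁻ ω, B ω ∂(Q n)) / min ε 1 := measure_le_of_le_ae b1 b2 hδ0 hδt
      _ ≤ _ := ENNReal.div_le_div_right b3 _
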